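/- **The chain.** Let $L\ge 2$ be even, $\nu\in\{1,\dots,L\}$, and on $(\mathbb C^2)^{\otimes L}$ let $$H_h=-\tfrac14\sum_{n=1}^{L}\big(\sigma^x_n\sigma^x_{n+1}+\sigma^y_n\sigma^y_{n+1}\big)-h\,\sigma^z_\nu ,$$ with the parity-antiperiodic boundary condition $\sigma^{\pm}_{L+1}=-(-1)^{\mathcal N}\sigma^{\pm}_1$, where $\sigma_n^\pm=(\sigma_n^x\pm i\sigma_n^y)/2$ and $\mathcal N=\sum_{n=1}^L\sigma_n^+\sigma_n^-$. Put $Z_L(\beta,h)=\mathrm{Tr}\,e^{-\beta H_h}$ and $\zeta_L(\beta,h)=Z_L(\beta,h)/Z_L(\beta,0)$, with $\beta>0$ and $h\in\mathbb R$. Let $$F_L(z)=1+\frac{2h}{L}\sum_q\frac1{z+\cos q},\qquad q=\pm\frac{(2n+1)\pi}{L},\quad n=0,\dots,\tfrac L2-1,$$ and let $(z^2-1)^{1/2}$ denote the analytic continuation from $(1,\infty)$ to $\mathbb C\setminus[-1,1]$. For a set $S\subset\mathbb C$ a *contour around $S$* is a closed (e.g. piecewise $C^1$) curve $C$ that avoids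 $S$, has winding number $1$ about every point of $S$, and lies in $\mathbb C\setminus\{iy: |y|\ge\pi/\beta\}$, so that it does not go around the zeros of $1+e^{-\beta z}$; $\log(1+e^{-\beta z})$ is the branch which is holomorphic on that domain and real on $\mathbb R$. For a (normalized) partition function $Z$ put $m=\beta^{-1}\partial_h\log Z$ and $\chi=\partial_h m=\beta^{-1}\partial_h^2\log Z$. **The chain with impurity.** On $(\mathbb C^2)^{\otimes L}\otimes\mathbb C^2$, with Pauli matrices $\tau$ acting on the last factor, let $H_{\lambda,h}=H_0-h(\sigma^z_\nu+\tau^z)-\lambda\sigma_\nu^z\tau^z$, where $\lambda\in\mathbb R$ and $H_0$ is $H_h$ at $h=0$. Let $Z^{int}_L(\beta,h,\lambda)=\mathrm{Tr}\,e^{-\beta H_{\lambda,h}}$, with magnetization $m_L^{int}$ and susceptibility $\chi^{int}_L$ defined by the same $h$-derivatives. **Theorem.** 1. $\zeta_L(\beta,h)>0$, and for every contour $C$ around the set of all zeros and poles of $F_L$, $$\log\zeta_L(\beta,h)=-\beta h+\frac1{2\pi i}\oint_C\log(1+e^{-\beta z})\,\frac{\partial_zF_L(z)}{F_L(z)}\,dz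 .$$ Moreover $Z_L(\beta,0)\le e^{C_\beta L}$ with $C_\beta$ independent of $L$. 2. For $z\notin[-1,1]$, $\displaystyle\lim_{L\to\infty}F_L(z)=1+\frac{2h}\pi\int_0^\pi\frac{dq}{z+\cos q}=1+\frac{2h}{(z^2-1)^{1/2}}$. 3. As $L\to\infty$ along even $L$ (with $\nu=\nu_L$ arbitrary), $\zeta_L(\beta,h)$ converges to a limit $\zeta(\beta,h)>0$ which is smooth and even in $h$, and $m_L$, $\chi_L$ converge to the magnetization $m(\beta,h)$ and susceptibility $\chi(\beta,h)$ of $\zeta$. For every contour $C$ around $[-1,\sqrt{1+4h^2}]$ (if $h\le 0$) or $[-\sqrt{1+4h^2},1]$ (if $h>0$), $$\log\zeta(\beta,h)=-\beta h+\frac{\beta}{2\pi i}\oint_C\frac{dz}{1+e^{\beta z}}\log\Big(1+\frac{2h}{(z^2-1)^{1/2}}\Big),$$ $$m(\beta,h)=-1+\frac1{\pi i}\oint_C\frac{1}{1+e^{\beta z}}\,\frac{dz}{(z^2-1)^{1/2}+2h},$$ $$\chi(\beta,h)=-\frac2{\pi i}\oint_C\frac{1}{1+e^{\beta z}}\,\frac{dz}{\big((z^2-1)^{1/2}+2h\big)^2}.$$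 In particular $\chi(\beta,0)=\dfrac{2\sinh\beta}{1+\cosh\beta}$. 4. As $\beta\to\infty$, $m(\beta,h)\to\dfrac{2h}{\sqrt{1+4h^2}}$ and $\chi(\beta,h)\to\dfrac{2}{(1+4h^2)^{3/2}}$. 5. As $L\to\infty$ along even $L$, for all $\beta>0$ and $h,\lambda\in\mathbb R$, $$\frac{Z_L^{int}(\beta,h,\lambda)}{Z_L(\beta,0)}\to\zeta^{int}(\beta,h,\lambda)=e^{\beta h}\zeta(\beta,h+\lambda)+e^{-\beta h}\zeta(\beta,h-\lambda),$$ and $m^{int}_L$, $\chi_L^{int}$ converge to the magnetization $m^{int}$ and susceptibility $\chi^{int}$ of $\zeta^{int}$. At zero field $$\chi^{int}(\beta,0)=\chi(\beta,\lambda)+\beta\,\big(m(\beta,\lambda)+1\big)^2 .$$ (Since $\chi$ is even and $m$ is odd in the field, this is $\chi(\beta,|\lambda|)+\beta(m(\beta,|\lambda|)+1)^2$ for $\lambda\ge0$ and $\chi(\beta,|\lambda|)+\beta(m(\beta,|\lambda|)-1)^2$ for $\lambda\le0$.) 6. For every $\lambda\in\mathbb R$, of either sign, $\chi^{int}(\beta,0)\to+\infty$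 as $\beta\to\infty$. Hence there is no Kondo effect: it is not the case that for every antiferromagnetic coupling ($\lambda<0$) the susceptibility $\chi^{int}(\beta,h)$ has, for small $h$, a limit as $\beta\to\infty$ which is positive at $h=0$ and continuous as $h\to0$, while $\chi^{int}(\beta,0)$ diverges as $\beta\to\infty$ for every ferromagnetic coupling ($\lambda>0$). -/

import Mathlib

open Filter Topology
open scoped Kronecker

namespace XYChain

noncomputable section

/-! ### The spin chain -/

/-- Spin configurations of `L` sites; `0` is spin up (`σᶻ = 1`), `1` is spin down (`σᶻ = -1`). -/
abbrev Config (L : ℕ) : Type := Fin L → Fin 2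

def pauliX : Matrix (Fin 2) (Fin 2) ℂ := !![0, 1; 1, 0]

def pauliY : Matrix (Fin 2) (Fin 2) ℂ := !![0, -Complex.I; Complex.I, 0]

def pauliZ : Matrix (Fin 2) (Fin 2) ℂ := !![1, 0; 0, -1]

/-- The operator on `(ℂ²)^{⊗ L}` which acts as `A` on site `n` and as the identity elsewhere. -/
def siteOp {L : ℕ} (n : Fin L) (A : Matrix (Fin 2) (Fin 2) ℂ) :
    Matrix (Config L) (Config L) ℂ :=
  Matrix.of fun s t => if ∀ m, m ≠ n → s m = t m then A (s n) (t n) else 0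

/-- `(-1)^N`, where `N = ∑ₙ σₙ⁺ σₙ⁻` is the number of sites with spin up. -/
def parityOp (L : ℕ) : Matrix (Config L) (Config L) ℂ :=
  Matrix.diagonal fun s => (-1 : ℂ) ^ (Finset.univ.filter fun n => s n = 0).card

/-- `σ_{n+1}` for a Pauli matrix `A = σˣ` or `A = σʸ`, where for the last site the
parity-antiperiodic convention `σ_{L+1}^± = -(-1)^N σ_1^±` is used. It is linear, so that it
reads the same for `σˣ = σ⁺ + σ⁻` and for `σʸ = -i (σ⁺ - σ⁻)`. Sites are numbered from `0`. -/
def nextSiteOp {L : ℕ} (n : Fin L) (A : Matrix (Fin 2) (Fin 2) ℂ) :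
    Matrix (Config L) (Config L) ℂ :=
  if h : n.val + 1 < L then siteOp ⟨n.val + 1, h⟩ A
  else -(parityOp L * siteOp ⟨0, lt_of_le_of_lt (Nat.zero_le _) n.isLt⟩ A)

/-- `H₀ = -(1/4) ∑ₙ (σₙˣ σₙ₊₁ˣ + σₙʸ σₙ₊₁ʸ)` with parity-antiperiodic boundary conditions. -/
def freeHamiltonian (L : ℕ) : Matrix (Config L) (Config L) ℂ :=
  (-(1 / 4) : ℂ) • ∑ n : Fin L,
    (siteOp n pauliX * nextSiteOp n pauliX + siteOp n pauliY * nextSiteOp n pauliY)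

/-- `H_h = H₀ - h σ_ν^z`. -/
def chainHamiltonian (L : ℕ) (ν : Fin L) (h : ℝ) : Matrix (Config L) (Config L) ℂ :=
  freeHamiltonian L - (h : ℂ) • siteOp ν pauliZ

/-- `Z_L(β,h) = Tr e^{-β H_h}` (a real number, since `H_h` is Hermitian). -/
def chainPartition (L : ℕ) (ν : Fin L) (β h : ℝ) : ℝ :=
  (Matrix.trace (NormedSpace.exp (-(β : ℂ) • chainHamiltonian L ν h))).re

/-- `ζ_L(β,h) = Z_L(β,h) / Z_L(β,0)`. -/
def chainZeta (L : ℕ) (ν : Fin L) (β h : ℝ) : ℝ :=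
  chainPartition L ν β h / chainPartition L ν β 0

/-- `H₀ - h (σ_ν^z + τ^z) - lam σ_ν^z τ^z`; the second tensor factor is the impurity spin. -/
def impurityHamiltonian (L : ℕ) (ν : Fin L) (lam h : ℝ) :
    Matrix (Config L × Fin 2) (Config L × Fin 2) ℂ :=
  freeHamiltonian L ⊗ₖ (1 : Matrix (Fin 2) (Fin 2) ℂ)
    - (h : ℂ) • (siteOp ν pauliZ ⊗ₖ (1 : Matrix (Fin 2) (Fin 2) ℂ)
        + (1 : Matrix (Config L) (Config L) ℂ) ⊗ₖ pauliZ)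
    - (lam : ℂ) • (siteOp ν pauliZ ⊗ₖ pauliZ)

/-- The partition function of the chain coupled to the impurity. -/
def impurityPartition (L : ℕ) (ν : Fin L) (β lam h : ℝ) : ℝ :=
  (Matrix.trace (NormedSpace.exp (-(β : ℂ) • impurityHamiltonian L ν lam h))).re

/-- `m = β⁻¹ ∂_h log Z` for a (normalized) partition function `Z` of the field. -/
def magnetization (Z : ℝ → ℝ) (β h : ℝ) : ℝ :=
  β⁻¹ * deriv (fun x => Real.log (Z x)) h

/-- `χ = ∂_h m = β⁻¹ ∂_h² log Z`. -/
def susceptibility (Z : ℝ → ℝ) (β h : ℝ) : ℝ :=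
  deriv (fun x => magnetization Z β x) h

/-- The Kondo effect for a susceptibility `X lam β h` (coupling, inverse temperature, field):
for every antiferromagnetic coupling `lam < 0` the zero temperature limit exists for all small
fields, is positive at `h = 0` and continuous as `h → 0`, while for every ferromagnetic coupling
`lam > 0` the zero field susceptibility diverges at zero temperature. -/
def ExhibitsKondoEffect (X : ℝ → ℝ → ℝ → ℝ) : Prop :=
  (∀ lam : ℝ, lam < 0 → ∃ X₀ : ℝ → ℝ,
      (∀ᶠ h in 𝓝 (0 : ℝ), Tendsto (fun β => X lam β h) atTop (𝓝 (X₀ h))) ∧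
      0 < X₀ 0 ∧ ContinuousAt X₀ 0) ∧
  ∀ lam : ℝ, 0 < lam → Tendsto (fun β => X lam β 0) atTop atTop

/-! ### The function `F` -/

/-- The positive momenta `(2n+1)π/L`; the set of all momenta is `{±momentum L n : n < L/2}`. -/
def momentum (L n : ℕ) : ℝ := (2 * (n : ℝ) + 1) * Real.pi / L

/-- `F_L(z) = 1 + (2h/L) ∑_q 1/(z + cos q)`, the sum over all `L` momenta `q`. -/
def finiteF (L : ℕ) (h : ℝ) (z : ℂ) : ℂ :=
  1 + (2 * h / L : ℂ) * ∑ n ∈ Finset.range (L / 2),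
    (1 / (z + (Real.cos (momentum L n) : ℂ)) + 1 / (z + (Real.cos (-momentum L n) : ℂ)))

/-- The zeros and the poles of `F_L`. -/
def finiteSingularities (L : ℕ) (h : ℝ) : Set ℂ :=
  {z | finiteF L h z = 0} ∪ {z | ∃ n < L / 2, z = -(Real.cos (momentum L n) : ℂ)}

/-- The analytic continuation of `(z² - 1)^{1/2}` from `(1, ∞)` to `ℂ ∖ [-1, 1]`. -/
def sqrtBranch (z : ℂ) : ℂ := (z - 1) ^ (1 / 2 : ℂ) * (z + 1) ^ (1 / 2 : ℂ)

/-- `[-1, √(1+4h²)]` if `h ≤ 0` and `[-√(1+4h²), 1]` if `h > 0`, as a subset of `ℂ`. -/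
def limitInterval (h : ℝ) : Set ℂ :=
  Complex.ofReal '' (if h ≤ 0 then Set.Icc (-1) (Real.sqrt (1 + 4 * h ^ 2))
    else Set.Icc (-Real.sqrt (1 + 4 * h ^ 2)) 1)

/-! ### Contours -/

/-- `γ` restricted to `[0,1]` is a closed curve, differentiable except at finitely many points,
with integrable velocity (in particular every piecewise `C¹` closed curve). -/
structure IsClosedCurve (γ : ℝ → ℂ) : Prop where
  continuousOn : ContinuousOn γ (Set.Icc 0 1)
  closed : γ 0 = γ 1
  differentiable : ∃ s : Set ℝ, s.Finite ∧ ∀ t ∈ Set.Ioo (0 : ℝ) 1, t ∉ s → DifferentiableAt ℝ γ t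
  integrable : IntervalIntegrable (deriv γ) MeasureTheory.volume 0 1

/-- `∮_γ f(z) dz`. -/
def contourIntegral (γ : ℝ → ℂ) (f : ℂ → ℂ) : ℂ :=
  ∫ t in (0 : ℝ)..1, f (γ t) * deriv γ t

def windingNumber (γ : ℝ → ℂ) (w : ℂ) : ℂ :=
  (2 * Real.pi * Complex.I)⁻¹ * contourIntegral γ (fun z => (z - w)⁻¹)

/-- The plane without the two rays of the imaginary axis that start at `±iπ/β`; all zeros of
`1 + e^{-βz}` are on these rays. -/
def thermalDomain (β : ℝ) : Set ℂ := {z | z.re = 0 → |z.im| < Real.pi / β}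

/-- The branch of `log (1 + e^{-βz})` which is holomorphic on `thermalDomain β` and real on the
real axis. -/
def logOnePlusExp (β : ℝ) (z : ℂ) : ℂ :=
  if 0 ≤ z.re then Complex.log (1 + Complex.exp (-(β * z)))
  else -(β * z) + Complex.log (1 + Complex.exp (β * z))

/-- A closed curve which goes once, counterclockwise, around every point of `S`, but not around
the zeros of `1 + e^{-βz}`. -/
structure IsThermalContour (β : ℝ) (S : Set ℂ) (γ : ℝ → ℂ) : Prop where
  curve : IsClosedCurve γ
  mem_domain : ∀ t ∈ Set.Icc (0 : ℝ) 1, γ t ∈ thermalDomain β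
  avoids : ∀ t ∈ Set.Icc (0 : ℝ) 1, γ t ∉ S
  encloses : ∀ w ∈ S, windingNumber γ w = 1

end

end XYChain

/-! ### Traces of exponentials of quadratic fermion operators -/

namespace XYChain

open Matrix

section CAR

variable {X : Type*} [Fintype X] [DecidableEq X]

/-! The chain is a system of free fermions. Jordan–Wigner strings turn the spins into operators
satisfying the canonical anticommutation relations (`isCAR_fermi`), and the parity factor in the
boundary condition cancels the string around the ring, so that the fermions are antiperiodic
whatever their number. By `chainHamiltonian_eq`, H_h is the constant h plus the second quantization
of an L × L matrix A_h = A_0 - 2h|ν⟩⟨ν|, and the trace factorizes: Z_L = e^{-βh} ∏ (1 + e^{-βε_k})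
over the eigenvalues ε_k of A_h.

The field is a rank-one perturbation of A_0. By the matrix determinant lemma the quotient of the two
characteristic polynomials is 1 + 2h⟨ν|(z - A_0)⁻¹|ν⟩, which is F_L (`prod_energy_eq`). A sum of f
over the spectrum of A_h, minus the same sum for A_0, is therefore a contour integral of f F_L'/F_L.
Taking f = log(1 + e^{-βz}) gives the formula in finite volume.

With w = z - (z²-1)^{1/2}, so that |w| < 1 off the cut, the diagonal resolvent is (z²-1)^{-1/2} (1 -
w^L)/(1 + w^L) (`freeGreen_eq`), and it converges uniformly on compact sets off the cut. Off
`limitInterval h` neither 1 + 2hG_L nor its limit is real and nonpositive (`finiteF_mem_slitPlane`,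
`limitF_mem_slitPlane`). Hence one can integrate by parts with the principal logarithm, and one
contour serves all L and all nearby fields. The limit L → ∞ and two h-derivatives pass under the
integral.

The limit itself is explicit. Since log(1 + e^{-βz}) + βz/2 is even, on a centrally symmetric
contour only F(z)F(-z) = (z² - r²)/(z² - 1) matters, with r² = 1 + 4h². This is rational, and
residues give ζ = cosh(βr/2)/cosh(β/2) (`contourIntegral_even`). Smoothness, evenness and the limits
β → ∞ are read off from it.

The impurity spin τᶻ is conserved, so the coupled partition function is a sum of two chain partition
functions in the fields h ± λ. At h = 0 the two sectors have equal weight and opposite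
magnetizations ±(m + 1), whose variance contributes β(m + 1)² to χ. Since m tends to 2λ/√(1+4λ²) >
-1, this diverges for either sign of λ. -/

theorem exp_smul_of_isIdempotentElem {N : Matrix X X ℂ} (hN : N * N = N) (c : ℂ) :
    NormedSpace.exp (c • N) = 1 + (Complex.exp c - 1) • N := by
  have hpow : ∀ n : ℕ, N ^ (n + 1) = N := by
    intro n
    induction n with
    | zero => simp
    | succ n ih => rw [pow_succ, ih, hN]
  have h1 : HasSum (fun n : ℕ => ((n.factorial : ℂ)⁻¹ * c ^ n) • N) (Complex.exp c • N) := by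
    have := NormedSpace.exp_series_hasSum_exp' (𝕂 := ℂ) c
    rw [← Complex.exp_eq_exp_ℂ] at this
    simpa [smul_eq_mul] using this.smul_const N
  -- All powers of N equal N except the zeroth, which is 1; this series corrects that single term.
  have h2 : HasSum (fun n : ℕ => if n = 0 then 1 - N else 0) (1 - N) := hasSum_ite_eq 0 (1 - N)
  rw [NormedSpace.exp_eq_tsum ℂ]
  have h3 := (h1.add h2).tsum_eq
  have h4 : (1 : Matrix X X ℂ) + (Complex.exp c - 1) • N = Complex.exp c • N + (1 - N) := by
    rw [sub_smul, one_smul]; abel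
  rw [h4, ← h3]
  refine tsum_congr fun n => ?_
  cases n with
  | zero => simp
  | succ n => simp [smul_pow, hpow, smul_smul]

/-- The canonical anticommutation relations for `b i` and adjoints `bd i`. -/
structure IsCAR {L : ℕ} (b bd : Fin L → Matrix X X ℂ) : Prop where
  ann_ann : ∀ i j, b i * b j + b j * b i = 0
  cre_cre : ∀ i j, bd i * bd j + bd j * bd i = 0
  ann_cre : ∀ i j, b i * bd j + bd j * b i = if i = j then 1 else 0

/-- Anticommutators are bilinear, so only the mixed relation constrains the coefficients, through
the entries of `W * V`. Unitarity is not needed, because `bd` is not assumed to be the adjoint of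
`b`. -/
theorem IsCAR.transform {L : ℕ} {b bd : Fin L → Matrix X X ℂ} (hb : IsCAR b bd)
    {V W : Matrix (Fin L) (Fin L) ℂ} (hVW : W * V = 1) :
    IsCAR (fun k => ∑ j, W k j • b j) (fun k => ∑ j, V j k • bd j) := by
  have key : ∀ (x y : Fin L → Matrix X X ℂ) (u v : Fin L → ℂ),
      (∑ i, u i • x i) * (∑ j, v j • y j) + (∑ j, v j • y j) * (∑ i, u i • x i) =
        ∑ i, ∑ j, (u i * v j) • (x i * y j + y j * x i) := by
    intro x y u v
    rw [Finset.sum_mul_sum, Finset.sum_mul_sum, Finset.sum_comm (γ := Fin L) (s := Finset.univ)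
      (f := fun j i => v j • y j * u i • x i)]
    simp only [← Finset.sum_add_distrib, smul_add, smul_mul_smul_comm, mul_comm]
  refine ⟨fun i j => ?_, fun i j => ?_, fun i j => ?_⟩
  · rw [key]; simp [hb.ann_ann]
  · rw [key]; simp [hb.cre_cre]
  · rw [key]
    simp only [hb.ann_cre, smul_ite, smul_zero, Finset.sum_ite_eq, Finset.mem_univ, if_true]
    rw [← Finset.sum_smul]
    have := congrFun (congrFun hVW i) j
    rw [mul_apply] at this
    rw [this, one_apply]
    split_ifs <;> simp

theorem IsCAR.number_mul_self {L : ℕ} {b bd : Fin L → Matrix X X ℂ} (hb : IsCAR b bd) (k : Fin L) :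
    bd k * b k * (bd k * b k) = bd k * b k := by
  have h0 : b k * b k = 0 := by
    have := hb.ann_ann k k
    rw [← two_smul ℂ] at this
    exact (smul_eq_zero.mp this).resolve_left two_ne_zero
  have h1 : b k * bd k = 1 - bd k * b k := by
    have := hb.ann_cre k k
    rw [if_pos rfl] at this
    exact eq_sub_of_add_eq this
  calc bd k * b k * (bd k * b k) = bd k * (b k * bd k) * b k := by simp only [mul_assoc]
    _ = bd k * b k - bd k * (bd k * (b k * b k)) := by rw [h1]; noncomm_ring
    _ = _ := by rw [h0]; simp

/-- Passing a bilinear of another mode costs two minus signs. -/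
theorem IsCAR.commute_number {L : ℕ} {b bd : Fin L → Matrix X X ℂ} (hb : IsCAR b bd)
    {k j : Fin L} (hkj : k ≠ j) :
    Commute (b k) (bd j * b j) ∧ Commute (bd k) (bd j * b j) := by
  have h1 : b k * bd j = -(bd j * b k) := by
    have := hb.ann_cre k j
    rw [if_neg hkj] at this
    exact eq_neg_of_add_eq_zero_left this
  have h2 : b j * bd k = -(bd k * b j) := by
    have := hb.ann_cre j k
    rw [if_neg hkj.symm] at this
    exact eq_neg_of_add_eq_zero_left this
  have h3 : b k * b j = -(b j * b k) := eq_neg_of_add_eq_zero_left (hb.ann_ann k j)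
  have h4 : bd k * bd j = -(bd j * bd k) := eq_neg_of_add_eq_zero_left (hb.cre_cre k j)
  constructor
  · calc b k * (bd j * b j) = (b k * bd j) * b j := by rw [mul_assoc]
      _ = -(bd j * (b k * b j)) := by rw [h1]; noncomm_ring
      _ = bd j * b j * b k := by rw [h3]; noncomm_ring
  · calc bd k * (bd j * b j) = (bd k * bd j) * b j := by rw [mul_assoc]
      _ = -(bd j * (bd k * b j)) := by rw [h4]; noncomm_ring
      _ = bd j * (b j * bd k) := by rw [h2]; noncomm_ring
      _ = bd j * b j * bd k := by rw [mul_assoc]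

/-- The modes are peeled off one at a time. The trace gives an occupied and an empty mode equal
weight, so each contributes the average of 1 and e^c. No occupation-number basis is needed, and the
space carrying the relations may have any finite dimension. -/
theorem IsCAR.trace_exp_sum {L : ℕ} {b bd : Fin L → Matrix X X ℂ} (hb : IsCAR b bd)
    (c : Fin L → ℂ) (S : Finset (Fin L)) :
    trace (NormedSpace.exp (∑ k ∈ S, c k • (bd k * b k))) =
      Fintype.card X * ∏ k ∈ S, ((1 + Complex.exp (c k)) / 2) := by
  induction S using Finset.induction_on with
  | empty => simp
  | insert k S hk ih =>
    set Y := ∑ j ∈ S, c j • (bd j * b j) with hY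
    have hcb : Commute (b k) Y := Commute.sum_right _ _ _ fun j hj =>
      ((hb.commute_number (by rintro rfl; exact hk hj)).1).smul_right _
    have hcbd : Commute (bd k) Y := Commute.sum_right _ _ _ fun j hj =>
      ((hb.commute_number (by rintro rfl; exact hk hj)).2).smul_right _
    have hcE : Commute (b k) (NormedSpace.exp Y) := hcb.exp_right
    rw [Finset.sum_insert hk, Finset.prod_insert hk, ← hY,
      Matrix.exp_add_of_commute _ _ ((hcbd.mul_left hcb).smul_left _),
      exp_smul_of_isIdempotentElem (hb.number_mul_self k)]
    have h1 : b k * bd k = 1 - bd k * b k := by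
      have := hb.ann_cre k k
      rw [if_pos rfl] at this
      exact eq_sub_of_add_eq this
    -- Cyclicity moves `bd k` behind `b k`, and the anticommutation relation then gives x = T - x,
    -- where T is the full trace.
    have htr : trace (bd k * b k * NormedSpace.exp Y) = trace (NormedSpace.exp Y) / 2 := by
      have : trace (bd k * b k * NormedSpace.exp Y) =
          trace (NormedSpace.exp Y) - trace (bd k * b k * NormedSpace.exp Y) := by
        calc trace (bd k * b k * NormedSpace.exp Y)
            = trace (bd k * (NormedSpace.exp Y * b k)) := by rw [mul_assoc, hcE.eq]
          _ = trace (NormedSpace.exp Y * (b k * bd k)) := by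
              rw [trace_mul_comm, mul_assoc]
          _ = _ := by
              rw [h1, mul_sub, mul_one, trace_sub, trace_mul_comm _ (bd k * b k)]
      linear_combination this / 2
    rw [add_mul, one_mul, smul_mul_assoc, trace_add, trace_smul, htr, ih, smul_eq_mul]
    ring

/-- The second quantization of a one-particle operator. -/
noncomputable def secondQuantization {L : ℕ} (a ad : Fin L → Matrix X X ℂ)
    (A : Matrix (Fin L) (Fin L) ℂ) : Matrix X X ℂ :=
  ∑ i, ∑ j, A i j • (ad i * a j)

/-- Diagonalizing the one-particle matrix turns the quadratic operator into a weighted sum of number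
operators of the transformed modes. -/
theorem secondQuantization_diagonalize {L : ℕ} (a ad : Fin L → Matrix X X ℂ)
    (V W : Matrix (Fin L) (Fin L) ℂ) (d : Fin L → ℂ) :
    secondQuantization a ad (V * diagonal d * W) =
      ∑ k, d k • ((∑ i, V i k • ad i) * (∑ j, W k j • a j)) := by
  simp only [secondQuantization, mul_apply (M := V * diagonal d), mul_diagonal, Finset.sum_mul, Finset.mul_sum,
    Finset.sum_smul, Finset.smul_sum, smul_mul_assoc, mul_smul_comm, smul_smul]
  rw [Finset.sum_congr rfl fun i _ => Finset.sum_comm, Finset.sum_comm]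
  refine Finset.sum_congr rfl fun k _ => ?_
  rw [Finset.sum_comm]
  exact Finset.sum_congr rfl fun j _ => Finset.sum_congr rfl fun i _ => by congr 1; ring

/-- `Tr exp (c dΓ(A))` is a product over the eigenvalues of `A`. -/
theorem IsCAR.trace_exp_secondQuantization {L : ℕ} {a ad : Fin L → Matrix X X ℂ} (ha : IsCAR a ad)
    {A : Matrix (Fin L) (Fin L) ℂ} (hA : A.IsHermitian) (c : ℂ) :
    trace (NormedSpace.exp (c • secondQuantization a ad A)) =
      Fintype.card X * ∏ k, ((1 + Complex.exp (c * hA.eigenvalues k)) / 2) := by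
  set U : Matrix (Fin L) (Fin L) ℂ := (hA.eigenvectorUnitary : Matrix (Fin L) (Fin L) ℂ) with hU
  have h1 : A = U * diagonal (fun k => (hA.eigenvalues k : ℂ)) * star U := by
    have := hA.spectral_theorem
    rw [Unitary.conjStarAlgAut_apply] at this
    exact this
  have h2 : star U * U = 1 := Unitary.coe_star_mul_self hA.eigenvectorUnitary
  rw [← (ha.transform h2).trace_exp_sum (fun k => c * hA.eigenvalues k) Finset.univ]
  conv_lhs => rw [h1, secondQuantization_diagonalize, Finset.smul_sum]
  simp only [smul_smul]

end CAR

end XYChain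

/-! ### The Jordan–Wigner transformation -/

namespace XYChain

open Matrix

variable {L : ℕ}

theorem siteOp_mul_apply (n : Fin L) (A : Matrix (Fin 2) (Fin 2) ℂ)
    (M : Matrix (Config L) (Config L) ℂ) (s t : Config L) :
    (siteOp n A * M) s t = ∑ x, A (s n) x * M (Function.update s n x) t := by
  have himg : (Finset.univ.filter fun u : Config L => ∀ m, m ≠ n → s m = u m) =
      Finset.univ.image (Function.update s n) := by
    ext u
    simp only [Finset.mem_filter, Finset.mem_univ, true_and, Finset.mem_image]
    constructor
    · intro h
      refine ⟨u n, ?_⟩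
      ext m
      by_cases hm : m = n
      · subst hm; simp
      · simp [Function.update_of_ne hm, h m hm]
    · rintro ⟨x, rfl⟩ m hm
      simp [Function.update_of_ne hm]
  rw [mul_apply]
  simp only [siteOp, of_apply, ite_mul, zero_mul]
  rw [← Finset.sum_filter, himg,
    Finset.sum_image fun x _ y _ hxy => Function.update_injective s n hxy]
  simp

theorem siteOp_mul_siteOp (n : Fin L) (A B : Matrix (Fin 2) (Fin 2) ℂ) :
    siteOp n A * siteOp n B = siteOp n (A * B) := by
  -- The factor 1 is inserted so that `siteOp_mul_apply` evaluates every site operator by updating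
  -- one spin.
  have : siteOp n A * (siteOp n B * 1) = siteOp n (A * B) * 1 := by
    ext s t
    simp only [siteOp_mul_apply, Function.update_self]
    simp only [mul_apply (M := A), Finset.sum_mul, Finset.mul_sum]
    rw [Finset.sum_comm]
    refine Finset.sum_congr rfl fun x _ => Finset.sum_congr rfl fun y _ => ?_
    rw [Function.update_idem, mul_assoc]
  simpa using this

theorem siteOp_commute {n m : Fin L} (hnm : n ≠ m) (A B : Matrix (Fin 2) (Fin 2) ℂ) :
    siteOp n A * siteOp m B = siteOp m B * siteOp n A := by
  have : siteOp n A * (siteOp m B * 1) = siteOp m B * (siteOp n A * 1) := by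
    ext s t
    simp only [siteOp_mul_apply, Function.update_of_ne hnm, Function.update_of_ne hnm.symm,
      Finset.mul_sum]
    rw [Finset.sum_comm]
    refine Finset.sum_congr rfl fun x _ => Finset.sum_congr rfl fun y _ => ?_
    rw [Function.update_comm hnm]
    ring
  simpa using this

theorem siteOp_add (n : Fin L) (A B : Matrix (Fin 2) (Fin 2) ℂ) :
    siteOp n (A + B) = siteOp n A + siteOp n B := by
  ext s t
  simp only [siteOp, of_apply, Matrix.add_apply]
  split_ifs <;> simp

theorem siteOp_smul (n : Fin L) (c : ℂ) (A : Matrix (Fin 2) (Fin 2) ℂ) :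
    siteOp n (c • A) = c • siteOp n A := by
  ext s t
  simp [siteOp]

theorem siteOp_neg (n : Fin L) (A : Matrix (Fin 2) (Fin 2) ℂ) :
    siteOp n (-A) = -siteOp n A := by
  simpa using siteOp_smul n (-1) A

theorem siteOp_diagonal (n : Fin L) (d : Fin 2 → ℂ) :
    siteOp n (diagonal d) = diagonal fun s : Config L => d (s n) := by
  ext s t
  simp only [siteOp, of_apply, diagonal_apply]
  by_cases hst : s = t
  · subst hst; simp
  · rw [if_neg hst]
    split_ifs with h h'
    · exact absurd (funext fun m => if hm : m = n then hm ▸ h' else h m hm) hst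
    · rfl
    · rfl

theorem siteOp_one (n : Fin L) : siteOp n 1 = 1 := by
  rw [← diagonal_one, siteOp_diagonal, ← diagonal_one]

theorem siteOp_zero (n : Fin L) : siteOp n (0 : Matrix (Fin 2) (Fin 2) ℂ) = 0 := by
  simpa using siteOp_smul n 0 (0 : Matrix (Fin 2) (Fin 2) ℂ)

/-- The eigenvalue of `-σᶻ`. -/
def flipSign (x : Fin 2) : ℂ := if x = 0 then -1 else 1

/-- The Jordan–Wigner sign of the sites before `m`. -/
def stringSign (m : ℕ) (s : Config L) : ℂ :=
  ∏ j ∈ Finset.univ.filter (fun j : Fin L => j.val < m), flipSign (s j)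

/-- The Jordan–Wigner string of the sites before `m`. -/
def stringOp (L m : ℕ) : Matrix (Config L) (Config L) ℂ := diagonal (stringSign m)

theorem flipSign_mul_self (x : Fin 2) : flipSign x * flipSign x = 1 := by
  unfold flipSign; split_ifs <;> norm_num

theorem stringSign_mul_self (m : ℕ) (s : Config L) : stringSign m s * stringSign m s = 1 := by
  rw [stringSign, ← Finset.prod_mul_distrib]
  exact Finset.prod_eq_one fun j _ => flipSign_mul_self _

theorem stringOp_mul_self (m : ℕ) : stringOp L m * stringOp L m = 1 := by
  rw [stringOp, diagonal_mul_diagonal, ← diagonal_one]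
  congr 1
  exact funext fun s => stringSign_mul_self m s

theorem stringOp_comm (m n : ℕ) : stringOp L m * stringOp L n = stringOp L n * stringOp L m := by
  simp only [stringOp, diagonal_mul_diagonal, mul_comm]

theorem stringOp_succ (n : Fin L) :
    stringOp L (n.val + 1) = stringOp L n * siteOp n (diagonal flipSign) := by
  rw [siteOp_diagonal, stringOp, stringOp, diagonal_mul_diagonal]
  congr 1
  funext s
  have : (Finset.univ.filter fun j : Fin L => j.val < n.val + 1) =
      insert n (Finset.univ.filter fun j : Fin L => j.val < n.val) := by
    ext j
    simp only [Finset.mem_filter, Finset.mem_univ, true_and, Finset.mem_insert, Fin.ext_iff]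
    omega
  rw [stringSign, this, Finset.prod_insert (by simp), mul_comm]
  rfl

/-- The string has a factor -1 for each spin up, and these are the occupied sites. This identity is
what lets the parity in the boundary condition cancel the string that closes the ring. -/
theorem stringOp_length : stringOp L L = parityOp L := by
  rw [stringOp, parityOp]
  congr 1
  funext s
  simp [stringSign, flipSign, Finset.prod_ite]

theorem stringOp_commute {m : ℕ} {n : Fin L} (h : m ≤ n.val) (A : Matrix (Fin 2) (Fin 2) ℂ) :
    stringOp L m * siteOp n A = siteOp n A * stringOp L m := by
  ext s t
  rw [stringOp, diagonal_mul, mul_diagonal]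
  by_cases hst : ∀ j, j ≠ n → s j = t j
  · rw [mul_comm]
    congr 1
    refine Finset.prod_congr rfl fun j hj => ?_
    rw [hst j]
    rintro rfl
    simp at hj
    omega
  · simp [siteOp, hst]

/-- An operator with zero diagonal flips the spin at `n`, and this reverses exactly one factor of a
string that covers `n`. -/
theorem stringOp_anticommute {m : ℕ} {n : Fin L} (h : n.val < m) {A : Matrix (Fin 2) (Fin 2) ℂ}
    (h0 : A 0 0 = 0) (h1 : A 1 1 = 0) :
    stringOp L m * siteOp n A = -(siteOp n A * stringOp L m) := by
  ext s t
  rw [neg_apply, stringOp, diagonal_mul, mul_diagonal]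
  by_cases hst : ∀ j, j ≠ n → s j = t j
  · by_cases hA : A (s n) (t n) = 0
    · simp [siteOp, hA]
    · have hne : flipSign (s n) = -flipSign (t n) := by
        revert hA
        generalize s n = x
        generalize t n = y
        fin_cases x <;> fin_cases y <;> simp [h0, h1, flipSign]
      have hmem : n ∈ Finset.univ.filter (fun j : Fin L => j.val < m) := by simp [h]
      rw [stringSign, stringSign, ← Finset.mul_prod_erase _ _ hmem,
        ← Finset.mul_prod_erase _ _ hmem, hne]
      have : ∏ x ∈ (Finset.univ.filter (fun j : Fin L => j.val < m)).erase n, flipSign (s x) =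
          ∏ x ∈ (Finset.univ.filter (fun j : Fin L => j.val < m)).erase n, flipSign (t x) :=
        Finset.prod_congr rfl fun j hj => by rw [hst j (Finset.ne_of_mem_erase hj)]
      rw [this]
      ring
  · simp [siteOp, hst]

/-- `σ⁺`. -/
def raising : Matrix (Fin 2) (Fin 2) ℂ := !![0, 1; 0, 0]

/-- `σ⁻`. -/
def lowering : Matrix (Fin 2) (Fin 2) ℂ := !![0, 0; 1, 0]

/-- The fermion operator obtained from the operator `A` at the site `n`. -/
def fermi (A : Matrix (Fin 2) (Fin 2) ℂ) (n : Fin L) : Matrix (Config L) (Config L) ℂ :=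
  stringOp L n * siteOp n A

theorem fermi_mul_same (A B : Matrix (Fin 2) (Fin 2) ℂ) (n : Fin L) :
    fermi A n * fermi B n = siteOp n (A * B) := by
  rw [fermi, fermi, stringOp_commute le_rfl B, mul_assoc, ← mul_assoc (siteOp n A),
    siteOp_mul_siteOp, ← stringOp_commute le_rfl, ← mul_assoc, stringOp_mul_self, one_mul]

/-- Only the string of the later site reaches the earlier one, and it supplies the single minus
sign. So only the operator at the earlier site has to be off-diagonal. -/
theorem fermi_anticommute_of_lt {A B : Matrix (Fin 2) (Fin 2) ℂ} (hA0 : A 0 0 = 0)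
    (hA1 : A 1 1 = 0) {n m : Fin L} (h : n < m) :
    fermi A n * fermi B m + fermi B m * fermi A n = 0 := by
  have h1 : fermi A n * fermi B m = -(stringOp L n * stringOp L m * (siteOp n A * siteOp m B)) := by
    rw [fermi, fermi, mul_assoc, ← mul_assoc (siteOp n A), ← neg_eq_iff_eq_neg.mpr
      (stringOp_anticommute h hA0 hA1)]
    noncomm_ring
  have h2 : fermi B m * fermi A n = stringOp L n * stringOp L m * (siteOp n A * siteOp m B) := by
    rw [fermi, fermi, mul_assoc, ← mul_assoc (siteOp m B),
      ← stringOp_commute (le_of_lt h : n.val ≤ m.val), siteOp_commute h.ne, stringOp_comm]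
    simp only [mul_assoc]
  rw [h1, h2, neg_add_cancel]

theorem fermi_anticommute {A B : Matrix (Fin 2) (Fin 2) ℂ} (hA0 : A 0 0 = 0)
    (hA1 : A 1 1 = 0) (hB0 : B 0 0 = 0) (hB1 : B 1 1 = 0) {n m : Fin L} (h : n ≠ m) :
    fermi A n * fermi B m + fermi B m * fermi A n = 0 := by
  rcases lt_or_gt_of_ne h with h | h
  · exact fermi_anticommute_of_lt hA0 hA1 h
  · rw [add_comm]; exact fermi_anticommute_of_lt hB0 hB1 h

theorem lowering_mul_lowering : lowering * lowering = 0 := by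
  ext i j; fin_cases i <;> fin_cases j <;> simp [lowering]

theorem raising_mul_raising : raising * raising = 0 := by
  ext i j; fin_cases i <;> fin_cases j <;> simp [raising]

theorem lowering_raising : lowering * raising + raising * lowering = 1 := by
  ext i j; fin_cases i <;> fin_cases j <;> simp [lowering, raising]

theorem isCAR_fermi : IsCAR (fermi (L := L) lowering) (fermi raising) := by
  refine ⟨fun i j => ?_, fun i j => ?_, fun i j => ?_⟩
  · by_cases h : i = j
    · subst h; rw [fermi_mul_same, lowering_mul_lowering, siteOp_zero, add_zero]
    · exact fermi_anticommute (by simp [lowering]) (by simp [lowering]) (by simp [lowering])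
        (by simp [lowering]) h
  · by_cases h : i = j
    · subst h; rw [fermi_mul_same, raising_mul_raising, siteOp_zero, add_zero]
    · exact fermi_anticommute (by simp [raising]) (by simp [raising]) (by simp [raising])
        (by simp [raising]) h
  · by_cases h : i = j
    · subst h
      rw [fermi_mul_same, fermi_mul_same, ← siteOp_add, lowering_raising, siteOp_one, if_pos rfl]
    · rw [if_neg h]
      exact fermi_anticommute (by simp [lowering]) (by simp [lowering]) (by simp [raising])
        (by simp [raising]) h

theorem siteOp_pauliZ (n : Fin L) :
    siteOp n pauliZ = (2 : ℂ) • (fermi raising n * fermi lowering n) - 1 := by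
  rw [fermi_mul_same, ← siteOp_smul, ← siteOp_one n, sub_eq_add_neg, ← siteOp_neg, ← siteOp_add]
  congr 1
  ext i j; fin_cases i <;> fin_cases j <;> norm_num [lowering, raising, pauliZ]

theorem pauliX_eq : pauliX = raising + lowering := by
  ext i j; fin_cases i <;> fin_cases j <;> simp [lowering, raising, pauliX]

theorem pauliY_eq : pauliY = (-Complex.I) • raising + Complex.I • lowering := by
  ext i j; fin_cases i <;> fin_cases j <;> simp [lowering, raising, pauliY]

/-- The annihilation and creation operators following site `n`, with antiperiodic convention. -/
def fermiNext (A : Matrix (Fin 2) (Fin 2) ℂ) (n : Fin L) : Matrix (Config L) (Config L) ℂ :=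
  if h : n.val + 1 < L then fermi A ⟨n.val + 1, h⟩ else -fermi A ⟨0, by have := n.isLt; omega⟩

/-- At the last site the string is the parity operator, which squares to 1 against the parity in the
boundary condition. What remains is -σ₁, the antiperiodic fermion, with no dependence on the
particle number. -/
theorem stringOp_mul_nextSiteOp (A : Matrix (Fin 2) (Fin 2) ℂ) (n : Fin L) :
    stringOp L (n.val + 1) * nextSiteOp n A = fermiNext A n := by
  unfold nextSiteOp fermiNext
  split_ifs with h
  · rfl
  · have hL : n.val + 1 = L := by have := n.isLt; omega
    have h0 : stringOp L 0 = 1 := by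
      rw [stringOp, ← diagonal_one]; congr 1; funext s; simp [stringSign]
    rw [hL, ← stringOp_length, mul_neg, ← mul_assoc, stringOp_mul_self, one_mul, fermi, h0, one_mul]

/-- The strings of neighbouring sites differ only by the sign at site `n`, which is absorbed into
`A`; everything else squares to 1. -/
theorem siteOp_mul_nextSiteOp (A B : Matrix (Fin 2) (Fin 2) ℂ) (n : Fin L) :
    siteOp n A * nextSiteOp n B = fermi (A * diagonal flipSign) n * fermiNext B n := by
  rw [fermi, ← stringOp_mul_nextSiteOp, stringOp_succ, stringOp_commute le_rfl, mul_assoc,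
    ← mul_assoc (stringOp L n), ← mul_assoc (stringOp L n), stringOp_mul_self, one_mul,
    ← mul_assoc, siteOp_mul_siteOp, mul_assoc A, diagonal_mul_diagonal]
  congr 2
  have : (fun i => flipSign i * flipSign i) = 1 := funext flipSign_mul_self
  rw [this, diagonal_one', mul_one]

theorem nextSiteOp_add (n : Fin L) (A B : Matrix (Fin 2) (Fin 2) ℂ) :
    nextSiteOp n (A + B) = nextSiteOp n A + nextSiteOp n B := by
  unfold nextSiteOp
  split_ifs
  · exact siteOp_add _ _ _
  · rw [siteOp_add]; noncomm_ring

theorem nextSiteOp_smul (n : Fin L) (c : ℂ) (A : Matrix (Fin 2) (Fin 2) ℂ) :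
    nextSiteOp n (c • A) = c • nextSiteOp n A := by
  unfold nextSiteOp
  split_ifs
  · exact siteOp_smul _ _ _
  · rw [siteOp_smul, mul_smul_comm, smul_neg]

theorem raising_mul_flip : raising * diagonal flipSign = raising := by
  ext i j; fin_cases i <;> fin_cases j <;> simp [raising, flipSign]

theorem lowering_mul_flip : lowering * diagonal flipSign = -lowering := by
  ext i j; fin_cases i <;> fin_cases j <;> simp [lowering, flipSign]

/-- In the sum of the x and y couplings the double raising and double lowering terms cancel, leaving
pure hopping. The relative minus sign comes from `lowering_mul_flip`. -/
theorem bond_eq (n : Fin L) :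
    siteOp n pauliX * nextSiteOp n pauliX + siteOp n pauliY * nextSiteOp n pauliY =
      (2 : ℂ) • (fermi raising n * fermiNext lowering n - fermi lowering n * fermiNext raising n)
      := by
  have h1 : siteOp n raising * nextSiteOp n lowering = fermi raising n * fermiNext lowering n := by
    rw [siteOp_mul_nextSiteOp, raising_mul_flip]
  have h2 : siteOp n lowering * nextSiteOp n raising =
      -(fermi lowering n * fermiNext raising n) := by
    rw [siteOp_mul_nextSiteOp, lowering_mul_flip, fermi, siteOp_neg, fermi]
    noncomm_ring
  rw [pauliX_eq, pauliY_eq, sub_eq_add_neg, ← h1, ← h2]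
  simp only [siteOp_add, nextSiteOp_add, siteOp_smul, nextSiteOp_smul, add_mul, mul_add,
    smul_mul_smul_comm]
  have hI : Complex.I * Complex.I = -1 := Complex.I_mul_I
  simp only [neg_mul, mul_neg, neg_neg, hI]
  module

/-- The antiperiodic shift. -/
def antiperiodicShift (L : ℕ) : Matrix (Fin L) (Fin L) ℂ :=
  of fun i j => if i.val + 1 = j.val then 1 else if i.val + 1 = L ∧ j.val = 0 then -1 else 0

/-- The one-particle Hamiltonian `A₀ - 2h |ν⟩⟨ν|`. -/
noncomputable def oneParticle (L : ℕ) (ν : Fin L) (h : ℝ) : Matrix (Fin L) (Fin L) ℂ :=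
  (-(1 / 2) : ℂ) • (antiperiodicShift L + (antiperiodicShift L)ᵀ)
    - (2 * h : ℂ) • diagonal (Pi.single ν 1)

theorem sum_antiperiodicShift {M : Type*} [AddCommGroup M] [Module ℂ M] (f : Fin L → M)
    (i : Fin L) :
    ∑ j, antiperiodicShift L i j • f j =
      if h : i.val + 1 < L then f ⟨i.val + 1, h⟩ else -f ⟨0, by have := i.isLt; omega⟩ := by
  split_ifs with h
  · rw [Finset.sum_eq_single ⟨i.val + 1, h⟩]
    · simp [antiperiodicShift]
    · intro j _ hj
      have h1 : i.val + 1 ≠ j.val := fun e => hj (Fin.ext e.symm)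
      have h2 : i.val + 1 ≠ L := h.ne
      simp [antiperiodicShift, h1, h2]
    · simp
  · have hL : i.val + 1 = L := by have := i.isLt; omega
    rw [Finset.sum_eq_single ⟨0, by have := i.isLt; omega⟩]
    · have hL0 : L ≠ 0 := by omega
      simp [antiperiodicShift, hL, hL0]
    · intro j _ hj
      have h1 : i.val + 1 ≠ j.val := by have := j.isLt; omega
      have h2 : j.val ≠ 0 := fun e => hj (Fin.ext e)
      simp [antiperiodicShift, h1, h2]
    · simp

/-! ### Second quantization of the one-particle Hamiltonian -/

variable {X : Type*} [Fintype X]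

theorem secondQuantization_add (a ad : Fin L → Matrix X X ℂ) (A B : Matrix (Fin L) (Fin L) ℂ) :
    secondQuantization a ad (A + B) = secondQuantization a ad A + secondQuantization a ad B := by
  simp [secondQuantization, add_smul, Finset.sum_add_distrib]

theorem secondQuantization_smul (a ad : Fin L → Matrix X X ℂ) (c : ℂ)
    (A : Matrix (Fin L) (Fin L) ℂ) :
    secondQuantization a ad (c • A) = c • secondQuantization a ad A := by
  simp [secondQuantization, Finset.smul_sum, smul_smul]

theorem secondQuantization_single (a ad : Fin L → Matrix X X ℂ) (ν : Fin L) :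
    secondQuantization a ad (diagonal (Pi.single ν 1)) = ad ν * a ν := by
  rw [secondQuantization, Finset.sum_eq_single ν, Finset.sum_eq_single ν]
  · simp
  · intro j _ hj; simp [diagonal_apply_ne _ hj.symm]
  · simp
  · intro i _ hi
    refine Finset.sum_eq_zero fun j _ => ?_
    rw [diagonal_apply]
    split_ifs <;> simp [hi]
  · simp

theorem secondQuantization_shift :
    secondQuantization (fermi (L := L) lowering) (fermi raising) (antiperiodicShift L) =
      ∑ n, fermi raising n * fermiNext lowering n := by
  refine Finset.sum_congr rfl fun n _ => ?_
  simp only [← mul_smul_comm]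
  rw [← Finset.mul_sum, sum_antiperiodicShift]
  rfl

/-- Reordering a hopping term needs its two sites to be distinct. For the bond that closes the ring
this is where `1 < L` enters. -/
theorem secondQuantization_shift_transpose (hL : 1 < L) :
    secondQuantization (fermi (L := L) lowering) (fermi raising) (antiperiodicShift L)ᵀ =
      -∑ n, fermi lowering n * fermiNext raising n := by
  rw [secondQuantization, Finset.sum_comm, ← Finset.sum_neg_distrib]
  refine Finset.sum_congr rfl fun n _ => ?_
  simp only [transpose_apply, ← smul_mul_assoc]
  rw [← Finset.sum_mul, sum_antiperiodicShift, fermiNext]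
  have key : ∀ m : Fin L, n ≠ m →
      fermi raising m * fermi lowering n = -(fermi lowering n * fermi raising m) := by
    intro m hm
    have := isCAR_fermi.ann_cre n m
    rw [if_neg hm] at this
    exact eq_neg_of_add_eq_zero_right this
  split_ifs with h
  · exact key _ (by simp [Fin.ext_iff])
  · rw [neg_mul, key _ (by simp [Fin.ext_iff]; omega)]
    noncomm_ring

/-- Since σᶻ is twice the number operator minus 1, the field term splits into the rank-one part
-2h|ν⟩⟨ν| and the constant h, the source of the prefactor e^{-βh}. -/
theorem chainHamiltonian_eq (hL : 1 < L) (ν : Fin L) (h : ℝ) :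
    chainHamiltonian L ν h = (h : ℂ) • 1 +
      secondQuantization (fermi lowering) (fermi raising) (oneParticle L ν h) := by
  rw [chainHamiltonian, oneParticle, sub_eq_add_neg (_ • (antiperiodicShift L + _)), ← neg_smul,
    secondQuantization_add, secondQuantization_smul, secondQuantization_smul,
    secondQuantization_add, secondQuantization_single, secondQuantization_shift,
    secondQuantization_shift_transpose hL, freeHamiltonian, siteOp_pauliZ]
  simp only [bond_eq]
  rw [← Finset.smul_sum, Finset.sum_sub_distrib]
  module

theorem oneParticle_isHermitian (ν : Fin L) (h : ℝ) : (oneParticle L ν h).IsHermitian := by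
  have hT : (antiperiodicShift L)ᴴ = (antiperiodicShift L)ᵀ := by
    ext i j
    simp only [conjTranspose_apply, transpose_apply, antiperiodicShift, of_apply]
    split_ifs <;> simp
  have hT' : ((antiperiodicShift L)ᵀ)ᴴ = antiperiodicShift L := by
    rw [← hT, conjTranspose_conjTranspose]
  have hd : star (Pi.single ν 1 : Fin L → ℂ) = Pi.single ν 1 := by
    ext j; by_cases hj : j = ν <;> simp [hj]
  rw [IsHermitian, oneParticle, conjTranspose_sub, conjTranspose_smul, conjTranspose_smul,
    conjTranspose_add, hT, hT', diagonal_conjTranspose, hd, add_comm]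
  simp

/-- The one-particle energies. -/
noncomputable def energy (L : ℕ) (ν : Fin L) (h : ℝ) : Fin L → ℝ :=
  (oneParticle_isHermitian ν h).eigenvalues

theorem trace_exp_chainHamiltonian (hL : 1 < L) (ν : Fin L) (c : ℂ) (h : ℝ) :
    trace (NormedSpace.exp (c • chainHamiltonian L ν h)) =
      Complex.exp (c * h) * ∏ k, (1 + Complex.exp (c * energy L ν h k)) := by
  rw [chainHamiltonian_eq hL, smul_add, smul_smul,
    Matrix.exp_add_of_commute _ _ ((Commute.one_left _).smul_left _),
    exp_smul_of_isIdempotentElem (one_mul 1), sub_smul, one_smul, add_sub_cancel, smul_mul_assoc,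
    one_mul, trace_smul, isCAR_fermi.trace_exp_secondQuantization (oneParticle_isHermitian ν h),
    Finset.prod_div_distrib]
  simp [energy, mul_div_cancel₀]

theorem chainPartition_eq (hL : 1 < L) (ν : Fin L) (β h : ℝ) :
    chainPartition L ν β h =
      Real.exp (-(β * h)) * ∏ k, (1 + Real.exp (-(β * energy L ν h k))) := by
  rw [chainPartition, trace_exp_chainHamiltonian hL, ← Complex.ofReal_re (Real.exp _ * _)]
  congr 1
  push_cast
  simp only [neg_mul]

end XYChain

/-! ### The branch of the square root -/

namespace XYChain

theorem cpow_half_sq (u : ℂ) : (u ^ (1 / 2 : ℂ)) ^ 2 = u := by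
  rw [one_div]; exact Complex.cpow_ofNat_inv_pow u 2

/-- The argument of the principal root is half of one in (-π, π]. These sign conditions, together
with the square, are all that is used about the two factors of `sqrtBranch`. -/
theorem cpow_half_re (u : ℂ) :
    0 ≤ (u ^ (1 / 2 : ℂ)).re ∧ ((u ^ (1 / 2 : ℂ)).re = 0 → 0 ≤ (u ^ (1 / 2 : ℂ)).im) := by
  by_cases hu : u = 0
  · subst hu; simp
  have him : (Complex.log u * (1 / 2)).im = u.arg / 2 := by
    rw [show (1 / 2 : ℂ) = ((1 / 2 : ℝ) : ℂ) by push_cast; rfl, Complex.im_mul_ofReal,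
      Complex.log_im]
    ring
  rw [Complex.cpow_def_of_ne_zero hu, Complex.exp_re, Complex.exp_im, him]
  have h1 := Complex.neg_pi_lt_arg u
  have h2 := Complex.arg_le_pi u
  have hexp := Real.exp_pos (Complex.log u * (1 / 2)).re
  have hpi := Real.pi_pos
  refine ⟨mul_nonneg hexp.le (Real.cos_nonneg_of_mem_Icc ⟨by linarith, by linarith⟩), fun h => ?_⟩
  have hc : Real.cos (u.arg / 2) = 0 := (mul_eq_zero.mp h).resolve_left hexp.ne'
  have harg : ¬ u.arg < Real.pi := fun hlt =>
    (Real.cos_pos_of_mem_Ioo ⟨by linarith, by linarith⟩ : 0 < Real.cos (u.arg / 2)).ne' hc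
  exact mul_nonneg hexp.le (Real.sin_nonneg_of_nonneg_of_le_pi (by linarith) (by linarith))

/-- The cut `[-1, 1]`. -/
def cut : Set ℂ := Complex.ofReal '' Set.Icc (-1) 1

theorem mem_cut {z : ℂ} : z ∈ cut ↔ z.im = 0 ∧ -1 ≤ z.re ∧ z.re ≤ 1 := by
  constructor
  · rintro ⟨x, hx, rfl⟩
    exact ⟨Complex.ofReal_im x, by simpa using hx.1, by simpa using hx.2⟩
  · rintro ⟨h0, h1, h2⟩
    exact ⟨z.re, ⟨h1, h2⟩, Complex.ext (by simp) (by simp [h0])⟩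

theorem isCompact_cut : IsCompact cut := isCompact_Icc.image Complex.continuous_ofReal

theorem neg_mem_cut {z : ℂ} : -z ∈ cut ↔ z ∈ cut := by
  simp only [mem_cut, Complex.neg_im, Complex.neg_re, neg_eq_zero]
  constructor <;> rintro ⟨h0, h1, h2⟩ <;> exact ⟨h0, by linarith, by linarith⟩

theorem sqrtBranch_sq (z : ℂ) : sqrtBranch z ^ 2 = z ^ 2 - 1 := by
  rw [sqrtBranch, mul_pow, cpow_half_sq, cpow_half_sq]; ring

/-- Off the cut, `sqrtBranch z` is the square root of `z² - 1` which lies in the half-plane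
of `z`. -/
theorem sqrtBranch_pos {z : ℂ} (hz : z ∉ cut) :
    0 < z.re * (sqrtBranch z).re + z.im * (sqrtBranch z).im := by
  obtain ⟨ha1, ha2⟩ := cpow_half_re (z - 1)
  obtain ⟨hb1, hb2⟩ := cpow_half_re (z + 1)
  have ha := cpow_half_sq (z - 1)
  have hb := cpow_half_sq (z + 1)
  unfold sqrtBranch
  set a := (z - 1) ^ (1 / 2 : ℂ)
  set b := (z + 1) ^ (1 / 2 : ℂ)
  have ha_re := congrArg Complex.re ha
  have ha_im := congrArg Complex.im ha
  have hb_re := congrArg Complex.re hb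
  have hb_im := congrArg Complex.im hb
  simp only [pow_two, Complex.mul_re, Complex.mul_im, Complex.sub_re, Complex.sub_im,
    Complex.add_re, Complex.add_im, Complex.one_re, Complex.one_im] at ha_re ha_im hb_re hb_im
  -- Since a² = z - 1 and b² = z + 1 give z = (a² + b²)/2, the real part of z̄ab equals (|a|² +
  -- |b|²)/2 times the real part of āb. Only the sign of the latter is at stake.
  have key : 0 < a.re * b.re + a.im * b.im := by
    by_cases him : z.im = 0
    · have hz' : z.re < -1 ∨ 1 < z.re := by
        by_contra hcon
        push Not at hcon
        exact hz (mem_cut.mpr ⟨him, hcon.1, hcon.2⟩)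
      have ha0 : a.re = 0 ∨ a.im = 0 := by
        have : a.re * a.im = 0 := by linarith
        exact mul_eq_zero.mp this
      have hb0 : b.re = 0 ∨ b.im = 0 := by
        have : b.re * b.im = 0 := by linarith
        exact mul_eq_zero.mp this
      rcases hz' with hneg | hpos
      · have har : a.re = 0 := ha0.elim id fun h => by nlinarith [sq_nonneg a.re]
        have hbr : b.re = 0 := hb0.elim id fun h => by nlinarith [sq_nonneg b.re]
        have hai : 0 < a.im := lt_of_le_of_ne (ha2 har) fun h => by nlinarith
        have hbi : 0 < b.im := lt_of_le_of_ne (hb2 hbr) fun h => by nlinarith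
        nlinarith [mul_pos hai hbi]
      · have hai : a.im = 0 := ha0.elim (fun h => by nlinarith [sq_nonneg a.im]) id
        have hbi : b.im = 0 := hb0.elim (fun h => by nlinarith [sq_nonneg b.im]) id
        have har : 0 < a.re := lt_of_le_of_ne ha1 fun h => by nlinarith
        have hbr : 0 < b.re := lt_of_le_of_ne hb1 fun h => by nlinarith
        nlinarith [mul_pos har hbr]
    · have har : 0 < a.re := lt_of_le_of_ne ha1 fun h => him (by rw [← h] at ha_im; linarith)
      have hbr : 0 < b.re := lt_of_le_of_ne hb1 fun h => him (by rw [← h] at hb_im; linarith)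
      have hab : a.re * a.im = b.re * b.im := by linarith
      have hprod : 0 ≤ a.im * b.im := by
        have h1 : a.re * (a.im * b.im) = b.re * b.im ^ 2 := by
          linear_combination b.im * hab
        have h2 : 0 ≤ a.re * (a.im * b.im) := by rw [h1]; positivity
        exact nonneg_of_mul_nonneg_right h2 har
      have := mul_pos har hbr
      linarith
  have hzre : z.re = (a.re ^ 2 - a.im ^ 2 + b.re ^ 2 - b.im ^ 2) / 2 := by linarith
  have hzim : z.im = a.re * a.im + b.re * b.im := by linarith
  have hnz : 0 < a.re ^ 2 + a.im ^ 2 + b.re ^ 2 + b.im ^ 2 := by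
    nlinarith [sq_nonneg (a.re - b.re), sq_nonneg (a.im - b.im)]
  rw [Complex.mul_re, Complex.mul_im, hzre, hzim]
  have := mul_pos hnz key
  linarith

/-- The other root is the negative, which `sqrtBranch_pos` puts in the opposite open half-plane.
This makes the oddness of the branch immediate. -/
theorem eq_sqrtBranch {z t : ℂ} (hz : z ∉ cut) (ht : t ^ 2 = z ^ 2 - 1)
    (hpos : 0 ≤ z.re * t.re + z.im * t.im) : t = sqrtBranch z := by
  rw [← sqrtBranch_sq z, sq_eq_sq_iff_eq_or_eq_neg] at ht
  refine ht.resolve_right fun h => ?_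
  have := sqrtBranch_pos hz
  rw [h, Complex.neg_re, Complex.neg_im] at hpos
  linarith

theorem sqrtBranch_neg {z : ℂ} (hz : z ∉ cut) : sqrtBranch (-z) = -sqrtBranch z := by
  have hz' : -z ∉ cut := fun h => hz (neg_mem_cut.mp h)
  refine (eq_sqrtBranch hz' ?_ ?_).symm
  · rw [neg_sq, sqrtBranch_sq, neg_sq]
  · simpa using (sqrtBranch_pos hz).le

theorem sqrtBranch_ne_zero {z : ℂ} (hz : z ∉ cut) : sqrtBranch z ≠ 0 := by
  intro h
  have := sqrtBranch_pos hz
  simp [h] at this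

theorem isOpen_compl_cut : IsOpen cutᶜ := isCompact_cut.isClosed.isOpen_compl

/-- Both principal roots are discontinuous on (-∞, -1), although their product is not. There
differentiability is carried over from -z by oddness; elsewhere it is that of the factors. The value
follows by differentiating s² = z² - 1. -/
theorem hasDerivAt_sqrtBranch {z : ℂ} (hz : z ∉ cut) :
    HasDerivAt sqrtBranch (z / sqrtBranch z) z := by
  have main : ∀ u : ℂ, u ∉ cut → (0 < u.re ∨ u.im ≠ 0) → DifferentiableAt ℂ sqrtBranch u := by
    intro u hu h
    have h1 : u - 1 ∈ Complex.slitPlane := by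
      rw [Complex.mem_slitPlane_iff]
      by_cases him : u.im = 0
      · left
        have hre : 0 < u.re := h.resolve_right (not_not.mpr him)
        by_contra hcon
        simp only [Complex.sub_re, Complex.one_re] at hcon
        exact hu (mem_cut.mpr ⟨him, by linarith, by linarith⟩)
      · right; simpa using him
    have h2 : u + 1 ∈ Complex.slitPlane := by
      rw [Complex.mem_slitPlane_iff] at h1 ⊢
      simp only [Complex.sub_re, Complex.one_re, Complex.sub_im, Complex.one_im, Complex.add_re,
        Complex.add_im] at h1 ⊢
      rcases h1 with h1 | h1
      · left; linarith
      · right; simpa using h1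
    exact ((differentiableAt_id.sub_const 1).cpow_const h1).mul
      ((differentiableAt_id.add_const 1).cpow_const h2)
  have hd : DifferentiableAt ℂ sqrtBranch z := by
    by_cases h : 0 < z.re ∨ z.im ≠ 0
    · exact main z hz h
    · push Not at h
      have hlt : z.re < -1 := by
        by_contra hcon
        exact hz (mem_cut.mpr ⟨h.2, by linarith, by linarith⟩)
      have hd := (main (-z) (fun h' => hz (neg_mem_cut.mp h'))
        (Or.inl (by rw [Complex.neg_re]; linarith))).hasDerivAt
      have hd2 := ((hd.comp z (hasDerivAt_neg z)).neg).differentiableAt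
      refine hd2.congr_of_eventuallyEq ?_
      filter_upwards [isOpen_compl_cut.mem_nhds hz] with u hu
      simp [sqrtBranch_neg hu]
  have h1 := hd.hasDerivAt.fun_pow 2
  have h2 : HasDerivAt (fun u => sqrtBranch u ^ 2) (2 * z) z := by
    simp only [sqrtBranch_sq]
    simpa using ((hasDerivAt_id z).fun_pow 2).sub_const 1
  have h3 := h1.unique h2
  have hs := sqrtBranch_ne_zero hz
  have : deriv sqrtBranch z = z / sqrtBranch z := by
    rw [eq_div_iff hs]
    simp at h3
    linear_combination h3 / 2
  rw [← this]
  exact hd.hasDerivAt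

theorem continuousOn_sqrtBranch : ContinuousOn sqrtBranch cutᶜ := fun _ hz =>
  (hasDerivAt_sqrtBranch hz).continuousAt.continuousWithinAt

/-- The inverse Joukowski variable `w` with `z = (w + 1/w)/2` and `|w| < 1`. -/
noncomputable def joukowski (z : ℂ) : ℂ := z - sqrtBranch z

theorem joukowski_mul (z : ℂ) : joukowski z * (z + sqrtBranch z) = 1 := by
  have := sqrtBranch_sq z
  rw [joukowski]
  linear_combination -this

theorem joukowski_ne_zero (z : ℂ) : joukowski z ≠ 0 := left_ne_zero_of_mul_eq_one (joukowski_mul z)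

/-- The numbers z - s and z + s have product 1, and |z + s|² - |z - s|² is four times the positive
quantity of `sqrtBranch_pos`. -/
theorem norm_joukowski_lt {z : ℂ} (hz : z ∉ cut) : ‖joukowski z‖ < 1 := by
  have hpos := sqrtBranch_pos hz
  have h1 : ‖joukowski z‖ * ‖z + sqrtBranch z‖ = 1 := by
    rw [← norm_mul, joukowski_mul, norm_one]
  have h2 : ‖joukowski z‖ ^ 2 < ‖z + sqrtBranch z‖ ^ 2 := by
    rw [joukowski, Complex.sq_norm, Complex.sq_norm, Complex.normSq_apply, Complex.normSq_apply]
    simp only [Complex.sub_re, Complex.sub_im, Complex.add_re, Complex.add_im]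
    nlinarith
  have h3 : ‖joukowski z‖ < ‖z + sqrtBranch z‖ := lt_of_pow_lt_pow_left₀ 2 (norm_nonneg _) h2
  by_contra hcon
  nlinarith [norm_nonneg (joukowski z)]

theorem joukowski_inv (z : ℂ) : (joukowski z)⁻¹ = z + sqrtBranch z :=
  inv_eq_of_mul_eq_one_right (joukowski_mul z)

theorem eq_joukowski (z : ℂ) : z = (joukowski z + (joukowski z)⁻¹) / 2 := by
  rw [joukowski_inv, joukowski]; ring

theorem sqrtBranch_eq_joukowski (z : ℂ) :
    sqrtBranch z = ((joukowski z)⁻¹ - joukowski z) / 2 := by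
  rw [joukowski_inv, joukowski]; ring

theorem continuousOn_joukowski : ContinuousOn joukowski cutᶜ :=
  continuousOn_id.sub continuousOn_sqrtBranch

end XYChain

/-! ### The resolvent of the free one-particle Hamiltonian -/

namespace XYChain

open Matrix

/-- The plane wave factor `e^{i q_k}`. -/
noncomputable def phase (L k : ℕ) : ℂ := Complex.exp (momentum L k * Complex.I)

theorem phase_ne_zero (L k : ℕ) : phase L k ≠ 0 := Complex.exp_ne_zero _

theorem phase_pow_length {L : ℕ} (hL : L ≠ 0) (k : ℕ) : phase L k ^ L = -1 := by
  have hL' : (L : ℂ) ≠ 0 := Nat.cast_ne_zero.mpr hL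
  rw [phase, ← Complex.exp_nat_mul, momentum]
  have : (L : ℂ) * (((2 * (k : ℝ) + 1) * Real.pi / L : ℝ) * Complex.I) =
      Real.pi * Complex.I + k * (2 * Real.pi * Complex.I) := by
    push_cast
    field_simp
    ring
  rw [this, Complex.exp_add, Complex.exp_pi_mul_I, Complex.exp_nat_mul_two_pi_mul_I, mul_one]

theorem cos_momentum (L k : ℕ) :
    (Real.cos (momentum L k) : ℂ) = (phase L k + (phase L k)⁻¹) / 2 := by
  rw [phase, ← Complex.exp_neg, Complex.ofReal_cos, Complex.cos, neg_mul]

/-- The momenta have spacing 2π/L, so the terms are geometric with ratio an L-th root of unity. The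
bounds on `m` keep this ratio different from 1. -/
theorem sum_phase_zpow {L : ℕ} (hL : L ≠ 0) {m : ℤ} (hm : m ≠ 0) (hmL : |m| < L) :
    ∑ k ∈ Finset.range L, phase L k ^ m = 0 := by
  have hL' : (L : ℂ) ≠ 0 := Nat.cast_ne_zero.mpr hL
  set r : ℂ := Complex.exp (2 * Real.pi * Complex.I * (m / L)) with hr
  have hterm : ∀ k : ℕ, phase L k ^ m = phase L 0 ^ m * r ^ k := by
    intro k
    rw [phase, phase, hr, ← Complex.exp_int_mul, ← Complex.exp_int_mul, ← Complex.exp_nat_mul,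
      ← Complex.exp_add]
    congr 1
    simp only [momentum]
    push_cast
    field_simp
    ring
  have hr1 : r ≠ 1 := by
    intro h
    obtain ⟨n, hn⟩ := Complex.exp_eq_one_iff.mp h
    have h2 : (m : ℂ) = n * L := by
      have h3 : (2 * Real.pi * Complex.I : ℂ) ≠ 0 := Complex.two_pi_I_ne_zero
      have h4 : (m : ℂ) / L = n := by
        apply mul_left_cancel₀ h3
        rw [hn]; ring
      rw [← h4]; field_simp
    have h3 : m = n * L := by exact_mod_cast h2
    rw [h3, abs_mul, Nat.abs_cast] at hmL
    have hn0 : n ≠ 0 := by rintro rfl; simp at h3; exact hm h3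
    have : 1 ≤ |n| := Int.one_le_abs hn0
    nlinarith [Int.natCast_nonneg L]
  have hrL : r ^ L = 1 := by
    rw [hr, ← Complex.exp_nat_mul]
    rw [show (L : ℂ) * (2 * Real.pi * Complex.I * (m / L)) = m * (2 * Real.pi * Complex.I) by
      field_simp]
    exact Complex.exp_int_mul_two_pi_mul_I m
  rw [Finset.sum_congr rfl fun k _ => hterm k, ← Finset.mul_sum, geom_sum_eq hr1, hrL, sub_self, zero_div, mul_zero]

/-- The diagonal element `(1/L) ∑_q 1/(z + cos q)` of the free resolvent. -/
noncomputable def freeGreen (L : ℕ) (z : ℂ) : ℂ :=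
  (L : ℂ)⁻¹ * ∑ k ∈ Finset.range L, (z + (Real.cos (momentum L k) : ℂ))⁻¹

/-- The index k ↦ L - 1 - k sends q to 2π - q. This reconciles the enumeration of momenta in (0, 2π)
with the pairs ±q in the definition of F_L. -/
theorem cos_momentum_reflect {L k : ℕ} (hk : k < L) :
    Real.cos (momentum L (L - 1 - k)) = Real.cos (momentum L k) := by
  have hL' : (L : ℝ) ≠ 0 := Nat.cast_ne_zero.mpr (by omega)
  have : momentum L (L - 1 - k) = 2 * Real.pi - momentum L k := by
    have h1 : ((L - 1 - k : ℕ) : ℝ) = L - 1 - k := by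
      rw [Nat.cast_sub (by omega), Nat.cast_sub (by omega), Nat.cast_one]
    simp only [momentum, h1]
    field_simp
    ring
  rw [this, Real.cos_two_pi_sub]

theorem finiteF_eq {L : ℕ} (hL : Even L) (h : ℝ) (z : ℂ) :
    finiteF L h z = 1 + 2 * h * freeGreen L z := by
  obtain ⟨p, rfl⟩ := hL
  have h2 : (p + p) / 2 = p := by omega
  rw [finiteF, freeGreen, h2, Finset.sum_range_add,
    ← Finset.sum_range_reflect (fun x => (z + (Real.cos (momentum (p + p) (p + x)) : ℂ))⁻¹),
    ← Finset.sum_add_distrib]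
  have : ∀ n ∈ Finset.range p,
      (1 / (z + (Real.cos (momentum (p + p) n) : ℂ)) +
        1 / (z + (Real.cos (-momentum (p + p) n) : ℂ))) =
      (z + (Real.cos (momentum (p + p) n) : ℂ))⁻¹ +
        (z + (Real.cos (momentum (p + p) (p + (p - 1 - n))) : ℂ))⁻¹ := by
    intro n hn
    have hn' := Finset.mem_range.mp hn
    rw [Real.cos_neg, one_div, show p + (p - 1 - n) = p + p - 1 - n by omega,
      cos_momentum_reflect (by omega)]
  rw [Finset.sum_congr rfl this]
  ring

theorem exists_lt_half {L k : ℕ} (hL : Even L) (hk : k < L) :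
    ∃ n < L / 2, Real.cos (momentum L n) = Real.cos (momentum L k) := by
  obtain ⟨p, rfl⟩ := hL
  by_cases h : k < p
  · exact ⟨k, by omega, rfl⟩
  · exact ⟨p + p - 1 - k, by omega, cos_momentum_reflect hk⟩

/-- The sum over momenta in closed form. -/
theorem freeGreen_eq {L : ℕ} (hL : Even L) (hL0 : L ≠ 0) {z : ℂ} (hz : z ∉ cut) :
    freeGreen L z =
      (sqrtBranch z)⁻¹ * ((1 - joukowski z ^ L) / (1 + joukowski z ^ L)) := by
  have hL' : (L : ℂ) ≠ 0 := Nat.cast_ne_zero.mpr hL0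
  have hs := sqrtBranch_ne_zero hz
  have hw0 := joukowski_ne_zero z
  have hw1 := norm_joukowski_lt hz
  have hzw := eq_joukowski z
  have hsw := sqrtBranch_eq_joukowski z
  set w := joukowski z
  set s := sqrtBranch z
  have hnorm : ∀ k, ‖phase L k‖ = 1 := fun k => Complex.norm_exp_ofReal_mul_I _
  have hne : ∀ u : ℂ, ‖u‖ < 1 → 1 + u ≠ 0 := by
    intro u hu h
    rw [eq_neg_of_add_eq_zero_right h] at hu
    simp at hu
  have h1 : ∀ k, 1 + w * phase L k ≠ 0 := fun k => hne _ (by rw [norm_mul, hnorm, mul_one]; exact hw1)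
  have h2 : ∀ k, 1 + w * (phase L k)⁻¹ ≠ 0 := fun k =>
    hne _ (by rw [norm_mul, norm_inv, hnorm, inv_one, mul_one]; exact hw1)
  have hwL : 1 + w ^ L ≠ 0 := hne _ (by
    rw [norm_pow]; exact pow_lt_one₀ (norm_nonneg _) hw1 hL0)
  -- In the variable w, z + cos q factors as (1 + we^{iq})(1 + we^{-iq})/(2w), and this is the
  -- partial fraction decomposition of its inverse.
  have hterm : ∀ k, (z + (Real.cos (momentum L k) : ℂ))⁻¹ =
      s⁻¹ * ((1 + w * phase L k)⁻¹ + (1 + w * (phase L k)⁻¹)⁻¹ - 1) := by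
    intro k
    have hp := phase_ne_zero L k
    have e1 : z + (Real.cos (momentum L k) : ℂ) =
        (1 + w * phase L k) * (1 + w * (phase L k)⁻¹) / (2 * w) := by
      rw [cos_momentum, hzw]; field_simp; ring
    have e2 : s⁻¹ * ((1 + w * phase L k)⁻¹ + (1 + w * (phase L k)⁻¹)⁻¹ - 1) =
        s⁻¹ * (1 - w ^ 2) / ((1 + w * phase L k) * (1 + w * (phase L k)⁻¹)) := by
      have := h1 k
      have := h2 k
      rw [eq_div_iff (mul_ne_zero (h1 k) (h2 k))]
      rw [show s⁻¹ * ((1 + w * phase L k)⁻¹ + (1 + w * (phase L k)⁻¹)⁻¹ - 1) *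
          ((1 + w * phase L k) * (1 + w * (phase L k)⁻¹)) =
          s⁻¹ * ((1 + w * phase L k)⁻¹ * (1 + w * phase L k) * (1 + w * (phase L k)⁻¹) +
          (1 + w * (phase L k)⁻¹)⁻¹ * (1 + w * (phase L k)⁻¹) * (1 + w * phase L k) -
          (1 + w * phase L k) * (1 + w * (phase L k)⁻¹)) by ring,
        inv_mul_cancel₀ (h1 k), inv_mul_cancel₀ (h2 k)]
      field_simp
      ring
    have e3 : s⁻¹ * (1 - w ^ 2) = 2 * w := by
      rw [inv_mul_eq_iff_eq_mul₀ hs, hsw]; field_simp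
    rw [e1, e2, e3, inv_div]
  -- As L is even and x^L = -1, one has (-wx)^L = -w^L. The geometric series truncated at L terms is
  -- therefore exact up to the factor 1 + w^L, which does not depend on x.
  have hgeom : ∀ x : ℂ, x ^ L = -1 → 1 + w * x ≠ 0 →
      (1 + w * x)⁻¹ = (1 + w ^ L)⁻¹ * ∑ n ∈ Finset.range L, (-w) ^ n * x ^ n := by
    intro x hx hne'
    rw [eq_comm, inv_mul_eq_iff_eq_mul₀ hwL, ← div_eq_mul_inv, eq_div_iff hne']
    have := mul_neg_geom_sum (-w * x) L
    rw [mul_pow, hL.neg_pow, hx] at this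
    simp only [mul_pow] at this
    linear_combination this
  have hsumpow : ∀ n ∈ Finset.range L,
      ∑ k ∈ Finset.range L, phase L k ^ n = if n = 0 then (L : ℂ) else 0 := by
    intro n hn
    split_ifs with h0
    · subst h0; simp
    · have := sum_phase_zpow hL0 (m := n) (by exact_mod_cast h0)
        (by rw [Nat.abs_cast]; exact_mod_cast Finset.mem_range.mp hn)
      simpa using this
  have hsumpow' : ∀ n ∈ Finset.range L,
      ∑ k ∈ Finset.range L, (phase L k)⁻¹ ^ n = if n = 0 then (L : ℂ) else 0 := by
    intro n hn
    split_ifs with h0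
    · subst h0; simp
    · have := sum_phase_zpow hL0 (m := -n) (by simpa using h0)
        (by rw [abs_neg, Nat.abs_cast]; exact_mod_cast Finset.mem_range.mp hn)
      simpa using this
  -- After exchanging the sums, only the constant term survives the sum over momenta.
  have hA : ∀ x : ℕ → ℂ, (∀ k, x k ^ L = -1) → (∀ k, 1 + w * x k ≠ 0) →
      (∀ n ∈ Finset.range L,
        ∑ k ∈ Finset.range L, x k ^ n = if n = 0 then (L : ℂ) else 0) →
      ∑ k ∈ Finset.range L, (1 + w * x k)⁻¹ = L * (1 + w ^ L)⁻¹ := by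
    intro x hx hx' hsum
    rw [Finset.sum_congr rfl fun k _ => hgeom (x k) (hx k) (hx' k), ← Finset.mul_sum,
      Finset.sum_comm]
    simp only [← Finset.mul_sum]
    rw [Finset.sum_congr rfl fun n hn => by rw [hsum n hn]]
    simp only [mul_ite, mul_zero, Finset.sum_ite_eq', Finset.mem_range, Nat.pos_of_ne_zero hL0,
      if_true, pow_zero, one_mul]
    ring
  have hph := fun k => phase_pow_length hL0 k
  rw [freeGreen, Finset.sum_congr rfl fun k _ => hterm k, ← Finset.mul_sum,
    Finset.sum_sub_distrib, Finset.sum_add_distrib, hA _ hph h1 hsumpow,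
    hA _ (fun k => by rw [inv_pow, hph]; norm_num) h2 hsumpow']
  simp only [Finset.sum_const, Finset.card_range, nsmul_eq_mul, mul_one]
  field_simp
  ring

/-- The matrix of plane waves. -/
noncomputable def waveMatrix (L : ℕ) : Matrix (Fin L) (Fin L) ℂ :=
  of fun j k => phase L k ^ j.val

/-- The inverse of the matrix of plane waves. -/
noncomputable def waveInv (L : ℕ) : Matrix (Fin L) (Fin L) ℂ :=
  of fun k j => (L : ℂ)⁻¹ * (phase L k)⁻¹ ^ j.val

theorem waveMatrix_mul_waveInv {L : ℕ} (hL : L ≠ 0) : waveMatrix L * waveInv L = 1 := by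
  have hL' : (L : ℂ) ≠ 0 := Nat.cast_ne_zero.mpr hL
  ext i j
  rw [mul_apply, one_apply]
  have hterm : ∀ k : Fin L, waveMatrix L i k * waveInv L k j =
      (L : ℂ)⁻¹ * phase L k ^ ((i.val : ℤ) - j.val) := by
    intro k
    simp only [waveMatrix, waveInv, of_apply]
    rw [zpow_sub₀ (phase_ne_zero L k), zpow_natCast, zpow_natCast, inv_pow]
    ring
  rw [Finset.sum_congr rfl fun k _ => hterm k, ← Finset.mul_sum,
    Fin.sum_univ_eq_sum_range (fun k => phase L k ^ ((i.val : ℤ) - j.val)) L]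
  split_ifs with hij
  · subst hij; simp [hL']
  · rw [sum_phase_zpow hL, mul_zero]
    · have : i.val ≠ j.val := fun h => hij (Fin.ext h)
      omega
    · have := i.isLt; have := j.isLt
      rw [abs_lt]; omega

/-- Plane waves also satisfy the equation at the closing bond because e^{iqL} = -1 for the chosen
momenta. -/
theorem shift_mul_wave {L : ℕ} (hL : L ≠ 0) :
    antiperiodicShift L * waveMatrix L = waveMatrix L * diagonal fun k : Fin L => phase L k := by
  ext i k
  rw [mul_apply, mul_diagonal]
  simp only [← smul_eq_mul (a := antiperiodicShift L _ _)]
  rw [sum_antiperiodicShift fun j => waveMatrix L j k]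
  simp only [waveMatrix, of_apply]
  split_ifs with h
  · rw [pow_succ]
  · have : i.val + 1 = L := by have := i.isLt; omega
    rw [← pow_succ, this, phase_pow_length hL, pow_zero]

theorem shift_mul_transpose {L : ℕ} : antiperiodicShift L * (antiperiodicShift L)ᵀ = 1 := by
  ext i j
  rw [mul_apply]
  simp only [← smul_eq_mul (a := antiperiodicShift L _ _)]
  rw [sum_antiperiodicShift fun k => (antiperiodicShift L)ᵀ k j]
  simp only [transpose_apply, antiperiodicShift, of_apply, one_apply, Fin.ext_iff]
  have := i.isLt
  have := j.isLt
  split_ifs <;> first | omega | grind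

theorem shift_transpose_mul_wave {L : ℕ} (hL : L ≠ 0) :
    (antiperiodicShift L)ᵀ * waveMatrix L = waveMatrix L * diagonal fun k : Fin L => (phase L k)⁻¹ := by
  have h1 : (antiperiodicShift L)ᵀ * antiperiodicShift L = 1 :=
    mul_eq_one_comm.mp shift_mul_transpose
  have h2 : (diagonal fun k : Fin L => phase L k) * (diagonal fun k : Fin L => (phase L k)⁻¹) = 1 := by
    rw [diagonal_mul_diagonal, ← diagonal_one]
    congr 1
    funext k
    exact mul_inv_cancel₀ (phase_ne_zero L k)
  calc (antiperiodicShift L)ᵀ * waveMatrix L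
      = (antiperiodicShift L)ᵀ * (waveMatrix L * ((diagonal fun k : Fin L => phase L k) *
          (diagonal fun k : Fin L => (phase L k)⁻¹))) := by rw [h2, mul_one]
    _ = (antiperiodicShift L)ᵀ * antiperiodicShift L * waveMatrix L *
          (diagonal fun k : Fin L => (phase L k)⁻¹) := by
        rw [← mul_assoc (waveMatrix L), ← shift_mul_wave hL]
        noncomm_ring
    _ = _ := by rw [h1, one_mul]

theorem free_eq_wave {L : ℕ} (hL : L ≠ 0) (z : ℂ) :
    z • (1 : Matrix (Fin L) (Fin L) ℂ) -
        (-(1 / 2) : ℂ) • (antiperiodicShift L + (antiperiodicShift L)ᵀ) =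
      waveMatrix L * (diagonal fun k : Fin L => z + (Real.cos (momentum L k) : ℂ)) * waveInv L := by
  have h1 := waveMatrix_mul_waveInv hL
  have hd : (diagonal fun k : Fin L => z + (Real.cos (momentum L k) : ℂ)) =
      z • 1 + (1 / 2 : ℂ) • ((diagonal fun k : Fin L => phase L k) +
        diagonal fun k : Fin L => (phase L k)⁻¹) := by
    rw [← diagonal_one, diagonal_add, ← diagonal_smul, ← diagonal_smul, diagonal_add]
    congr 1
    funext k
    rw [cos_momentum]
    simp only [Pi.smul_apply, smul_eq_mul]
    ring
  rw [hd, mul_add, add_mul, mul_smul_comm, mul_one, smul_mul_assoc, h1, mul_smul_comm, mul_add,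
    ← shift_mul_wave hL, ← shift_transpose_mul_wave hL, ← add_mul, smul_mul_assoc, mul_assoc, h1,
    mul_one]
  module

/-! ### Characteristic polynomials with and without the field -/

theorem prod_range_eq_det {L : ℕ} (hL : L ≠ 0) (z : ℂ) :
    (z • (1 : Matrix (Fin L) (Fin L) ℂ) -
        (-(1 / 2) : ℂ) • (antiperiodicShift L + (antiperiodicShift L)ᵀ)).det =
      ∏ k : Fin L, (z + (Real.cos (momentum L k) : ℂ)) := by
  have h1 := congrArg det (waveMatrix_mul_waveInv hL)
  rw [det_mul, det_one] at h1
  rw [free_eq_wave hL, det_mul, det_mul, det_diagonal, mul_right_comm, h1, one_mul]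

theorem prod_energy_eq_det {L : ℕ} (ν : Fin L) (h : ℝ) (z : ℂ) :
    ∏ k, (z - (energy L ν h k : ℂ)) = (z • 1 - oneParticle L ν h).det := by
  have h1 := (oneParticle_isHermitian ν h).charpoly_eq
  have h2 := eval_charpoly (oneParticle L ν h) z
  rw [h1, Polynomial.eval_prod] at h2
  simp only [Polynomial.eval_sub, Polynomial.eval_X, Polynomial.eval_C] at h2
  rw [smul_one_eq_diagonal]
  exact h2

theorem prod_energy_zero {L : ℕ} (ν : Fin L) (z : ℂ) :
    ∏ k, (z - (energy L ν 0 k : ℂ)) = ∏ k : Fin L, (z + (Real.cos (momentum L k) : ℂ)) := by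
  have hL : L ≠ 0 := by have := ν.isLt; omega
  rw [prod_energy_eq_det, ← prod_range_eq_det hL, oneParticle]
  simp

/-- The determinant formula: `F_L` is the quotient of the characteristic polynomials. -/
theorem prod_energy_eq {L : ℕ} (hL : Even L) (ν : Fin L) (h : ℝ) {z : ℂ}
    (hz : ∏ k : Fin L, (z + (Real.cos (momentum L k) : ℂ)) ≠ 0) :
    ∏ k, (z - (energy L ν h k : ℂ)) =
      (∏ k : Fin L, (z + (Real.cos (momentum L k) : ℂ))) * finiteF L h z := by
  have hL0 : L ≠ 0 := by have := ν.isLt; omega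
  set A := z • (1 : Matrix (Fin L) (Fin L) ℂ) -
        (-(1 / 2) : ℂ) • (antiperiodicShift L + (antiperiodicShift L)ᵀ) with hA
  have hz' : ∀ k : Fin L, z + (Real.cos (momentum L k) : ℂ) ≠ 0 := fun k =>
    Finset.prod_ne_zero_iff.mp hz k (Finset.mem_univ k)
  have hVW := waveMatrix_mul_waveInv hL0
  have hWV : waveInv L * waveMatrix L = 1 := mul_eq_one_comm.mp hVW
  have hinv : A⁻¹ = waveMatrix L *
      (diagonal fun k : Fin L => (z + (Real.cos (momentum L k) : ℂ))⁻¹) * waveInv L := by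
    refine inv_eq_right_inv ?_
    rw [hA, free_eq_wave hL0]
    calc _ = waveMatrix L * (diagonal fun k : Fin L => z + (Real.cos (momentum L k) : ℂ)) *
          (waveInv L * waveMatrix L) *
          (diagonal fun k : Fin L => (z + (Real.cos (momentum L k) : ℂ))⁻¹) * waveInv L := by
            simp only [mul_assoc]
      _ = 1 := by
        rw [hWV, mul_one, mul_assoc (waveMatrix L), diagonal_mul_diagonal]
        simp only [mul_inv_cancel₀ (hz' _)]
        rw [diagonal_one, mul_one, hVW]
  have hdet := prod_range_eq_det hL0 z
  have hU : IsUnit A.det := by rw [hA, hdet]; exact isUnit_iff_ne_zero.mpr hz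
  -- The perturbation is a column times a row, so the matrix determinant lemma reduces the quotient
  -- of determinants to one entry of A⁻¹.
  have hsplit : z • 1 - oneParticle L ν h =
      A + replicateCol Unit (Pi.single ν (2 * h : ℂ)) * replicateRow Unit (Pi.single ν (1 : ℂ)) := by
    rw [oneParticle, hA, ← sub_add]
    congr 1
    ext i j
    simp only [Matrix.smul_apply, diagonal_apply, mul_apply, replicateCol_apply,
      replicateRow_apply, Finset.univ_unique, Finset.sum_singleton, Pi.single_apply, smul_eq_mul]
    split_ifs <;> simp_all
  rw [prod_energy_eq_det, hsplit, det_add_replicateCol_mul_replicateRow hU, ← hdet, ← hA]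
  congr 1
  rw [det_unique, Matrix.add_apply, one_apply_eq, finiteF_eq hL]
  congr 1
  -- On the diagonal the phases of the plane wave and of its inverse cancel; this is why nothing
  -- depends on ν.
  have hR : A⁻¹ ν ν = freeGreen L z := by
    rw [hinv, mul_apply, freeGreen, Finset.mul_sum,
      ← Fin.sum_univ_eq_sum_range (fun k => (L : ℂ)⁻¹ * (z + (Real.cos (momentum L k) : ℂ))⁻¹) L]
    refine Finset.sum_congr rfl fun k _ => ?_
    have hp : phase L k ^ ν.val ≠ 0 := pow_ne_zero _ (phase_ne_zero L k)
    rw [mul_diagonal, waveMatrix, waveInv, of_apply, of_apply, inv_pow]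
    field_simp
  rw [← hR, mul_apply]
  simp only [mul_apply (N := A⁻¹), replicateRow_apply, replicateCol_apply, Pi.single_apply, ite_mul,
    one_mul, zero_mul, mul_ite, mul_zero, Finset.sum_ite_eq', Finset.mem_univ, if_true]
  rw [mul_comm]

end XYChain

/-! ### Zeros of `F_L` and of its limit; the limit `L → ∞` -/

namespace XYChain

theorem one_le_sqrt_one_add (h : ℝ) : 1 ≤ Real.sqrt (1 + 4 * h ^ 2) := by
  rw [Real.one_le_sqrt]; nlinarith [sq_nonneg h]

theorem mem_limitInterval {h : ℝ} {z : ℂ} : z ∈ limitInterval h ↔ z.im = 0 ∧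
    ((h ≤ 0 ∧ -1 ≤ z.re ∧ z.re ≤ Real.sqrt (1 + 4 * h ^ 2)) ∨
      (0 < h ∧ -Real.sqrt (1 + 4 * h ^ 2) ≤ z.re ∧ z.re ≤ 1)) := by
  unfold limitInterval
  split_ifs with hh
  · constructor
    · rintro ⟨x, hx, rfl⟩
      exact ⟨Complex.ofReal_im x, Or.inl ⟨hh, by simpa using hx.1, by simpa using hx.2⟩⟩
    · rintro ⟨h0, ⟨_, h1, h2⟩ | ⟨h1, _⟩⟩
      · exact ⟨z.re, ⟨h1, h2⟩, Complex.ext (by simp) (by simp [h0])⟩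
      · linarith
  · constructor
    · rintro ⟨x, hx, rfl⟩
      exact ⟨Complex.ofReal_im x, Or.inr ⟨lt_of_not_ge hh, by simpa using hx.1, by simpa using hx.2⟩⟩
    · rintro ⟨h0, ⟨h1, _⟩ | ⟨_, h1, h2⟩⟩
      · exact absurd h1 hh
      · exact ⟨z.re, ⟨h1, h2⟩, Complex.ext (by simp) (by simp [h0])⟩

theorem cut_subset_limitInterval (h : ℝ) : cut ⊆ limitInterval h := by
  intro z hz
  obtain ⟨h0, h1, h2⟩ := mem_cut.mp hz
  have h3 := one_le_sqrt_one_add h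
  rw [mem_limitInterval]
  refine ⟨h0, ?_⟩
  rcases le_or_gt h 0 with hh | hh
  · exact Or.inl ⟨hh, h1, by linarith⟩
  · exact Or.inr ⟨hh, by linarith, h2⟩

theorem isCompact_limitInterval (h : ℝ) : IsCompact (limitInterval h) := by
  unfold limitInterval
  split_ifs <;> exact isCompact_Icc.image Complex.continuous_ofReal

/-- If `z² - 1` has a real root on the branch, `1 + 2hρ/√(z²-1)` does not vanish off the interval. -/
theorem one_add_div_pos {h t ρ : ℝ} {z : ℂ} (hz : z ∉ limitInterval h) (hs : sqrtBranch z = t)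
    (hρ0 : 0 < ρ) (hρ1 : ρ ≤ 1) : 0 < 1 + 2 * h * ρ / t := by
  have hcut : z ∉ cut := fun hh => hz (cut_subset_limitInterval h hh)
  have ht : t ≠ 0 := by
    rintro rfl
    exact sqrtBranch_ne_zero hcut (by simpa using hs)
  have hpos := sqrtBranch_pos hcut
  have hsq := sqrtBranch_sq z
  rw [hs] at hpos hsq
  have hre := congrArg Complex.re hsq
  have him := congrArg Complex.im hsq
  simp only [pow_two, Complex.mul_re, Complex.mul_im, Complex.sub_re, Complex.sub_im,
    Complex.one_re, Complex.one_im, Complex.ofReal_re, Complex.ofReal_im] at hre him hpos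
  have hre0 : z.re ≠ 0 := by rintro h0; rw [h0] at hpos; simp at hpos
  have him0 : z.im = 0 := by
    have : z.re * z.im = 0 := by linarith
    exact (mul_eq_zero.mp this).resolve_left hre0
  have hzsq : z.re ^ 2 = 1 + t ^ 2 := by rw [him0] at hre; nlinarith
  have hprod : 0 < z.re * t := by simpa [him0] using hpos
  by_contra hcon
  push Not at hcon
  have hr0 := Real.sqrt_nonneg (1 + 4 * h ^ 2)
  -- A nonpositive value forces |2hρ/t| ≥ 1 with ρ ≤ 1, hence z² = 1 + t² ≤ 1 + 4h². The factor ρ is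
  -- there for finite volume, where it is (1 - w^L)/(1 + w^L); in the limit it is 1.
  have hbd : t ^ 2 ≤ 4 * h ^ 2 := by
    have h1 : 2 * h * ρ / t * (2 * h * ρ / t) ≥ 1 := by nlinarith
    have h2 : (2 * h * ρ / t) * (2 * h * ρ / t) * t ^ 2 = 4 * h ^ 2 * ρ ^ 2 := by
      field_simp; ring
    have h3 : ρ ^ 2 ≤ 1 := by nlinarith
    nlinarith [sq_nonneg t, sq_nonneg h]
  have habs : |z.re| ≤ Real.sqrt (1 + 4 * h ^ 2) := by
    rw [← Real.sqrt_sq_eq_abs]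
    exact Real.sqrt_le_sqrt (by nlinarith)
  -- It also forces t, and with it z, to have the sign opposite to h, which selects the side on
  -- which the interval extends beyond the cut.
  have hsign : h * t < 0 := by
    have h1 : 2 * h * ρ / t < 0 := by linarith
    have h2 : 2 * h * ρ / t * t ^ 2 = 2 * ρ * (h * t) := by field_simp
    have h3 : 0 < t ^ 2 := by positivity
    have h4 : 2 * ρ * (h * t) < 0 := by rw [← h2]; exact mul_neg_of_neg_of_pos h1 h3
    by_contra hc
    push Not at hc
    have : 0 ≤ 2 * ρ * (h * t) := by positivity
    linarith
  apply hz
  rw [mem_limitInterval]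
  refine ⟨him0, ?_⟩
  rcases le_or_gt h 0 with hh | hh
  · have ht0 : 0 < t := by by_contra hc; push Not at hc; nlinarith
    have hz0 : 0 < z.re := by by_contra hc; push Not at hc; nlinarith
    exact Or.inl ⟨hh, by linarith, (abs_le.mp habs).2⟩
  · have ht0 : t < 0 := by by_contra hc; push Not at hc; nlinarith
    have hz0 : z.re < 0 := by by_contra hc; push Not at hc; nlinarith
    exact Or.inr ⟨hh, (abs_le.mp habs).1, by linarith⟩

/-- If the value were real and nonpositive, solving for the square root would show that it is real,
contrary to `one_add_div_pos` with ρ = 1. So the principal logarithm is holomorphic on a whole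
neighbourhood of any admissible contour. -/
theorem limitF_mem_slitPlane {h : ℝ} {z : ℂ} (hz : z ∉ limitInterval h) :
    1 + 2 * h * (sqrtBranch z)⁻¹ ∈ Complex.slitPlane := by
  by_contra hcon
  have hcut : z ∉ cut := fun hh => hz (cut_subset_limitInterval h hh)
  have hs := sqrtBranch_ne_zero hcut
  rw [Complex.mem_slitPlane_iff] at hcon
  push Not at hcon
  set F := 1 + 2 * h * (sqrtBranch z)⁻¹ with hF
  have hFr : F = (F.re : ℂ) := Complex.ext (by simp) (by simp [hcon.2])
  have hr1 : (F.re - 1 : ℝ) ≠ 0 := by linarith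
  have hst : sqrtBranch z = ((2 * h / (F.re - 1) : ℝ) : ℂ) := by
    have h1 : (F.re : ℂ) - 1 = 2 * h * (sqrtBranch z)⁻¹ := by rw [← hFr, hF]; ring
    have h2 : (F.re : ℂ) - 1 ≠ 0 := by exact_mod_cast hr1
    push_cast
    rw [eq_div_iff h2, h1]
    field_simp
  have h0 : h ≠ 0 := by
    rintro rfl
    apply hs
    rw [hst]; simp
  have := one_add_div_pos hz hst one_pos le_rfl
  have h3 : 1 + 2 * h * 1 / (2 * h / (F.re - 1)) = F.re := by field_simp; ring
  rw [h3] at this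
  linarith [hcon.1]

theorem sqrtBranch_real {z : ℂ} (hz : z ∉ cut) (him : z.im = 0) :
    sqrtBranch z = ((sqrtBranch z).re : ℂ) := by
  have hsq := sqrtBranch_sq z
  have hre := congrArg Complex.re hsq
  have him' := congrArg Complex.im hsq
  have hpos := sqrtBranch_pos hz
  simp only [pow_two, Complex.mul_re, Complex.mul_im, Complex.sub_re, Complex.sub_im,
    Complex.one_re, Complex.one_im, him] at hre him' hpos
  refine Complex.ext (by simp) ?_
  rw [Complex.ofReal_im]
  have h1 : (sqrtBranch z).re ≠ 0 := by rintro h0; rw [h0] at hpos; simp at hpos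
  have : (sqrtBranch z).re * (sqrtBranch z).im = 0 := by linarith
  exact (mul_eq_zero.mp this).resolve_left h1

theorem add_cos_ne_zero {z : ℂ} (hz : z ∉ cut) (x : ℝ) : z + (Real.cos x : ℂ) ≠ 0 := by
  intro h
  apply hz
  rw [eq_neg_of_add_eq_zero_left h, neg_mem_cut]
  exact ⟨Real.cos x, ⟨Real.neg_one_le_cos x, Real.cos_le_one x⟩, rfl⟩

/-- Every summand has imaginary part of the sign opposite to that of Im z, so nothing cancels: off
the real axis 1 + 2hG_L is not real when h ≠ 0. -/
theorem freeGreen_im {L : ℕ} (hL0 : L ≠ 0) {z : ℂ} (hz : z.im ≠ 0) :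
    ∃ c : ℝ, 0 < c ∧ (freeGreen L z).im = -(z.im * c) := by
  have hcut : z ∉ cut := fun h => hz (mem_cut.mp h).1
  refine ⟨(L : ℝ)⁻¹ * ∑ k ∈ Finset.range L, (Complex.normSq (z + (Real.cos (momentum L k) : ℂ)))⁻¹,
    ?_, ?_⟩
  · refine mul_pos (by positivity) (Finset.sum_pos (fun k _ => ?_) (by simpa using hL0))
    exact inv_pos.mpr (Complex.normSq_pos.mpr (add_cos_ne_zero hcut _))
  · rw [freeGreen, show ((L : ℂ)⁻¹) = (((L : ℝ)⁻¹ : ℝ) : ℂ) by push_cast; rfl, Complex.im_ofReal_mul,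
      Complex.im_sum]
    simp only [Complex.inv_im, Complex.add_im, Complex.ofReal_im, add_zero, neg_div]
    rw [Finset.sum_neg_distrib, mul_neg, Finset.mul_sum, Finset.mul_sum, Finset.mul_sum]
    congr 1
    exact Finset.sum_congr rfl fun k _ => by ring

/-- On the real axis w is real and, L being even, 0 ≤ w^L < 1, so `one_add_div_pos` applies with ρ =
(1 - w^L)/(1 + w^L). Off the axis `freeGreen_im` suffices. The excluded set does not depend on L. -/
theorem finiteF_mem_slitPlane {L : ℕ} (hL : Even L) (hL0 : L ≠ 0) {h : ℝ} {z : ℂ}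
    (hz : z ∉ limitInterval h) : 1 + 2 * h * freeGreen L z ∈ Complex.slitPlane := by
  have hcut : z ∉ cut := fun hh => hz (cut_subset_limitInterval h hh)
  rcases eq_or_ne h 0 with h0 | h0
  · simp [h0]
  rw [Complex.mem_slitPlane_iff]
  by_cases him : z.im = 0
  · left
    have hs := sqrtBranch_real hcut him
    set t := (sqrtBranch z).re
    have hw : joukowski z = ((z.re - t : ℝ) : ℂ) := by
      rw [joukowski, hs]
      refine Complex.ext (by simp) (by simp [him])
    have hw1 := norm_joukowski_lt hcut
    rw [hw, Complex.norm_real, Real.norm_eq_abs] at hw1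
    set w := z.re - t
    have hwL : w ^ L < 1 := by
      rw [← hL.pow_abs]; exact pow_lt_one₀ (abs_nonneg _) hw1 hL0
    have hwL0 : 0 ≤ w ^ L := hL.pow_nonneg w
    have hG : 1 + 2 * h * freeGreen L z =
        ((1 + 2 * h * ((1 - w ^ L) / (1 + w ^ L)) / t : ℝ) : ℂ) := by
      rw [freeGreen_eq hL hL0 hcut, hw, hs]
      push_cast
      ring
    rw [hG, Complex.ofReal_re]
    exact one_add_div_pos hz hs (div_pos (by linarith) (by linarith))
      ((div_le_one (by linarith)).mpr (by linarith))
  · right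
    obtain ⟨c, hc, hcim⟩ := freeGreen_im hL0 him
    have : (1 + 2 * h * freeGreen L z).im = 2 * h * (freeGreen L z).im := by
      rw [Complex.add_im, Complex.one_im, zero_add,
        show (2 * h : ℂ) = ((2 * h : ℝ) : ℂ) by push_cast; rfl, Complex.im_ofReal_mul]
    rw [this, hcim]
    have := hc.ne'
    simp [h0, him, this]

theorem neg_cos_mem_limitInterval (h x : ℝ) : -(Real.cos x : ℂ) ∈ limitInterval h := by
  apply cut_subset_limitInterval
  rw [neg_mem_cut]
  exact ⟨Real.cos x, ⟨Real.neg_one_le_cos x, Real.cos_le_one x⟩, rfl⟩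

theorem finiteSingularities_subset {L : ℕ} (hL : Even L) (hL0 : L ≠ 0) (h : ℝ) :
    finiteSingularities L h ⊆ limitInterval h := by
  rintro z (hz | ⟨n, _, rfl⟩)
  · by_contra hcon
    have h1 := Complex.slitPlane_ne_zero (finiteF_mem_slitPlane hL hL0 hcon)
    rw [← finiteF_eq hL] at h1
    exact h1 hz
  · exact neg_cos_mem_limitInterval h _

/-! ### Convergence of the Green functions off the cut -/

theorem differentiableAt_freeGreen (L : ℕ) {z : ℂ} (hz : z ∉ cut) :
    DifferentiableAt ℂ (freeGreen L) z := by
  unfold freeGreen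
  refine DifferentiableAt.const_mul (DifferentiableAt.fun_sum fun k _ => ?_) _
  exact (differentiableAt_id.add_const _).inv (add_cos_ne_zero hz _)

/-- On a compact set |w| attains a maximum r < 1, so the relative error 2w^L/(1 + w^L) is at most
2r^L/(1 - r). The sizes 2k + 2 run through all even L ≥ 2. -/
theorem tendstoUniformlyOn_freeGreen {K : Set ℂ} (hK : IsCompact K) (hcut : K ⊆ cutᶜ) :
    TendstoUniformlyOn (fun k : ℕ => freeGreen (2 * k + 2)) (fun z => (sqrtBranch z)⁻¹) atTop K := by
  rcases K.eq_empty_or_nonempty with rfl | hne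
  · exact tendstoUniformlyOn_empty
  have hcw : ContinuousOn (fun z => ‖joukowski z‖) K := (continuousOn_joukowski.mono hcut).norm
  obtain ⟨z₀, hz₀, hmax⟩ := hK.exists_isMaxOn hne hcw
  set r := ‖joukowski z₀‖ with hr
  have hr1 : r < 1 := norm_joukowski_lt (hcut hz₀)
  have hr0 : 0 ≤ r := norm_nonneg _
  have hcs : ContinuousOn (fun z => (sqrtBranch z)⁻¹) K :=
    (continuousOn_sqrtBranch.mono hcut).inv₀ fun z hz => sqrtBranch_ne_zero (hcut hz)
  obtain ⟨M, hM⟩ := hK.exists_bound_of_continuousOn hcs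
  have hM0 : 0 ≤ M := (norm_nonneg _).trans (hM z₀ hz₀)
  have hlim : Tendsto (fun k : ℕ => M * (2 * r ^ (2 * k + 2) / (1 - r))) atTop (𝓝 0) := by
    have h1 : Tendsto (fun k : ℕ => r ^ (2 * k + 2)) atTop (𝓝 0) :=
      (tendsto_pow_atTop_nhds_zero_of_lt_one hr0 hr1).comp
        (tendsto_atTop_mono (fun k => by simp only [id]; omega) tendsto_id)
    simpa using ((h1.const_mul 2).div_const (1 - r)).const_mul M
  rw [Metric.tendstoUniformlyOn_iff]
  intro ε hε
  filter_upwards [hlim.eventually (gt_mem_nhds hε)] with k hk z hz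
  refine lt_of_le_of_lt ?_ hk
  have hev : Even (2 * k + 2) := ⟨k + 1, by ring⟩
  set L := 2 * k + 2 with hLdef
  have hwz : ‖joukowski z ^ L‖ ≤ r ^ L := by
    rw [norm_pow]; exact pow_le_pow_left₀ (norm_nonneg _) (hmax hz) _
  have hrL : r ^ L ≤ r := pow_le_of_le_one hr0 hr1.le (by omega)
  have hden : 1 - r ≤ ‖1 + joukowski z ^ L‖ := by
    have := norm_sub_le_norm_add 1 (joukowski z ^ L)
    rw [norm_one] at this
    linarith
  have hden0 : 1 + joukowski z ^ L ≠ 0 := norm_pos_iff.mp (by linarith)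
  rw [dist_eq_norm, freeGreen_eq hev (by omega) (hcut hz)]
  have : (sqrtBranch z)⁻¹ - (sqrtBranch z)⁻¹ *
      ((1 - joukowski z ^ L) / (1 + joukowski z ^ L)) =
      (sqrtBranch z)⁻¹ * (2 * joukowski z ^ L / (1 + joukowski z ^ L)) := by
    field_simp; ring
  rw [this, norm_mul, norm_div, norm_mul, Complex.norm_two]
  refine mul_le_mul (hM z hz) ?_ (by positivity) hM0
  exact div_le_div₀ (by positivity) (by linarith) (by linarith) hden

theorem tendsto_finiteF (h : ℝ) {z : ℂ} (hz : z ∉ cut) :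
    Tendsto (fun k : ℕ => finiteF (2 * k + 2) h z) atTop (𝓝 (1 + 2 * h / sqrtBranch z)) := by
  have h1 := (tendstoUniformlyOn_freeGreen isCompact_singleton
    (Set.singleton_subset_iff.mpr hz)).tendsto_at (Set.mem_singleton z)
  have h2 := (h1.const_mul (2 * h : ℂ)).const_add 1
  refine h2.congr fun k => (finiteF_eq ⟨k + 1, by ring⟩ h z).symm

/-- The partial fractions of the finite sum have an explicit primitive. Its logarithms of 1 +
we^{±iq} are principal because |w| < 1, and they cancel at both endpoints, where e^{iq} = e^{-iq};
only the linear term is left. -/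
theorem integral_inv_add_cos {z : ℂ} (hz : z ∉ cut) :
    ∫ q in (0 : ℝ)..Real.pi, 1 / (z + (Real.cos q : ℂ)) = Real.pi / sqrtBranch z := by
  have hs := sqrtBranch_ne_zero hz
  have hw0 := joukowski_ne_zero z
  have hw1 := norm_joukowski_lt hz
  have hzw := eq_joukowski z
  have hsw := sqrtBranch_eq_joukowski z
  set w := joukowski z
  set s := sqrtBranch z
  have hslit : ∀ u : ℂ, ‖u‖ < 1 → 1 + u ∈ Complex.slitPlane := fun u hu =>
    Complex.mem_slitPlane_of_norm_lt_one hu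
  set E : ℝ → ℂ := fun q => Complex.exp (q * Complex.I)
  have hE : ∀ q, ‖E q‖ = 1 := fun q => Complex.norm_exp_ofReal_mul_I q
  have hE0 : ∀ q, E q ≠ 0 := fun q => Complex.exp_ne_zero _
  have h1 : ∀ q, 1 + w * E q ∈ Complex.slitPlane := fun q =>
    hslit _ (by rw [norm_mul, hE, mul_one]; exact hw1)
  have h2 : ∀ q, 1 + w * (E q)⁻¹ ∈ Complex.slitPlane := fun q =>
    hslit _ (by rw [norm_mul, norm_inv, hE, inv_one, mul_one]; exact hw1)
  have hdE : ∀ q, HasDerivAt E (E q * Complex.I) q := fun q => by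
    have := ((Complex.ofRealCLM.hasDerivAt (x := q)).mul_const Complex.I).cexp
    simpa using this
  have hdE' : ∀ q, HasDerivAt (fun q => (E q)⁻¹) (-((E q)⁻¹ * Complex.I)) q := fun q => by
    refine ((hdE q).inv (hE0 q)).congr_deriv ?_
    have := hE0 q
    field_simp
  set P : ℝ → ℂ := fun q => s⁻¹ * ((q : ℂ) + Complex.I * Complex.log (1 + w * E q) -
    Complex.I * Complex.log (1 + w * (E q)⁻¹))
  have hP : ∀ q, HasDerivAt P (1 / (z + (Real.cos q : ℂ))) q := by
    intro q
    have d1 := (((hdE q).const_mul w).const_add 1).clog_real (h1 q)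
    have d2 := (((hdE' q).const_mul w).const_add 1).clog_real (h2 q)
    have d3 := (((Complex.ofRealCLM.hasDerivAt (x := q)).add (d1.const_mul Complex.I)).sub
      (d2.const_mul Complex.I)).const_mul s⁻¹
    refine d3.congr_deriv ?_
    have n0 := hE0 q
    have n1 := Complex.slitPlane_ne_zero (h1 q)
    have n2 := Complex.slitPlane_ne_zero (h2 q)
    have hcos : (Real.cos q : ℂ) = (E q + (E q)⁻¹) / 2 := by
      simp only [E]
      rw [← Complex.exp_neg, Complex.ofReal_cos, Complex.cos, neg_mul]
    have hzc : z + (Real.cos q : ℂ) = (1 + w * E q) * (1 + w * (E q)⁻¹) / (2 * w) := by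
      rw [hcos, hzw]; field_simp; ring
    have hI : Complex.I ^ 2 = -1 := Complex.I_sq
    have e3 : s⁻¹ * (1 - w ^ 2) = 2 * w := by
      rw [inv_mul_eq_iff_eq_mul₀ hs, hsw]; field_simp
    rw [hzc, one_div, inv_div, ← e3, eq_div_iff (mul_ne_zero n1 n2)]
    simp only [Complex.ofRealCLM_apply, Complex.ofReal_one]
    have m1 : w * (E q * Complex.I) / (1 + w * E q) * (1 + w * E q) = w * (E q * Complex.I) :=
      div_mul_cancel₀ _ n1
    have m2 : w * -((E q)⁻¹ * Complex.I) / (1 + w * (E q)⁻¹) * (1 + w * (E q)⁻¹) =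
        w * -((E q)⁻¹ * Complex.I) := div_mul_cancel₀ _ n2
    have m3 : E q * (E q)⁻¹ = 1 := mul_inv_cancel₀ n0
    generalize (E q)⁻¹ = e' at *
    generalize w * (E q * Complex.I) / (1 + w * E q) = A at *
    generalize w * -(e' * Complex.I) / (1 + w * e') = B at *
    linear_combination s⁻¹ * Complex.I * (1 + w * e') * m1 - s⁻¹ * Complex.I * (1 + w * E q) * m2 +
      s⁻¹ * (w * E q * (1 + w * e') + w * e' * (1 + w * E q)) * hI - s⁻¹ * w ^ 2 * m3
  have hcont : Continuous fun q : ℝ => 1 / (z + (Real.cos q : ℂ)) :=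
    continuous_const.div (continuous_const.add (Complex.continuous_ofReal.comp Real.continuous_cos))
      fun q => add_cos_ne_zero hz q
  rw [intervalIntegral.integral_eq_sub_of_hasDerivAt (fun q _ => hP q)
    (hcont.intervalIntegrable _ _)]
  have e0 : E 0 = 1 := by simp [E]
  have e1 : E Real.pi = -1 := by simp [E]
  simp only [P, e0, e1, inv_one, inv_neg]
  push_cast
  ring

end XYChain

/-! ### Integrals along closed curves -/

namespace XYChain

open MeasureTheory

/-- Differentiation under the integral sign over `[0, 1]`, with an integrable weight. -/
theorem hasDerivAt_integral_mul {𝕜 : Type*} [RCLike 𝕜] [NormedAlgebra 𝕜 ℂ] {F F' : 𝕜 → ℝ → ℂ}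
    {w : ℝ → ℂ} {x₀ : 𝕜} {δ : ℝ} (hδ : 0 < δ) (hw : IntervalIntegrable w volume 0 1)
    (hF : ContinuousOn (Function.uncurry F) (Metric.closedBall x₀ δ ×ˢ Set.Icc 0 1))
    (hF' : ContinuousOn (Function.uncurry F') (Metric.closedBall x₀ δ ×ˢ Set.Icc 0 1))
    (hd : ∀ x ∈ Metric.closedBall x₀ δ, ∀ t ∈ Set.Icc (0 : ℝ) 1,
      HasDerivAt (fun y => F y t) (F' x t) x) :
    HasDerivAt (fun x => ∫ t in (0 : ℝ)..1, F x t * w t) (∫ t in (0 : ℝ)..1, F' x₀ t * w t) x₀ := by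
  have hI : Set.uIcc (0 : ℝ) 1 = Set.Icc 0 1 := Set.uIcc_of_le zero_le_one
  have hsub : Set.uIoc (0 : ℝ) 1 ⊆ Set.Icc 0 1 := by
    rw [Set.uIoc_of_le zero_le_one]; exact Set.Ioc_subset_Icc_self
  have hsec : ∀ {G : 𝕜 → ℝ → ℂ},
      ContinuousOn (Function.uncurry G) (Metric.closedBall x₀ δ ×ˢ Set.Icc 0 1) →
      ∀ x ∈ Metric.closedBall x₀ δ, IntervalIntegrable (fun t => G x t * w t) volume 0 1 := by
    intro G hG x hx
    refine hw.continuousOn_mul ?_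
    rw [hI]
    exact hG.comp (f := fun t => (x, t)) (by fun_prop) fun t ht => ⟨hx, ht⟩
  obtain ⟨C, hC⟩ := ((isCompact_closedBall x₀ δ).prod isCompact_Icc).exists_bound_of_continuousOn hF'
  refine (intervalIntegral.hasDerivAt_integral_of_dominated_loc_of_deriv_le
    (bound := fun t => C * ‖w t‖) (F := fun x t => F x t * w t) (F' := fun x t => F' x t * w t)
    (Metric.closedBall_mem_nhds x₀ hδ) ?_ ?_ ?_ ?_ ?_ ?_).2
  · filter_upwards [Metric.closedBall_mem_nhds x₀ hδ] with x hx
    exact (intervalIntegrable_iff.mp (hsec hF x hx)).aestronglyMeasurable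
  · exact hsec hF x₀ (Metric.mem_closedBall_self hδ.le)
  · exact (intervalIntegrable_iff.mp
      (hsec hF' x₀ (Metric.mem_closedBall_self hδ.le))).aestronglyMeasurable
  · refine ae_of_all _ fun t ht x hx => ?_
    rw [norm_mul]
    exact mul_le_mul_of_nonneg_right (hC (x, t) ⟨hx, hsub ht⟩) (norm_nonneg _)
  · exact hw.norm.const_mul C
  · exact ae_of_all _ fun t ht x hx => (hd x hx t (hsub ht)).mul_const _

theorem IsClosedCurve.intervalIntegrable_mul {γ : ℝ → ℂ} (hγ : IsClosedCurve γ) {φ : ℝ → ℂ}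
    (hφ : ContinuousOn φ (Set.Icc 0 1)) :
    IntervalIntegrable (fun t => φ t * deriv γ t) volume 0 1 :=
  hγ.integrable.continuousOn_mul (by rwa [Set.uIcc_of_le zero_le_one])

theorem contourIntegral_add {γ : ℝ → ℂ} (hγ : IsClosedCurve γ) {f g : ℂ → ℂ}
    (hf : ContinuousOn (fun t => f (γ t)) (Set.Icc 0 1))
    (hg : ContinuousOn (fun t => g (γ t)) (Set.Icc 0 1)) :
    contourIntegral γ (fun z => f z + g z) = contourIntegral γ f + contourIntegral γ g := by
  simp only [contourIntegral, add_mul]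
  exact intervalIntegral.integral_add (hγ.intervalIntegrable_mul hf) (hγ.intervalIntegrable_mul hg)

theorem contourIntegral_sub {γ : ℝ → ℂ} (hγ : IsClosedCurve γ) {f g : ℂ → ℂ}
    (hf : ContinuousOn (fun t => f (γ t)) (Set.Icc 0 1))
    (hg : ContinuousOn (fun t => g (γ t)) (Set.Icc 0 1)) :
    contourIntegral γ (fun z => f z - g z) = contourIntegral γ f - contourIntegral γ g := by
  simp only [contourIntegral, sub_mul]
  exact intervalIntegral.integral_sub (hγ.intervalIntegrable_mul hf) (hγ.intervalIntegrable_mul hg)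

theorem contourIntegral_const_mul (γ : ℝ → ℂ) (c : ℂ) (f : ℂ → ℂ) :
    contourIntegral γ (fun z => c * f z) = c * contourIntegral γ f := by
  simp only [contourIntegral, mul_assoc]
  exact intervalIntegral.integral_const_mul _ _

theorem contourIntegral_sum {ι : Type*} {γ : ℝ → ℂ} (hγ : IsClosedCurve γ) (s : Finset ι)
    {f : ι → ℂ → ℂ} (hf : ∀ i ∈ s, ContinuousOn (fun t => f i (γ t)) (Set.Icc 0 1)) :
    contourIntegral γ (fun z => ∑ i ∈ s, f i z) = ∑ i ∈ s, contourIntegral γ (f i) := by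
  simp only [contourIntegral, Finset.sum_mul]
  exact intervalIntegral.integral_finsetSum fun i hi => hγ.intervalIntegrable_mul (hf i hi)

theorem contourIntegral_congr {γ : ℝ → ℂ} {f g : ℂ → ℂ}
    (h : ∀ t ∈ Set.Icc (0 : ℝ) 1, f (γ t) = g (γ t)) :
    contourIntegral γ f = contourIntegral γ g := by
  refine intervalIntegral.integral_congr fun t ht => ?_
  rw [Set.uIcc_of_le zero_le_one] at ht
  simp only [h t ht]

/-- The integral of a derivative along a closed curve vanishes. -/
theorem contourIntegral_eq_zero {γ : ℝ → ℂ} (hγ : IsClosedCurve γ) {U u : ℂ → ℂ}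
    (hU : ∀ t ∈ Set.Icc (0 : ℝ) 1, HasDerivAt U (u (γ t)) (γ t))
    (hu : ContinuousOn (fun t => u (γ t)) (Set.Icc 0 1)) : contourIntegral γ u = 0 := by
  obtain ⟨s, hs, hd⟩ := hγ.differentiable
  rw [contourIntegral, integral_eq_of_hasDerivAt_off_countable_of_le (fun t => U (γ t))
    (fun t => u (γ t) * deriv γ t) zero_le_one hs.countable ?_ ?_ (hγ.intervalIntegrable_mul hu),
    hγ.closed, sub_self]
  · intro t ht
    exact (hU t ht).continuousAt.comp_continuousWithinAt (hγ.continuousOn t ht)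
  · intro t ht
    exact (hU t (Set.Ioo_subset_Icc_self ht.1)).comp t (hd t ht.1 ht.2).hasDerivAt

/-- Integration by parts along a closed curve. -/
theorem contourIntegral_by_parts {γ : ℝ → ℂ} (hγ : IsClosedCurve γ) {U u V v : ℂ → ℂ}
    (hU : ∀ t ∈ Set.Icc (0 : ℝ) 1, HasDerivAt U (u (γ t)) (γ t))
    (hu : ContinuousOn (fun t => u (γ t)) (Set.Icc 0 1))
    (hV : ∀ t ∈ Set.Icc (0 : ℝ) 1, HasDerivAt V (v (γ t)) (γ t))
    (hv : ContinuousOn (fun t => v (γ t)) (Set.Icc 0 1)) :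
    contourIntegral γ (fun z => U z * v z) = -contourIntegral γ (fun z => u z * V z) := by
  have hUc : ContinuousOn (fun t => U (γ t)) (Set.Icc 0 1) := fun t ht =>
    (hU t ht).continuousAt.comp_continuousWithinAt (hγ.continuousOn t ht)
  have hVc : ContinuousOn (fun t => V (γ t)) (Set.Icc 0 1) := fun t ht =>
    (hV t ht).continuousAt.comp_continuousWithinAt (hγ.continuousOn t ht)
  have h := contourIntegral_eq_zero hγ (U := fun z => U z * V z)
    (u := fun z => u z * V z + U z * v z) (fun t ht => (hU t ht).mul (hV t ht))
    ((hu.mul hVc).add (hUc.mul hv))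
  rw [contourIntegral_add hγ (hu.mul hVc) (hUc.mul hv)] at h
  exact eq_neg_of_add_eq_zero_right h

/-! ### Cauchy's theorem on the thermal domain -/

theorem isOpen_thermalDomain (β : ℝ) : IsOpen (thermalDomain β) := by
  have : thermalDomain β = {z : ℂ | z.re ≠ 0} ∪ {z | |z.im| < Real.pi / β} := by
    ext z
    simp only [thermalDomain, Set.mem_ofPred_eq, Set.mem_union]
    tauto
  rw [this]
  exact (isOpen_ne_fun Complex.continuous_re continuous_const).union
    (isOpen_lt Complex.continuous_im.abs continuous_const)

theorem ofReal_mem_thermalDomain {β : ℝ} (hβ : 0 < β) (x : ℝ) : (x : ℂ) ∈ thermalDomain β := by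
  intro _
  rw [Complex.ofReal_im, abs_zero]
  have := Real.pi_pos
  positivity

theorem smul_mem_thermalDomain {β : ℝ} (hβ : 0 < β) {z : ℂ} (hz : z ∈ thermalDomain β) {t : ℝ}
    (ht : t ∈ Set.Icc (0 : ℝ) 1) : (t : ℂ) * z ∈ thermalDomain β := by
  intro h
  rw [Complex.re_ofReal_mul] at h
  rw [Complex.im_ofReal_mul, abs_mul, abs_of_nonneg ht.1]
  rcases mul_eq_zero.mp h with h | h
  · have := Real.pi_pos
    rw [h, zero_mul]; positivity
  · have h1 := hz h
    exact lt_of_le_of_lt (mul_le_of_le_one_left (abs_nonneg _) ht.2) h1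

theorem neg_mem_thermalDomain {β : ℝ} {z : ℂ} (hz : z ∈ thermalDomain β) :
    -z ∈ thermalDomain β := by
  intro h
  rw [Complex.neg_im, abs_neg]
  exact hz (by simpa using h)

/-- Holomorphic functions on the star-shaped thermal domain have primitives. -/
theorem exists_primitive {β : ℝ} (hβ : 0 < β) {f : ℂ → ℂ}
    (hf : DifferentiableOn ℂ f (thermalDomain β)) :
    ∃ G : ℂ → ℂ, ∀ z ∈ thermalDomain β, HasDerivAt G (f z) z := by
  have hopen := isOpen_thermalDomain β
  -- The primitive is the integral of f along the segment from 0 to z. The trailing 1 is the weight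
  -- in `hasDerivAt_integral_mul`.
  refine ⟨fun z => ∫ t in (0 : ℝ)..1, f (t * z) * z * 1, fun z₀ hz₀ => ?_⟩
  obtain ⟨δ, hδ, hball⟩ := Metric.nhds_basis_closedBall.mem_iff.mp (hopen.mem_nhds hz₀)
  have hmaps : Set.MapsTo (fun p : ℂ × ℝ => (p.2 : ℂ) * p.1)
      (Metric.closedBall z₀ δ ×ˢ Set.Icc 0 1) (thermalDomain β) := fun p hp =>
    smul_mem_thermalDomain hβ (hball hp.1) hp.2
  have hmul : Continuous fun p : ℂ × ℝ => (p.2 : ℂ) * p.1 := by fun_prop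
  have hfd : ∀ z ∈ thermalDomain β, HasDerivAt f (deriv f z) z := fun z hz =>
    (hf.differentiableAt (hopen.mem_nhds hz)).hasDerivAt
  have hf' : ContinuousOn (deriv f) (thermalDomain β) := (hf.deriv hopen).continuousOn
  have hc : ContinuousOn (fun p : ℂ × ℝ => f (p.2 * p.1))
      (Metric.closedBall z₀ δ ×ˢ Set.Icc 0 1) := hf.continuousOn.comp hmul.continuousOn hmaps
  have hc' : ContinuousOn (fun p : ℂ × ℝ => deriv f (p.2 * p.1))
      (Metric.closedBall z₀ δ ×ˢ Set.Icc 0 1) := hf'.comp hmul.continuousOn hmaps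
  have hcF' : ContinuousOn (fun p : ℂ × ℝ => deriv f (p.2 * p.1) * p.2 * p.1 + f (p.2 * p.1))
      (Metric.closedBall z₀ δ ×ˢ Set.Icc 0 1) :=
    ((hc'.mul (by fun_prop)).mul (by fun_prop)).add hc
  have main := hasDerivAt_integral_mul (𝕜 := ℂ) (F := fun z t => f (t * z) * z)
    (F' := fun z t => deriv f (t * z) * t * z + f (t * z)) (w := fun _ => 1) hδ
    intervalIntegrable_const (hc.mul (by fun_prop)) hcF' ?_
  · refine main.congr_deriv ?_
    -- The integrand obtained by differentiating in z is the t-derivative of t f(tz₀), so it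
    -- integrates to f(z₀).
    have hpt : ∀ t ∈ Set.uIcc (0 : ℝ) 1, HasDerivAt (fun t : ℝ => (t : ℂ) * f (t * z₀))
        ((deriv f (t * z₀) * t * z₀ + f (t * z₀)) * 1) t := by
      intro t ht
      rw [Set.uIcc_of_le zero_le_one] at ht
      have h1 : HasDerivAt (fun t : ℝ => (t : ℂ)) 1 t := Complex.ofRealCLM.hasDerivAt
      have h2 := (hfd _ (smul_mem_thermalDomain hβ hz₀ ht)).comp t (h1.mul_const z₀)
      refine (h1.mul h2).congr_deriv ?_
      simp only [Function.comp]
      ring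
    rw [intervalIntegral.integral_eq_sub_of_hasDerivAt hpt]
    · simp
    · refine ContinuousOn.intervalIntegrable ?_
      rw [Set.uIcc_of_le zero_le_one]
      refine ContinuousOn.mul ?_ continuousOn_const
      exact hcF'.comp (f := fun t : ℝ => (z₀, t)) (by fun_prop)
        fun t ht => ⟨Metric.mem_closedBall_self hδ.le, ht⟩
  · intro z hz t ht
    have h1 := (hfd _ (smul_mem_thermalDomain hβ (hball hz) ht)).comp z
      ((hasDerivAt_id z).const_mul (t : ℂ))
    refine (h1.mul (hasDerivAt_id z)).congr_deriv ?_
    simp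

/-- Cauchy's integral formula for closed curves in the thermal domain. -/
theorem contourIntegral_cauchy {β : ℝ} (hβ : 0 < β) {f : ℂ → ℂ}
    (hf : DifferentiableOn ℂ f (thermalDomain β)) {γ : ℝ → ℂ} (hγ : IsClosedCurve γ)
    (hdom : ∀ t ∈ Set.Icc (0 : ℝ) 1, γ t ∈ thermalDomain β) {w : ℂ} (hw : w ∈ thermalDomain β)
    (hav : ∀ t ∈ Set.Icc (0 : ℝ) 1, γ t ≠ w) :
    contourIntegral γ (fun z => f z * (z - w)⁻¹) =
      2 * Real.pi * Complex.I * (f w * windingNumber γ w) := by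
  have hopen := isOpen_thermalDomain β
  -- The difference quotient has a removable singularity at w, hence a primitive and zero integral;
  -- the subtracted f(w)/(z - w) gives the winding number.
  have hds : DifferentiableOn ℂ (dslope f w) (thermalDomain β) :=
    (Complex.differentiableOn_dslope (hopen.mem_nhds hw)).mpr hf
  obtain ⟨G, hG⟩ := exists_primitive hβ hds
  have hinv : ContinuousOn (fun t => (γ t - w)⁻¹) (Set.Icc 0 1) :=
    (hγ.continuousOn.sub continuousOn_const).inv₀ fun t ht => sub_ne_zero.mpr (hav t ht)
  have hfc : ContinuousOn (fun t => f (γ t)) (Set.Icc 0 1) :=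
    hf.continuousOn.comp hγ.continuousOn hdom
  have h0 := contourIntegral_eq_zero hγ (fun t ht => hG _ (hdom t ht))
    (hds.continuousOn.comp hγ.continuousOn hdom)
  have h1 : contourIntegral γ (dslope f w) =
      contourIntegral γ (fun z => f z * (z - w)⁻¹ - f w * (z - w)⁻¹) := by
    refine contourIntegral_congr fun t ht => ?_
    rw [dslope_of_ne f (hav t ht), slope_def_field, div_eq_mul_inv, sub_mul]
  rw [h1, contourIntegral_sub hγ (f := fun z => f z * (z - w)⁻¹) (g := fun z => f w * (z - w)⁻¹)
    (hfc.mul hinv) (continuousOn_const.mul hinv), contourIntegral_const_mul] at h0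
  have hpi : (2 * Real.pi * Complex.I : ℂ) ≠ 0 := Complex.two_pi_I_ne_zero
  rw [sub_eq_zero.mp h0, windingNumber]
  field_simp

/-- The derivative in w is an integral of (z - w)⁻², which has a primitive along the curve. So the
winding number is locally constant, with no need to know that it is an integer. -/
theorem windingNumber_eq_of_ball {γ : ℝ → ℂ} (hγ : IsClosedCurve γ) {s : ℂ} {δ : ℝ}
    (hav : ∀ t ∈ Set.Icc (0 : ℝ) 1, γ t ∉ Metric.ball s δ) {w : ℂ} (hw : w ∈ Metric.ball s δ) :
    windingNumber γ w = windingNumber γ s := by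
  have hδ : 0 < δ := Metric.pos_of_mem_ball hw
  have hd : ∀ v ∈ Metric.ball s δ, HasDerivAt (windingNumber γ) 0 v := by
    intro v hv
    obtain ⟨ε, hε, hball⟩ := Metric.nhds_basis_closedBall.mem_iff.mp (Metric.isOpen_ball.mem_nhds hv)
    have hne : ∀ u ∈ Metric.closedBall v ε, ∀ t ∈ Set.Icc (0 : ℝ) 1, γ t - u ≠ 0 := by
      intro u hu t ht h
      exact hav t ht (sub_eq_zero.mp h ▸ hball hu)
    have hsub : ContinuousOn (fun p : ℂ × ℝ => γ p.2 - p.1)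
        (Metric.closedBall v ε ×ˢ Set.Icc 0 1) :=
      (hγ.continuousOn.comp continuousOn_snd fun p hp => hp.2).sub continuousOn_fst
    have hinv : ContinuousOn (fun p : ℂ × ℝ => (γ p.2 - p.1)⁻¹)
        (Metric.closedBall v ε ×ˢ Set.Icc 0 1) := hsub.inv₀ fun p hp => hne p.1 hp.1 p.2 hp.2
    have h1 := hasDerivAt_integral_mul (𝕜 := ℂ) (F := fun u t => (γ t - u)⁻¹)
      (F' := fun u t => (γ t - u)⁻¹ ^ 2) hε hγ.integrable hinv (hinv.fun_pow 2) ?_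
    · have h2 := h1.const_mul (2 * Real.pi * Complex.I)⁻¹
      refine h2.congr_deriv ?_
      have h3 : contourIntegral γ (fun z => (z - v)⁻¹ ^ 2) = 0 := by
        refine contourIntegral_eq_zero hγ (U := fun z => -(z - v)⁻¹) (fun t ht => ?_) ?_
        · have hne' := hne v (Metric.mem_closedBall_self hε.le) t ht
          have := (((hasDerivAt_id (γ t)).sub_const v).inv hne').neg
          refine this.congr_deriv ?_
          simp [neg_div]
        · exact (hinv.fun_pow 2).comp (f := fun t : ℝ => (v, t)) (by fun_prop)
            fun t ht => ⟨Metric.mem_closedBall_self hε.le, ht⟩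
      rw [contourIntegral] at h3
      rw [h3, mul_zero]
    · intro u hu t ht
      have := ((hasDerivAt_id u).const_sub (γ t)).inv (hne u hu t ht)
      refine this.congr_deriv ?_
      simp
  exact Metric.isOpen_ball.is_const_of_deriv_eq_zero (convex_ball s δ).isPreconnected
    (fun v hv => (hd v hv).differentiableAt.differentiableWithinAt) (fun v hv => (hd v hv).deriv)
    hw (Metric.mem_ball_self hδ)

/-- A thermal contour around a compact set is one around a neighbourhood of it. -/
theorem IsThermalContour.exists_thickening {β : ℝ} {S : Set ℂ} (hS : IsCompact S) {γ : ℝ → ℂ}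
    (hγ : IsThermalContour β S γ) :
    ∃ δ > 0, IsThermalContour β (Metric.thickening δ S) γ := by
  have hΓ : IsCompact (γ '' Set.Icc 0 1) := isCompact_Icc.image_of_continuousOn hγ.curve.continuousOn
  have hdis : Disjoint S (γ '' Set.Icc 0 1) := by
    rw [Set.disjoint_right]
    rintro _ ⟨t, ht, rfl⟩
    exact hγ.avoids t ht
  obtain ⟨δ, hδ, hd⟩ := hdis.exists_thickenings hS hΓ.isClosed
  have hav : ∀ t ∈ Set.Icc (0 : ℝ) 1, γ t ∉ Metric.thickening δ S := fun t ht hmem =>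
    Set.disjoint_left.mp hd hmem (Metric.self_subset_thickening hδ _ ⟨t, ht, rfl⟩)
  refine ⟨δ, hδ, hγ.curve, hγ.mem_domain, hav, fun w hw => ?_⟩
  obtain ⟨s, hs, hws⟩ := Metric.mem_thickening_iff.mp hw
  rw [windingNumber_eq_of_ball hγ.curve (fun t ht hmem => hav t ht
    (Metric.mem_thickening_iff.mpr ⟨s, hs, hmem⟩)) hws]
  exact hγ.encloses s hs

theorem IsThermalContour.mono {β : ℝ} {S T : Set ℂ} {γ : ℝ → ℂ} (hγ : IsThermalContour β S γ)
    (h : T ⊆ S) : IsThermalContour β T γ :=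
  ⟨hγ.curve, hγ.mem_domain, fun t ht hmem => hγ.avoids t ht (h hmem),
    fun w hw => hγ.encloses w (h hw)⟩

end XYChain

/-! ### The logarithm of `1 + e^{-βz}` on the thermal domain -/

namespace XYChain

theorem one_add_exp_mem_slitPlane {β : ℝ} (hβ : 0 < β) {z : ℂ} (hz : |z.im| < Real.pi / β) :
    1 + Complex.exp (β * z) ∈ Complex.slitPlane := by
  have h1 : |β * z.im| < Real.pi := by
    rw [abs_mul, abs_of_pos hβ, mul_comm]; exact (lt_div_iff₀ hβ).mp hz
  have hexp := Real.exp_pos (β * z.re)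
  rw [Complex.mem_slitPlane_iff, Complex.add_re, Complex.add_im, Complex.exp_re, Complex.exp_im,
    Complex.re_ofReal_mul, Complex.im_ofReal_mul, Complex.one_re, Complex.one_im, zero_add]
  rcases eq_or_ne (β * z.im) 0 with h0 | h0
  · left; rw [h0, Real.cos_zero]; linarith
  · right
    rw [abs_lt] at h1
    refine mul_ne_zero hexp.ne' fun hs => h0 ?_
    exact (Real.sin_eq_zero_iff_of_lt_of_lt h1.1 h1.2).mp hs

theorem one_add_exp_mem_slitPlane_of_neg {β : ℝ} (hβ : 0 < β) {z : ℂ} (hz : z.re < 0) :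
    1 + Complex.exp (β * z) ∈ Complex.slitPlane := by
  refine Complex.mem_slitPlane_of_norm_lt_one ?_
  rw [Complex.norm_exp, Complex.re_ofReal_mul, Real.exp_lt_one_iff]
  exact mul_neg_of_pos_of_neg hβ hz

theorem one_add_exp_ne_zero {β : ℝ} (hβ : 0 < β) {z : ℂ} (hz : z ∈ thermalDomain β) :
    1 + Complex.exp (β * z) ≠ 0 := by
  rcases lt_trichotomy z.re 0 with h | h | h
  · exact Complex.slitPlane_ne_zero (one_add_exp_mem_slitPlane_of_neg hβ h)
  · exact Complex.slitPlane_ne_zero (one_add_exp_mem_slitPlane hβ (hz h))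
  · intro h0
    have h1 : Complex.exp (β * z) = -1 := eq_neg_of_add_eq_zero_right h0
    have h2 := congrArg norm h1
    rw [Complex.norm_exp, Complex.re_ofReal_mul, norm_neg, norm_one, Real.exp_eq_one_iff] at h2
    exact (mul_pos hβ h).ne' h2

/-- In the strip the argument of 1 + e^{βz} has the sign of β Im z and both are below π in modulus,
so their difference stays in the principal range. This glues the two cases of `logOnePlusExp` across
the imaginary axis. -/
theorem log_one_add_exp {β : ℝ} (hβ : 0 < β) {z : ℂ} (hz : |z.im| < Real.pi / β) :
    Complex.log (1 + Complex.exp (-(β * z))) =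
      -(β * z) + Complex.log (1 + Complex.exp (β * z)) := by
  set u := 1 + Complex.exp (β * z) with hu
  have hslit := one_add_exp_mem_slitPlane hβ hz
  have hu0 : u ≠ 0 := Complex.slitPlane_ne_zero hslit
  have h1 : |β * z.im| < Real.pi := by
    rw [abs_mul, abs_of_pos hβ, mul_comm]; exact (lt_div_iff₀ hβ).mp hz
  rw [abs_lt] at h1
  have hexp := Real.exp_pos (β * z.re)
  have huim : u.im = Real.exp (β * z.re) * Real.sin (β * z.im) := by
    rw [hu, Complex.add_im, Complex.exp_im, Complex.re_ofReal_mul, Complex.im_ofReal_mul,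
      Complex.one_im, zero_add]
  have him : (-(β * z) + Complex.log u).im = u.arg - β * z.im := by
    rw [Complex.add_im, Complex.neg_im, Complex.im_ofReal_mul, Complex.log_im]; ring
  have harg : -Real.pi < u.arg - β * z.im ∧ u.arg - β * z.im ≤ Real.pi := by
    have ha1 := Complex.neg_pi_lt_arg u
    have ha2 := Complex.arg_le_pi u
    have ha3 : u.arg ≠ Real.pi := fun h => by
      have := Complex.mem_slitPlane_iff_arg.mp hslit
      exact this.1 h
    rcases le_or_gt 0 (β * z.im) with h0 | h0
    · have : 0 ≤ u.arg := by
        rw [Complex.arg_nonneg_iff, huim]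
        exact mul_nonneg hexp.le (Real.sin_nonneg_of_nonneg_of_le_pi h0 h1.2.le)
      constructor <;> linarith
    · have : u.arg < 0 := by
        rw [Complex.arg_neg_iff, huim]
        exact mul_neg_of_pos_of_neg hexp (Real.sin_neg_of_neg_of_neg_pi_lt h0 h1.1)
      constructor <;> linarith
  have hval : Complex.exp (-(β * z) + Complex.log u) = 1 + Complex.exp (-(β * z)) := by
    rw [Complex.exp_add, Complex.exp_log hu0, hu, mul_add, mul_one, ← Complex.exp_add,
      neg_add_cancel, Complex.exp_zero, add_comm]
  rw [← hval, Complex.log_exp (by rw [him]; exact harg.1) (by rw [him]; exact harg.2)]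

/-- The Fermi function. -/
noncomputable def occupation (β : ℝ) (z : ℂ) : ℂ := 1 / (1 + Complex.exp (β * z))

theorem differentiableOn_occupation {β : ℝ} (hβ : 0 < β) :
    DifferentiableOn ℂ (occupation β) (thermalDomain β) := by
  intro z hz
  refine DifferentiableAt.differentiableWithinAt ?_
  unfold occupation
  exact (differentiableAt_const _).div (by fun_prop) (one_add_exp_ne_zero hβ hz)

theorem hasDerivAt_logOnePlusExp {β : ℝ} (hβ : 0 < β) {z : ℂ} (hz : z ∈ thermalDomain β) :
    HasDerivAt (logOnePlusExp β) (-(β * occupation β z)) z := by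
  have hne := one_add_exp_ne_zero hβ hz
  have d0 : HasDerivAt (fun z : ℂ => (β : ℂ) * z) β z := by
    simpa using (hasDerivAt_id z).const_mul (β : ℂ)
  have hee : Complex.exp (-(β * z)) * Complex.exp (β * z) = 1 := by
    rw [← Complex.exp_add, neg_add_cancel, Complex.exp_zero]
  have dplus : 1 + Complex.exp (-(β * z)) ∈ Complex.slitPlane →
      HasDerivAt (fun z : ℂ => Complex.log (1 + Complex.exp (-(β * z))))
        (-(β * occupation β z)) z := by
    intro hs
    refine ((d0.neg.cexp.const_add 1).clog hs).congr_deriv ?_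
    have hs0 := Complex.slitPlane_ne_zero hs
    simp only [Pi.neg_apply]
    rw [occupation, div_eq_iff hs0]
    field_simp
    linear_combination -(β : ℂ) * hee
  have dminus : 1 + Complex.exp (β * z) ∈ Complex.slitPlane →
      HasDerivAt (fun z : ℂ => -(β * z) + Complex.log (1 + Complex.exp (β * z)))
        (-(β * occupation β z)) z := by
    intro hs
    refine (d0.neg.add ((d0.cexp.const_add 1).clog hs)).congr_deriv ?_
    rw [occupation]
    field_simp
    ring
  have hstrip : IsOpen {u : ℂ | |u.im| < Real.pi / β} :=
    isOpen_lt Complex.continuous_im.abs continuous_const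
  rcases lt_trichotomy z.re 0 with h | h | h
  · refine (dminus (one_add_exp_mem_slitPlane_of_neg hβ h)).congr_of_eventuallyEq ?_
    filter_upwards [(isOpen_lt Complex.continuous_re continuous_const).mem_nhds h] with u hu
    rw [logOnePlusExp, if_neg (not_le.mpr hu)]
  · refine (dminus (one_add_exp_mem_slitPlane hβ (hz h))).congr_of_eventuallyEq ?_
    filter_upwards [hstrip.mem_nhds (hz h)] with u hu
    rw [logOnePlusExp]
    split_ifs
    · exact log_one_add_exp hβ hu
    · rfl
  · refine (dplus ?_).congr_of_eventuallyEq ?_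
    · have := one_add_exp_mem_slitPlane_of_neg hβ (z := -z) (by simpa using h)
      simpa using this
    · filter_upwards [(isOpen_lt continuous_const Complex.continuous_re).mem_nhds h] with u hu
      rw [logOnePlusExp, if_pos (le_of_lt hu)]

theorem differentiableOn_logOnePlusExp {β : ℝ} (hβ : 0 < β) :
    DifferentiableOn ℂ (logOnePlusExp β) (thermalDomain β) := fun _ hz =>
  (hasDerivAt_logOnePlusExp hβ hz).differentiableAt.differentiableWithinAt

theorem logOnePlusExp_neg {β : ℝ} (hβ : 0 < β) {z : ℂ} (hz : z ∈ thermalDomain β) :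
    logOnePlusExp β (-z) = logOnePlusExp β z + β * z := by
  unfold logOnePlusExp
  rcases lt_trichotomy z.re 0 with h | h | h
  · rw [if_pos (by rw [Complex.neg_re]; linarith), if_neg (not_le.mpr h), mul_neg, neg_neg]
    ring
  · rw [if_pos (by rw [Complex.neg_re]; linarith), if_pos h.ge, log_one_add_exp hβ (hz h), mul_neg,
      neg_neg]
    ring
  · rw [if_neg (by rw [Complex.neg_re]; linarith), if_pos h.le, mul_neg, neg_neg]
    ring

theorem logOnePlusExp_ofReal (β x : ℝ) :
    logOnePlusExp β x = (Real.log (1 + Real.exp (-(β * x))) : ℂ) := by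
  have h1 := Real.exp_pos (-(β * x))
  have h2 := Real.exp_pos (β * x)
  unfold logOnePlusExp
  split_ifs with h
  · rw [Complex.ofReal_log (by linarith)]; push_cast; rfl
  · have : Real.log (1 + Real.exp (-(β * x))) = -(β * x) + Real.log (1 + Real.exp (β * x)) := by
      rw [show 1 + Real.exp (-(β * x)) = Real.exp (-(β * x)) * (1 + Real.exp (β * x)) by
        rw [mul_add, ← Real.exp_add, neg_add_cancel, Real.exp_zero]; ring,
        Real.log_mul h1.ne' (by linarith), Real.log_exp]
    rw [this, Complex.ofReal_add, Complex.ofReal_log (by linarith)]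
    push_cast
    rfl

/-- `log (1 + e^{-βz}) + βz/2`, an even function. -/
noncomputable def logCoshBranch (β : ℝ) (z : ℂ) : ℂ := logOnePlusExp β z + β / 2 * z

theorem hasDerivAt_logCoshBranch {β : ℝ} (hβ : 0 < β) {z : ℂ} (hz : z ∈ thermalDomain β) :
    HasDerivAt (logCoshBranch β) (β * (1 / 2 - occupation β z)) z := by
  have h1 : HasDerivAt (fun z : ℂ => (β / 2 : ℂ) * z) (β / 2) z := by
    simpa using (hasDerivAt_id z).const_mul (β / 2 : ℂ)
  refine ((hasDerivAt_logOnePlusExp hβ hz).add h1).congr_deriv ?_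
  ring

theorem logCoshBranch_neg {β : ℝ} (hβ : 0 < β) {z : ℂ} (hz : z ∈ thermalDomain β) :
    logCoshBranch β (-z) = logCoshBranch β z := by
  rw [logCoshBranch, logCoshBranch, logOnePlusExp_neg hβ hz]; ring

theorem logCoshBranch_ofReal (β x : ℝ) :
    logCoshBranch β x = ((Real.log 2 + Real.log (Real.cosh (β * x / 2)) : ℝ) : ℂ) := by
  have h1 := Real.exp_pos (-(β * x))
  rw [logCoshBranch, logOnePlusExp_ofReal]
  norm_cast
  have hc := Real.cosh_pos (β * x / 2)
  have : 1 + Real.exp (-(β * x)) = Real.exp (-(β * x / 2)) * (2 * Real.cosh (β * x / 2)) := by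
    rw [Real.cosh_eq, mul_div_cancel₀ _ two_ne_zero, mul_add, ← Real.exp_add, ← Real.exp_add,
      neg_add_cancel, Real.exp_zero]
    congr 2
    ring
  rw [this, Real.log_mul (Real.exp_pos _).ne' (by positivity), Real.log_exp,
    Real.log_mul two_ne_zero hc.ne']
  ring

theorem occupation_neg {β : ℝ} (hβ : 0 < β) {z : ℂ} (hz : z ∈ thermalDomain β) :
    occupation β (-z) = 1 - occupation β z := by
  have h1 := one_add_exp_ne_zero hβ hz
  have h2 := one_add_exp_ne_zero hβ (neg_mem_thermalDomain hz)
  rw [mul_neg, Complex.exp_neg] at h2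
  have h3 := Complex.exp_ne_zero (β * z)
  rw [occupation, occupation, mul_neg, Complex.exp_neg]
  field_simp
  rw [add_comm (Complex.exp _) 1]
  field_simp
  ring

end XYChain

/-! ### Contour formulas in finite volume -/

namespace XYChain

open Matrix

variable {L : ℕ}

theorem energy_zero_eq (ν : Fin L) (k : Fin L) :
    ∃ j : Fin L, energy L ν 0 k = -Real.cos (momentum L j) := by
  have h := prod_energy_zero ν (energy L ν 0 k : ℂ)
  rw [Finset.prod_eq_zero (Finset.mem_univ k) (sub_self _), eq_comm, Finset.prod_eq_zero_iff] at h
  obtain ⟨j, _, hj⟩ := h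
  exact ⟨j, by exact_mod_cast eq_neg_of_add_eq_zero_left hj⟩

theorem neg_cos_mem_finiteSingularities (hL : Even L) (h : ℝ) (j : Fin L) :
    -(Real.cos (momentum L j) : ℂ) ∈ finiteSingularities L h := by
  obtain ⟨n, hn, hcos⟩ := exists_lt_half hL j.isLt
  exact Or.inr ⟨n, hn, by rw [hcos]⟩

theorem energy_zero_mem (hL : Even L) (ν : Fin L) (h : ℝ) (k : Fin L) :
    (energy L ν 0 k : ℂ) ∈ finiteSingularities L h := by
  obtain ⟨j, hj⟩ := energy_zero_eq ν k
  rw [hj, Complex.ofReal_neg]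
  exact neg_cos_mem_finiteSingularities hL h j

/-- The determinant formula makes an eigenvalue a zero of F_L only when it is not a free energy. The
other case does occur: ±q have equal energy, and a rank-one perturbation leaves such a level in the
spectrum. -/
theorem energy_mem (hL : Even L) (ν : Fin L) (h : ℝ) (k : Fin L) :
    (energy L ν h k : ℂ) ∈ finiteSingularities L h := by
  by_cases hz : ∏ j : Fin L, ((energy L ν h k : ℂ) + (Real.cos (momentum L j) : ℂ)) = 0
  · obtain ⟨j, _, hj⟩ := Finset.prod_eq_zero_iff.mp hz
    rw [eq_neg_of_add_eq_zero_left hj]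
    exact neg_cos_mem_finiteSingularities hL h j
  · have h1 := prod_energy_eq hL ν h hz
    rw [Finset.prod_eq_zero (Finset.mem_univ k) (sub_self _), eq_comm, mul_eq_zero] at h1
    exact Or.inl (h1.resolve_left hz)

theorem prod_add_cos_ne_zero (hL : Even L) {h : ℝ} {z : ℂ} (hz : z ∉ finiteSingularities L h) :
    ∏ j : Fin L, (z + (Real.cos (momentum L j) : ℂ)) ≠ 0 := by
  rw [Finset.prod_ne_zero_iff]
  intro j _ hj
  rw [eq_neg_of_add_eq_zero_left hj] at hz
  exact hz (neg_cos_mem_finiteSingularities hL h j)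

theorem logDeriv_prod_sub {ι : Type*} (s : Finset ι) (e : ι → ℂ) {z : ℂ}
    (hz : ∀ i ∈ s, z - e i ≠ 0) :
    logDeriv (fun z => ∏ i ∈ s, (z - e i)) z = ∑ i ∈ s, (z - e i)⁻¹ := by
  rw [logDeriv_prod (f := fun i z => z - e i) hz (fun i _ => by fun_prop)]
  refine Finset.sum_congr rfl fun i _ => ?_
  rw [logDeriv_apply, deriv_sub_const, deriv_id'', one_div]

/-- The logarithmic derivative of `F_L`. -/
theorem deriv_finiteF_div (hL : Even L) (ν : Fin L) {h : ℝ} {z : ℂ}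
    (hz : z ∉ finiteSingularities L h) :
    deriv (finiteF L h) z / finiteF L h z =
      ∑ k, (z - (energy L ν h k : ℂ))⁻¹ - ∑ k, (z - (energy L ν 0 k : ℂ))⁻¹ := by
  have h0 := prod_add_cos_ne_zero hL hz
  have hne : ∀ e : ℂ, e ∈ finiteSingularities L h → z - e ≠ 0 := fun e he h' =>
    hz (sub_eq_zero.mp h' ▸ he)
  have hcont : Continuous fun u : ℂ => ∏ j : Fin L, (u + (Real.cos (momentum L j) : ℂ)) := by
    fun_prop
  have hev : finiteF L h =ᶠ[𝓝 z] fun u =>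
      (∏ k, (u - (energy L ν h k : ℂ))) / ∏ k, (u - (energy L ν 0 k : ℂ)) := by
    filter_upwards [(isOpen_ne_fun hcont continuous_const).mem_nhds h0] with u hu
    rw [prod_energy_zero, prod_energy_eq hL ν h hu, mul_div_cancel_left₀ _ hu]
  have hP : ∏ k, (z - (energy L ν h k : ℂ)) ≠ 0 :=
    Finset.prod_ne_zero_iff.mpr fun k _ => hne _ (energy_mem hL ν h k)
  have hQ : ∏ k, (z - (energy L ν 0 k : ℂ)) ≠ 0 :=
    Finset.prod_ne_zero_iff.mpr fun k _ => hne _ (energy_zero_mem hL ν h k)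
  have h1 := logDeriv_div (f := fun u => ∏ k, (u - (energy L ν h k : ℂ)))
    (g := fun u => ∏ k, (u - (energy L ν 0 k : ℂ))) z hP hQ (by fun_prop) (by fun_prop)
  rw [logDeriv_prod_sub _ _ fun k _ => hne _ (energy_mem hL ν h k),
    logDeriv_prod_sub _ _ fun k _ => hne _ (energy_zero_mem hL ν h k), logDeriv_apply] at h1
  rw [hev.deriv_eq, hev.eq_of_nhds]
  exact h1

theorem mem_thermalDomain_of_mem_finiteSingularities {β : ℝ} (hβ : 0 < β) (hL : Even L)
    (hL0 : L ≠ 0) {h : ℝ} {z : ℂ} (hz : z ∈ finiteSingularities L h) : z ∈ thermalDomain β := by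
  have h1 := (mem_limitInterval.mp (finiteSingularities_subset hL hL0 h hz)).1
  rw [show z = (z.re : ℂ) from Complex.ext (by simp) (by simp [h1])]
  exact ofReal_mem_thermalDomain hβ _

/-- The residue theorem for `f F_L'/F_L`. -/
theorem contourIntegral_mul_logDeriv {β : ℝ} (hβ : 0 < β) (hL : Even L) (ν : Fin L) {h : ℝ}
    {γ : ℝ → ℂ} (hγ : IsThermalContour β (finiteSingularities L h) γ) {f : ℂ → ℂ}
    (hf : DifferentiableOn ℂ f (thermalDomain β)) :
    contourIntegral γ (fun z => f z * (deriv (finiteF L h) z / finiteF L h z)) =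
      2 * Real.pi * Complex.I *
        (∑ k, f (energy L ν h k) - ∑ k, f (energy L ν 0 k)) := by
  have hL0 : L ≠ 0 := by have := ν.isLt; omega
  have hfc : ContinuousOn (fun t => f (γ t)) (Set.Icc 0 1) :=
    hf.continuousOn.comp hγ.curve.continuousOn hγ.mem_domain
  have hne : ∀ e ∈ finiteSingularities L h, ∀ t ∈ Set.Icc (0 : ℝ) 1, γ t ≠ e :=
    fun e he t ht h' => hγ.avoids t ht (h' ▸ he)
  have hc : ∀ e ∈ finiteSingularities L h,
      ContinuousOn (fun t => f (γ t) * (γ t - e)⁻¹) (Set.Icc 0 1) := fun e he =>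
    hfc.mul ((hγ.curve.continuousOn.sub continuousOn_const).inv₀
      fun t ht => sub_ne_zero.mpr (hne e he t ht))
  have hcauchy : ∀ e ∈ finiteSingularities L h,
      contourIntegral γ (fun z => f z * (z - e)⁻¹) = 2 * Real.pi * Complex.I * f e := by
    intro e he
    rw [contourIntegral_cauchy hβ hf hγ.curve hγ.mem_domain
      (mem_thermalDomain_of_mem_finiteSingularities hβ hL hL0 he) (hne e he), hγ.encloses e he,
      mul_one]
  have h1 : contourIntegral γ (fun z => f z * (deriv (finiteF L h) z / finiteF L h z)) =
      contourIntegral γ (fun z => ∑ k, f z * (z - (energy L ν h k : ℂ))⁻¹ -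
        ∑ k, f z * (z - (energy L ν 0 k : ℂ))⁻¹) := by
    refine contourIntegral_congr fun t ht => ?_
    rw [deriv_finiteF_div hL ν (hγ.avoids t ht), mul_sub, Finset.mul_sum, Finset.mul_sum]
  rw [h1, contourIntegral_sub hγ.curve (f := fun z => ∑ k, f z * (z - (energy L ν h k : ℂ))⁻¹)
    (g := fun z => ∑ k, f z * (z - (energy L ν 0 k : ℂ))⁻¹)
    (continuousOn_finsetSum _ fun k _ => hc _ (energy_mem hL ν h k))
    (continuousOn_finsetSum _ fun k _ => hc _ (energy_zero_mem hL ν h k)),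
    contourIntegral_sum hγ.curve _ fun k _ => hc _ (energy_mem hL ν h k),
    contourIntegral_sum hγ.curve _ fun k _ => hc _ (energy_zero_mem hL ν h k),
    Finset.sum_congr rfl fun k _ => hcauchy _ (energy_mem hL ν h k),
    Finset.sum_congr rfl fun k _ => hcauchy _ (energy_zero_mem hL ν h k),
    ← Finset.mul_sum, ← Finset.mul_sum, mul_sub]

theorem one_lt_of_even (hL : Even L) (ν : Fin L) : 1 < L := by
  obtain ⟨p, rfl⟩ := hL
  have := ν.isLt
  omega

theorem chainPartition_pos (hL : Even L) (ν : Fin L) (β h : ℝ) : 0 < chainPartition L ν β h := by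
  rw [chainPartition_eq (one_lt_of_even hL ν)]
  exact mul_pos (Real.exp_pos _) (Finset.prod_pos fun k _ => by positivity)

theorem chainZeta_pos (hL : Even L) (ν : Fin L) (β h : ℝ) : 0 < chainZeta L ν β h :=
  div_pos (chainPartition_pos hL ν β h) (chainPartition_pos hL ν β 0)

theorem log_chainZeta (hL : Even L) (ν : Fin L) (β h : ℝ) :
    (Real.log (chainZeta L ν β h) : ℂ) = -(β * h) +
      (∑ k, logOnePlusExp β (energy L ν h k) - ∑ k, logOnePlusExp β (energy L ν 0 k)) := by
  have hpos : ∀ x : ℝ, 1 + Real.exp (-(β * x)) ≠ 0 := fun x => by positivity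
  simp only [logOnePlusExp_ofReal]
  norm_cast
  rw [chainZeta, Real.log_div (chainPartition_pos hL ν β h).ne' (chainPartition_pos hL ν β 0).ne',
    chainPartition_eq (one_lt_of_even hL ν), chainPartition_eq (one_lt_of_even hL ν),
    Real.log_mul (Real.exp_pos _).ne' (Finset.prod_ne_zero_iff.mpr fun k _ => hpos _),
    Real.log_mul (Real.exp_pos _).ne' (Finset.prod_ne_zero_iff.mpr fun k _ => hpos _),
    Real.log_exp, Real.log_exp, Real.log_prod fun k _ => hpos _, Real.log_prod fun k _ => hpos _]
  ring

theorem log_chainZeta_contour {β : ℝ} (hβ : 0 < β) (hL : Even L) (ν : Fin L) {h : ℝ}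
    {γ : ℝ → ℂ} (hγ : IsThermalContour β (finiteSingularities L h) γ) :
    (Real.log (chainZeta L ν β h) : ℂ) = -(β * h : ℂ) + (2 * Real.pi * Complex.I)⁻¹ *
      contourIntegral γ (fun z => logOnePlusExp β z *
        (deriv (finiteF L h) z / finiteF L h z)) := by
  rw [contourIntegral_mul_logDeriv hβ hL ν hγ (differentiableOn_logOnePlusExp hβ),
    inv_mul_cancel_left₀ Complex.two_pi_I_ne_zero, log_chainZeta hL]

/-- The eigenvalue sum is the trace, and the field changes one diagonal entry by -2h. This lets the
prefactor -βh be absorbed into the even function `logCoshBranch`. -/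
theorem sum_energy (ν : Fin L) (h : ℝ) :
    ∑ k, energy L ν h k - ∑ k, energy L ν 0 k = -(2 * h) := by
  have h1 : ∀ h : ℝ, ((∑ k, energy L ν h k : ℝ) : ℂ) = trace (oneParticle L ν h) := fun h => by
    rw [(oneParticle_isHermitian ν h).trace_eq_sum_eigenvalues, Complex.ofReal_sum]
    rfl
  have h2 : ((∑ k, energy L ν h k - ∑ k, energy L ν 0 k : ℝ) : ℂ) = ((-(2 * h) : ℝ) : ℂ) := by
    rw [Complex.ofReal_sub, h1, h1, oneParticle, oneParticle, trace_sub, trace_sub, trace_smul _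
      (diagonal _), trace_smul _ (diagonal _), trace_diagonal]
    simp
  exact_mod_cast h2

/-- The free energies -cos q are at least -1, so each of the L factors is at most 1 + e^β. -/
theorem chainPartition_zero_le {β : ℝ} (hβ : 0 < β) (hL : Even L) (ν : Fin L) :
    chainPartition L ν β 0 ≤ Real.exp (Real.log (1 + Real.exp β) * L) := by
  have h1 : ∀ k ∈ (Finset.univ : Finset (Fin L)),
      1 + Real.exp (-(β * energy L ν 0 k)) ≤ 1 + Real.exp β := by
    intro k _
    obtain ⟨j, hj⟩ := energy_zero_eq ν k
    have h2 := Real.cos_le_one (momentum L j)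
    gcongr
    rw [hj]
    nlinarith
  rw [chainPartition_eq (one_lt_of_even hL ν), mul_zero, neg_zero, Real.exp_zero, one_mul,
    mul_comm, Real.exp_nat_mul, Real.exp_log (by positivity)]
  refine (Finset.prod_le_prod (fun k _ => by positivity) h1).trans ?_
  simp

theorem differentiableOn_finiteF (hL : Even L) (h : ℝ) : DifferentiableOn ℂ (finiteF L h) cutᶜ := by
  rw [show finiteF L h = fun z => 1 + 2 * h * freeGreen L z from funext (finiteF_eq hL h)]
  exact fun z hz =>
    (((differentiableAt_freeGreen L hz).const_mul _).const_add _).differentiableWithinAt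

/-- Integration by parts for `∮ f F_L'/F_L`. -/
theorem contourIntegral_mul_logDeriv_by_parts {β : ℝ} (hL : Even L) (hL0 : L ≠ 0) {h : ℝ}
    {γ : ℝ → ℂ} (hγ : IsThermalContour β (limitInterval h) γ) {f f' : ℂ → ℂ}
    (hf : ∀ z ∈ thermalDomain β, HasDerivAt f (f' z) z)
    (hf' : ContinuousOn f' (thermalDomain β)) :
    contourIntegral γ (fun z => f z * (deriv (finiteF L h) z / finiteF L h z)) =
      -contourIntegral γ (fun z => f' z * Complex.log (1 + 2 * h * freeGreen L z)) := by
  have hcut : ∀ t ∈ Set.Icc (0 : ℝ) 1, γ t ∈ cutᶜ := fun t ht hmem =>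
    hγ.avoids t ht (cut_subset_limitInterval h hmem)
  have hslit : ∀ t ∈ Set.Icc (0 : ℝ) 1, finiteF L h (γ t) ∈ Complex.slitPlane := fun t ht => by
    rw [finiteF_eq hL]; exact finiteF_mem_slitPlane hL hL0 (hγ.avoids t ht)
  have hd := differentiableOn_finiteF hL h
  have hFc : ContinuousOn (fun t => finiteF L h (γ t)) (Set.Icc 0 1) :=
    hd.continuousOn.comp hγ.curve.continuousOn hcut
  have hF'c : ContinuousOn (fun t => deriv (finiteF L h) (γ t)) (Set.Icc 0 1) :=
    (hd.deriv isOpen_compl_cut).continuousOn.comp hγ.curve.continuousOn hcut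
  simp only [← finiteF_eq hL]
  refine contourIntegral_by_parts hγ.curve (fun t ht => hf _ (hγ.mem_domain t ht))
    (hf'.comp hγ.curve.continuousOn hγ.mem_domain) (fun t ht => ?_)
    (hF'c.div hFc fun t ht => Complex.slitPlane_ne_zero (hslit t ht))
  exact (hd.differentiableAt (isOpen_compl_cut.mem_nhds (hcut t ht))).hasDerivAt.clog (hslit t ht)

theorem continuousOn_occupation {β : ℝ} (hβ : 0 < β) :
    ContinuousOn (occupation β) (thermalDomain β) := (differentiableOn_occupation hβ).continuousOn

/-- Integration by parts removes the derivative of F_L, so that convergence of the Green function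
alone controls the limit, and the field enters only through the logarithm. -/
theorem log_chainZeta_occupation {β : ℝ} (hβ : 0 < β) (hL : Even L) (ν : Fin L) {h : ℝ}
    {γ : ℝ → ℂ} (hγ : IsThermalContour β (limitInterval h) γ) :
    (Real.log (chainZeta L ν β h) : ℂ) = -(β * h : ℂ) + β / (2 * Real.pi * Complex.I) *
      contourIntegral γ (fun z => occupation β z * Complex.log (1 + 2 * h * freeGreen L z)) := by
  have hL0 : L ≠ 0 := by have := ν.isLt; omega
  rw [log_chainZeta_contour hβ hL ν (hγ.mono (finiteSingularities_subset hL hL0 h)),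
    contourIntegral_mul_logDeriv_by_parts hL hL0 hγ
      (fun z hz => hasDerivAt_logOnePlusExp hβ hz)
      (continuousOn_const.mul (continuousOn_occupation hβ)).neg,
    show (fun z => -(β * occupation β z) * Complex.log (1 + 2 * h * freeGreen L z)) =
      fun z => (-β : ℂ) * (occupation β z * Complex.log (1 + 2 * h * freeGreen L z)) from
      funext fun z => by ring, contourIntegral_const_mul]
  ring

/-- Adding βz/2 to the logarithm changes the difference of eigenvalue sums by exactly -βh, by
`sum_energy`. The explicit linear term disappears and the weight becomes odd. -/
theorem log_chainZeta_even {β : ℝ} (hβ : 0 < β) (hL : Even L) (ν : Fin L) {h : ℝ}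
    {γ : ℝ → ℂ} (hγ : IsThermalContour β (limitInterval h) γ) :
    (Real.log (chainZeta L ν β h) : ℂ) = -(2 * Real.pi * Complex.I)⁻¹ *
      contourIntegral γ (fun z => β * (1 / 2 - occupation β z) *
        Complex.log (1 + 2 * h * freeGreen L z)) := by
  have hL0 : L ≠ 0 := by have := ν.isLt; omega
  have hsub := finiteSingularities_subset hL hL0 h
  have h1 := contourIntegral_mul_logDeriv hβ hL ν (hγ.mono hsub) (f := logCoshBranch β)
    fun z hz => (hasDerivAt_logCoshBranch hβ hz).differentiableAt.differentiableWithinAt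
  rw [contourIntegral_mul_logDeriv_by_parts hL hL0 hγ
      (fun z hz => hasDerivAt_logCoshBranch hβ hz)
      (continuousOn_const.mul (continuousOn_const.sub (continuousOn_occupation hβ)))] at h1
  rw [neg_mul, ← mul_neg, h1, inv_mul_cancel_left₀ Complex.two_pi_I_ne_zero, log_chainZeta hL]
  simp only [logCoshBranch, Finset.sum_add_distrib, ← Finset.mul_sum]
  have h2 : (∑ k, (energy L ν h k : ℂ)) - ∑ k, (energy L ν 0 k : ℂ) = -(2 * h) := by
    exact_mod_cast sum_energy ν h
  linear_combination -(β / 2 : ℂ) * h2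

end XYChain

/-! ### Confocal ellipses -/

namespace XYChain

open MeasureTheory

/-- The interval `[-a, a]`. -/
def symmInterval (a : ℝ) : Set ℂ := Complex.ofReal '' Set.Icc (-a) a

/-- The ellipse with foci `±a` which is the Joukowski image of the circle of radius `ρ`. -/
noncomputable def ellipse (a ρ t : ℝ) : ℂ :=
  a / 2 * (circleMap 0 ρ (2 * Real.pi * t) + (circleMap 0 ρ (2 * Real.pi * t))⁻¹)

theorem circleMap_zero_ne_zero {ρ : ℝ} (hρ : 1 < ρ) (θ : ℝ) : circleMap 0 ρ θ ≠ 0 :=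
  circleMap_ne_center (by linarith)

theorem hasDerivAt_ellipse {a ρ : ℝ} (hρ : 1 < ρ) (t : ℝ) :
    HasDerivAt (ellipse a ρ) (2 * Real.pi * (deriv (circleMap 0 ρ) (2 * Real.pi * t) *
      (a / 2 * (1 - (circleMap 0 ρ (2 * Real.pi * t) ^ 2)⁻¹)))) t := by
  have h0 := circleMap_zero_ne_zero hρ (2 * Real.pi * t)
  have h1 : HasDerivAt (fun t : ℝ => 2 * Real.pi * t) (2 * Real.pi) t := by
    simpa using (hasDerivAt_id t).const_mul (2 * Real.pi)
  have h2 : HasDerivAt (fun t : ℝ => circleMap 0 ρ (2 * Real.pi * t))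
      ((2 * Real.pi : ℝ) • deriv (circleMap 0 ρ) (2 * Real.pi * t)) t :=
    ((differentiable_circleMap 0 ρ _).hasDerivAt).scomp t h1
  refine ((h2.add (h2.inv h0)).const_mul (a / 2 : ℂ)).congr_deriv ?_
  rw [Complex.real_smul]
  push_cast
  field_simp
  ring

theorem deriv_ellipse {a ρ : ℝ} (hρ : 1 < ρ) : deriv (ellipse a ρ) =
    fun t => 2 * Real.pi * (deriv (circleMap 0 ρ) (2 * Real.pi * t) *
      (a / 2 * (1 - (circleMap 0 ρ (2 * Real.pi * t) ^ 2)⁻¹))) :=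
  funext fun t => (hasDerivAt_ellipse hρ t).deriv

theorem continuous_deriv_ellipse {a ρ : ℝ} (hρ : 1 < ρ) : Continuous (deriv (ellipse a ρ)) := by
  rw [deriv_ellipse hρ]
  have h1 : Continuous fun t : ℝ => circleMap 0 ρ (2 * Real.pi * t) :=
    (continuous_circleMap 0 ρ).comp (by fun_prop)
  have h2 : Continuous fun t : ℝ => deriv (circleMap 0 ρ) (2 * Real.pi * t) := by
    simp only [deriv_circleMap]
    exact h1.mul continuous_const
  refine continuous_const.mul (h2.mul (continuous_const.mul (continuous_const.sub ?_)))
  exact (h1.pow 2).inv₀ fun t => pow_ne_zero 2 (circleMap_zero_ne_zero hρ _)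

/-- The Joukowski map is odd and half a turn negates the circle. Applied twice this closes the
curve; applied once it is the central symmetry used for the closed form. -/
theorem ellipse_add_half (a ρ t : ℝ) : ellipse a ρ (t + 1 / 2) = -ellipse a ρ t := by
  have : circleMap 0 ρ (2 * Real.pi * (t + 1 / 2)) = -circleMap 0 ρ (2 * Real.pi * t) := by
    rw [show 2 * Real.pi * (t + 1 / 2) = 2 * Real.pi * t + Real.pi by ring]
    simp only [circleMap, zero_add]
    push_cast
    rw [add_mul, Complex.exp_add, Complex.exp_pi_mul_I]
    ring
  rw [ellipse, ellipse, this, inv_neg]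
  ring

theorem isClosedCurve_ellipse {a ρ : ℝ} (hρ : 1 < ρ) : IsClosedCurve (ellipse a ρ) where
  continuousOn := fun t _ => (hasDerivAt_ellipse hρ t).continuousAt.continuousWithinAt
  closed := by
    have h1 := ellipse_add_half a ρ (1 / 2)
    have h2 := ellipse_add_half a ρ 0
    rw [zero_add] at h2
    rw [h2, neg_neg] at h1
    rw [← h1]
    norm_num
  differentiable := ⟨∅, Set.finite_empty, fun t _ _ => (hasDerivAt_ellipse hρ t).differentiableAt⟩
  integrable := (continuous_deriv_ellipse hρ).intervalIntegrable _ _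

theorem norm_circleMap_gt {ρ : ℝ} (hρ : 1 < ρ) (θ : ℝ) {e : ℂ} (he : ‖e‖ = 1) :
    circleMap 0 ρ θ - e ≠ 0 := by
  intro h
  have h1 := congrArg norm (sub_eq_zero.mp h)
  rw [norm_circleMap_zero, he, abs_of_pos (by linarith)] at h1
  linarith

theorem mem_symmInterval {a : ℝ} (ha : 0 < a) {w : ℂ} (hw : w ∈ symmInterval a) :
    ∃ e : ℂ, ‖e‖ = 1 ∧ w = a / 2 * (e + e⁻¹) := by
  obtain ⟨x, hx, rfl⟩ := hw
  refine ⟨Complex.exp (Real.arccos (x / a) * Complex.I), Complex.norm_exp_ofReal_mul_I _, ?_⟩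
  have h1 : Real.cos (Real.arccos (x / a)) = x / a :=
    Real.cos_arccos (by rw [le_div_iff₀ ha]; linarith [hx.1]) (by rw [div_le_one ha]; exact hx.2)
  have h2 : (x : ℂ) = a * (Real.cos (Real.arccos (x / a)) : ℂ) := by
    rw [h1]
    push_cast
    have : (a : ℂ) ≠ 0 := by exact_mod_cast ha.ne'
    field_simp
  rw [← Complex.exp_neg, h2, Complex.ofReal_cos, Complex.cos, neg_mul]
  ring

theorem ellipse_sub {a ρ : ℝ} (hρ : 1 < ρ) (t : ℝ) {e : ℂ} (he : ‖e‖ = 1) :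
    ellipse a ρ t - a / 2 * (e + e⁻¹) = a / 2 * ((circleMap 0 ρ (2 * Real.pi * t) - e) *
      (circleMap 0 ρ (2 * Real.pi * t) - e⁻¹) / circleMap 0 ρ (2 * Real.pi * t)) := by
  have h0 := circleMap_zero_ne_zero hρ (2 * Real.pi * t)
  have he0 : e ≠ 0 := norm_ne_zero_iff.mp (by rw [he]; exact one_ne_zero)
  rw [ellipse]
  field_simp
  ring

theorem ellipse_notMem {a ρ : ℝ} (ha : 0 < a) (hρ : 1 < ρ) (t : ℝ) :
    ellipse a ρ t ∉ symmInterval a := by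
  intro hmem
  obtain ⟨e, he, hw⟩ := mem_symmInterval ha hmem
  have h1 := ellipse_sub (a := a) hρ t he
  have he' : ‖e⁻¹‖ = 1 := by rw [norm_inv, he, inv_one]
  rw [hw, sub_self] at h1
  refine mul_ne_zero ?_ (div_ne_zero (mul_ne_zero (norm_circleMap_gt hρ _ he)
    (norm_circleMap_gt hρ _ he')) (circleMap_zero_ne_zero hρ _)) h1.symm
  have : (a : ℂ) ≠ 0 := by exact_mod_cast ha.ne'
  simpa using this

/-- A point of the interval is the image of e and e⁻¹ on the unit circle. Under the Joukowski
substitution dz/(z - w) becomes a form with residues 1, 1 and -1 at e, e⁻¹ and 0. All three lie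
inside the circle of radius ρ, and 1 + 1 - 1 = 1. -/
theorem windingNumber_ellipse {a ρ : ℝ} (ha : 0 < a) (hρ : 1 < ρ) {w : ℂ}
    (hw : w ∈ symmInterval a) : windingNumber (ellipse a ρ) w = 1 := by
  obtain ⟨e, he, rfl⟩ := mem_symmInterval ha hw
  have he' : ‖e⁻¹‖ = 1 := by rw [norm_inv, he, inv_one]
  have he0 : e ≠ 0 := norm_ne_zero_iff.mp (by rw [he]; exact one_ne_zero)
  have ha0 : (a : ℂ) ≠ 0 := by exact_mod_cast ha.ne'
  have hball : ∀ v : ℂ, ‖v‖ ≤ 1 → v ∈ Metric.ball (0 : ℂ) ρ := fun v hv => by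
    rw [mem_ball_zero_iff]; linarith
  have hci : ∀ v : ℂ, ‖v‖ ≤ 1 → CircleIntegrable (fun z => (z - v)⁻¹) 0 ρ := fun v hv => by
    rw [circleIntegrable_sub_inv_iff]
    right
    rw [mem_sphere_zero_iff_norm, abs_of_pos (by linarith)]
    linarith
  have key : contourIntegral (ellipse a ρ) (fun z => (z - a / 2 * (e + e⁻¹))⁻¹) =
      ∮ z in C(0, ρ), ((z - e)⁻¹ + (z - e⁻¹)⁻¹ - (z - 0)⁻¹) := by
    have h1 : ∀ t, (ellipse a ρ t - a / 2 * (e + e⁻¹))⁻¹ * deriv (ellipse a ρ) t =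
        (2 * Real.pi : ℝ) • (fun θ => deriv (circleMap 0 ρ) θ • ((circleMap 0 ρ θ - e)⁻¹ +
          (circleMap 0 ρ θ - e⁻¹)⁻¹ - (circleMap 0 ρ θ - 0)⁻¹)) (2 * Real.pi * t) := by
      intro t
      rw [ellipse_sub hρ t he, deriv_ellipse hρ]
      have n0 := circleMap_zero_ne_zero hρ (2 * Real.pi * t)
      have n1 := norm_circleMap_gt hρ (2 * Real.pi * t) he
      have n2 := norm_circleMap_gt hρ (2 * Real.pi * t) he'
      have hee : e * e⁻¹ = 1 := mul_inv_cancel₀ he0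
      simp only [Complex.real_smul, smul_eq_mul, sub_zero]
      generalize circleMap 0 ρ (2 * Real.pi * t) = u at *
      generalize e⁻¹ = e' at *
      push_cast
      have hid : (u - e)⁻¹ + (u - e')⁻¹ - u⁻¹ = (u ^ 2 - 1) / (u * ((u - e) * (u - e'))) := by
        field_simp
        linear_combination -hee
      rw [hid]
      field_simp
    rw [contourIntegral, intervalIntegral.integral_congr fun t _ => h1 t,
      intervalIntegral.integral_smul]
    refine (intervalIntegral.smul_integral_comp_mul_left (fun θ => deriv (circleMap 0 ρ) θ •
      ((circleMap 0 ρ θ - e)⁻¹ + (circleMap 0 ρ θ - e⁻¹)⁻¹ - (circleMap 0 ρ θ - 0)⁻¹))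
      (2 * Real.pi)).trans ?_
    rw [mul_zero, mul_one]
    rfl
  rw [windingNumber, key, circleIntegral.integral_sub (f := fun z => (z - e)⁻¹ + (z - e⁻¹)⁻¹)
    (g := fun z => (z - 0)⁻¹) ((hci e he.le).add (hci _ he'.le)) (hci 0 (by simp)), circleIntegral.integral_add (hci e he.le) (hci _ he'.le),
    circleIntegral.integral_sub_inv_of_mem_ball (hball e he.le),
    circleIntegral.integral_sub_inv_of_mem_ball (hball _ he'.le),
    circleIntegral.integral_sub_inv_of_mem_ball (hball 0 (by simp)), add_sub_cancel_right,
    inv_mul_cancel₀ Complex.two_pi_I_ne_zero]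

theorem ellipse_im (a ρ t : ℝ) :
    (ellipse a ρ t).im = a / 2 * (ρ - ρ⁻¹) * Real.sin (2 * Real.pi * t) := by
  have h1 : circleMap 0 ρ (2 * Real.pi * t) =
      (ρ : ℂ) * Complex.exp (((2 * Real.pi * t : ℝ) : ℂ) * Complex.I) := by simp [circleMap]
  rw [ellipse, h1, mul_inv, ← Complex.exp_neg, ← neg_mul, ← Complex.ofReal_neg, ← Complex.ofReal_inv,
    show (a / 2 : ℂ) = ((a / 2 : ℝ) : ℂ) by push_cast; rfl, Complex.im_ofReal_mul, Complex.add_im,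
    Complex.im_ofReal_mul, Complex.im_ofReal_mul, Complex.exp_ofReal_mul_I_im,
    Complex.exp_ofReal_mul_I_im, Real.sin_neg]
  ring

/-- Flat ellipses are thermal contours. -/
theorem exists_isThermalContour_ellipse {β : ℝ} (hβ : 0 < β) {a : ℝ} (ha : 0 < a) :
    ∃ ρ : ℝ, 1 < ρ ∧ IsThermalContour β (symmInterval a) (ellipse a ρ) := by
  have hpi := Real.pi_pos
  -- This is the vertical semi-axis; as ρ decreases to 1 the ellipse collapses onto the interval and
  -- drops below height π/β.
  have hlim : Tendsto (fun ρ : ℝ => a / 2 * (ρ - ρ⁻¹)) (𝓝[>] 1) (𝓝 (a / 2 * (1 - 1⁻¹))) := by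
    have : ContinuousAt (fun ρ : ℝ => a / 2 * (ρ - ρ⁻¹)) 1 :=
      continuousAt_const.mul (continuousAt_id.sub (continuousAt_inv₀ one_ne_zero))
    exact this.tendsto.mono_left nhdsWithin_le_nhds
  have hev : ∀ᶠ ρ : ℝ in 𝓝[>] 1, a / 2 * (ρ - ρ⁻¹) < Real.pi / β :=
    hlim.eventually (gt_mem_nhds (by simp; positivity))
  obtain ⟨ρ, hρlt, hρ⟩ := (hev.and self_mem_nhdsWithin).exists
  have hρ1 : 1 < ρ := hρ
  refine ⟨ρ, hρ1, isClosedCurve_ellipse hρ1, fun t _ _ => ?_, fun t _ => ellipse_notMem ha hρ1 t,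
    fun w hw => windingNumber_ellipse ha hρ1 hw⟩
  have hB : 0 ≤ a / 2 * (ρ - ρ⁻¹) := by
    have : ρ⁻¹ ≤ 1 := inv_le_one_of_one_le₀ hρ1.le
    exact mul_nonneg (by positivity) (by linarith)
  rw [ellipse_im, abs_mul, abs_of_nonneg hB]
  exact lt_of_le_of_lt (mul_le_of_le_one_right hB (Real.abs_sin_le_one _)) hρlt

/-- Shifting the parameter by half a period sends z to -z and dz to -dz. -/
theorem contourIntegral_ellipse_neg {a ρ : ℝ} (f : ℂ → ℂ) :
    contourIntegral (ellipse a ρ) f = -contourIntegral (ellipse a ρ) (fun z => f (-z)) := by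
  set p : ℝ → ℂ := fun t => f (ellipse a ρ t) * deriv (ellipse a ρ) t with hp
  have hderiv : ∀ t, deriv (ellipse a ρ) (t + 1 / 2) = -deriv (ellipse a ρ) t := by
    intro t
    rw [← deriv_comp_add_const]
    simp only [ellipse_add_half]
    exact deriv.fun_neg
  have hshift : ∀ t, p (t + 1 / 2) = -(f (-ellipse a ρ t) * deriv (ellipse a ρ) t) := by
    intro t
    rw [hp]
    simp only [hderiv, ellipse_add_half]
    ring
  have hper : Function.Periodic p 1 := by
    intro t
    have h1 : t + 1 = t + 1 / 2 + 1 / 2 := by ring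
    rw [h1]
    simp only [hp, hderiv, ellipse_add_half, neg_neg]
  have h2 := hper.intervalIntegral_add_eq 0 (1 / 2)
  rw [contourIntegral, contourIntegral, ← intervalIntegral.integral_neg]
  simp only [← hshift]
  rw [intervalIntegral.integral_comp_add_right (fun t => p t)]
  rw [zero_add] at h2
  rw [h2, zero_add, add_comm (1 : ℝ)]

theorem limitInterval_subset_symmInterval (h : ℝ) :
    limitInterval h ⊆ symmInterval (Real.sqrt (1 + 4 * h ^ 2)) := by
  have h1 := one_le_sqrt_one_add h
  unfold limitInterval symmInterval
  refine Set.image_mono ?_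
  split_ifs
  · exact Set.Icc_subset_Icc_left (by linarith)
  · exact Set.Icc_subset_Icc_right (by linarith)

theorem neg_mem_symmInterval {a : ℝ} {z : ℂ} (hz : -z ∈ symmInterval a) : z ∈ symmInterval a := by
  obtain ⟨x, hx, hxz⟩ := hz
  exact ⟨-x, ⟨by linarith [hx.2], by linarith [hx.1]⟩, by rw [Complex.ofReal_neg, hxz, neg_neg]⟩

/-- For nearby fields the intervals are close. -/
theorem eventually_limitInterval_subset (h₀ : ℝ) {δ : ℝ} (hδ : 0 < δ) :
    ∀ᶠ h in 𝓝 h₀, limitInterval h ⊆ Metric.thickening δ (limitInterval h₀) := by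
  have hc : ContinuousAt (fun h : ℝ => Real.sqrt (1 + 4 * h ^ 2)) h₀ := by fun_prop
  have h1 : ∀ᶠ h in 𝓝 h₀,
      dist (Real.sqrt (1 + 4 * h ^ 2)) (Real.sqrt (1 + 4 * h₀ ^ 2)) < δ :=
    hc.tendsto.eventually (Metric.ball_mem_nhds _ hδ)
  -- The interval changes sides at zero field. If h₀ ≠ 0, nearby fields have its sign; if h₀ = 0,
  -- both shapes are close to [-1, 1].
  have h2 : ∀ᶠ h in 𝓝 h₀, 0 < h₀ → 0 < h := by
    by_cases hpos : 0 < h₀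
    · filter_upwards [lt_mem_nhds hpos] with h hh _ using hh
    · exact Eventually.of_forall fun h hh => absurd hh hpos
  have h3 : ∀ᶠ h in 𝓝 h₀, h₀ < 0 → h < 0 := by
    by_cases hneg : h₀ < 0
    · filter_upwards [gt_mem_nhds hneg] with h hh _ using hh
    · exact Eventually.of_forall fun h hh => absurd hh hneg
  filter_upwards [h1, h2, h3] with h hd hpos hneg z hz
  have hr := one_le_sqrt_one_add h
  have hr₀ := one_le_sqrt_one_add h₀
  have h0one : h₀ = 0 → Real.sqrt (1 + 4 * h₀ ^ 2) = 1 := by rintro rfl; simp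
  rw [Real.dist_eq, abs_lt] at hd
  set r := Real.sqrt (1 + 4 * h ^ 2)
  set r₀ := Real.sqrt (1 + 4 * h₀ ^ 2)
  rw [mem_limitInterval] at hz
  obtain ⟨him, hz⟩ := hz
  have key : ∀ y : ℝ, (y : ℂ) ∈ limitInterval h₀ → |z.re - y| < δ →
      z ∈ Metric.thickening δ (limitInterval h₀) := by
    intro y hy hlt
    refine Metric.mem_thickening_iff.mpr ⟨y, hy, ?_⟩
    rw [show z = (z.re : ℂ) from Complex.ext (by simp) (by simp [him]), dist_eq_norm,
      ← Complex.ofReal_sub, Complex.norm_real, Real.norm_eq_abs]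
    exact hlt
  rcases hz with ⟨hh, hz1, hz2⟩ | ⟨hh, hz1, hz2⟩
  · have hh₀ : h₀ ≤ 0 := by by_contra hcon; push Not at hcon; linarith [hpos hcon]
    refine key (min z.re r₀) (mem_limitInterval.mpr ⟨by simp, Or.inl ⟨hh₀, ?_, ?_⟩⟩) ?_
    · rw [Complex.ofReal_re]; exact le_min hz1 (by linarith)
    · rw [Complex.ofReal_re]; exact min_le_right _ _
    · rcases le_total z.re r₀ with hc' | hc'
      · rw [min_eq_left hc', sub_self, abs_zero]; exact hδ
      · rw [min_eq_right hc', abs_of_nonneg (by linarith)]; linarith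
  · have hh₀ : 0 ≤ h₀ := by by_contra hcon; push Not at hcon; linarith [hneg hcon]
    refine key (max z.re (-r₀)) (mem_limitInterval.mpr ⟨by simp, ?_⟩) ?_
    · rw [Complex.ofReal_re]
      rcases hh₀.eq_or_lt with h0 | h0
      · have := h0one h0.symm
        refine Or.inl ⟨h0.ge, ?_, max_le (by linarith) (by linarith)⟩
        exact le_max_of_le_right (by linarith)
      · exact Or.inr ⟨h0, le_max_right _ _, max_le hz2 (by linarith)⟩
    · rcases le_total z.re (-r₀) with hc' | hc'
      · rw [max_eq_right hc', abs_of_nonpos (by linarith)]; linarith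
      · rw [max_eq_left hc', sub_self, abs_zero]; exact hδ

/-- A thermal contour at the field `h₀` is one at all nearby fields. -/
theorem IsThermalContour.eventually_field {β h₀ : ℝ} {γ : ℝ → ℂ}
    (hγ : IsThermalContour β (limitInterval h₀) γ) :
    ∃ δ > 0, ∀ h ∈ Metric.closedBall h₀ δ, IsThermalContour β (limitInterval h) γ := by
  obtain ⟨ε, hε, hth⟩ := hγ.exists_thickening (isCompact_limitInterval h₀)
  obtain ⟨δ, hδ, hball⟩ :=
    Metric.nhds_basis_closedBall.mem_iff.mp (eventually_limitInterval_subset h₀ hε)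
  exact ⟨δ, hδ, fun h hh => hth.mono (hball hh)⟩

theorem exists_isThermalContour {β : ℝ} (hβ : 0 < β) (h : ℝ) :
    ∃ γ : ℝ → ℂ, IsThermalContour β (limitInterval h) γ := by
  obtain ⟨ρ, _, hγ⟩ := exists_isThermalContour_ellipse hβ
    (lt_of_lt_of_le one_pos (one_le_sqrt_one_add h))
  exact ⟨_, hγ.mono (limitInterval_subset_symmInterval h)⟩

end XYChain

/-! ### The thermodynamic limit -/

namespace XYChain

open MeasureTheory

/-- Contour integrals are continuous in a uniformly converging argument. -/
theorem tendsto_contourIntegral_comp {γ : ℝ → ℂ} (hγ : IsClosedCurve γ) {f ψ : ℂ → ℂ} {U : Set ℂ}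
    {G : ℕ → ℂ → ℂ} {g : ℂ → ℂ} (hf : ContinuousOn (fun t => f (γ t)) (Set.Icc 0 1))
    (hU : IsOpen U) (hψ : ContinuousOn ψ U)
    (hG : ∀ k, ContinuousOn (fun t => G k (γ t)) (Set.Icc 0 1))
    (hg : ContinuousOn (fun t => g (γ t)) (Set.Icc 0 1))
    (hgU : ∀ t ∈ Set.Icc (0 : ℝ) 1, g (γ t) ∈ U)
    (hlim : TendstoUniformlyOn G g atTop (γ '' Set.Icc 0 1)) :
    Tendsto (fun k => contourIntegral γ (fun z => f z * ψ (G k z))) atTop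
      (𝓝 (contourIntegral γ (fun z => f z * ψ (g z)))) := by
  have hIoc : Set.uIoc (0 : ℝ) 1 ⊆ Set.Icc 0 1 := by
    rw [Set.uIoc_of_le zero_le_one]; exact Set.Ioc_subset_Icc_self
  set K := (fun t => g (γ t)) '' Set.Icc 0 1 with hK
  have hKc : IsCompact K := isCompact_Icc.image_of_continuousOn hg
  have hKU : K ⊆ U := by rintro _ ⟨t, ht, rfl⟩; exact hgU t ht
  -- Eventually all values G_k(γ(t)) lie in this compact neighbourhood of the limiting values, on
  -- which ψ is bounded; the bound serves for dominated convergence.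
  obtain ⟨δ, hδ, hδU⟩ := hKc.exists_cthickening_subset_open hU hKU
  obtain ⟨C, hC⟩ := (hKc.cthickening (r := δ)).exists_bound_of_continuousOn (hψ.mono hδU)
  have hmem : ∀ᶠ k in atTop, ∀ t ∈ Set.Icc (0 : ℝ) 1, G k (γ t) ∈ Metric.cthickening δ K := by
    filter_upwards [Metric.tendstoUniformlyOn_iff.mp hlim δ hδ] with k hk t ht
    refine Metric.mem_cthickening_of_dist_le _ (g (γ t)) δ K ⟨t, ht, rfl⟩ ?_
    rw [dist_comm]
    exact (hk _ ⟨t, ht, rfl⟩).le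
  refine intervalIntegral.tendsto_integral_filter_of_dominated_convergence
    (fun t => C * ‖f (γ t) * deriv γ t‖) ?_ ?_ ?_ ?_
  · filter_upwards [hmem] with k hk
    refine (intervalIntegrable_iff.mp (hγ.intervalIntegrable_mul (hf.mul ?_))).aestronglyMeasurable
    exact hψ.comp (hG k) fun t ht => hδU (hk t ht)
  · filter_upwards [hmem] with k hk
    refine ae_of_all _ fun t ht => ?_
    rw [mul_right_comm, norm_mul, mul_comm]
    exact mul_le_mul_of_nonneg_right (hC _ (hk t (hIoc ht))) (norm_nonneg _)
  · exact (hγ.intervalIntegrable_mul hf).norm.const_mul C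
  · refine ae_of_all _ fun t ht => ?_
    have ht' := hIoc ht
    have h1 : Tendsto (fun k => G k (γ t)) atTop (𝓝 (g (γ t))) :=
      hlim.tendsto_at ⟨t, ht', rfl⟩
    have h2 : Tendsto ψ (𝓝 (g (γ t))) (𝓝 (ψ (g (γ t)))) :=
      (hψ.continuousAt (hU.mem_nhds (hgU t ht'))).tendsto
    exact ((h2.comp h1).const_mul _).mul_const _

/-! ### Field derivatives of the contour functionals -/

section Functional

variable {β : ℝ} {γ : ℝ → ℂ} {g : ℂ → ℂ}

/-- The contour formula for `log ζ` in terms of the Green function `g`. -/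
noncomputable def logFunctional (β : ℝ) (γ : ℝ → ℂ) (g : ℂ → ℂ) (h : ℝ) : ℂ :=
  -(β * h : ℂ) + β / (2 * Real.pi * Complex.I) *
    contourIntegral γ (fun z => occupation β z * Complex.log (1 + 2 * h * g z))

/-- The first field derivative of `logFunctional`. -/
noncomputable def logFunctional₁ (β : ℝ) (γ : ℝ → ℂ) (g : ℂ → ℂ) (h : ℝ) : ℂ :=
  -β + β / (2 * Real.pi * Complex.I) *
    contourIntegral γ (fun z => occupation β z * (2 * g z / (1 + 2 * h * g z)))

/-- The second field derivative of `logFunctional`. -/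
noncomputable def logFunctional₂ (β : ℝ) (γ : ℝ → ℂ) (g : ℂ → ℂ) (h : ℝ) : ℂ :=
  β / (2 * Real.pi * Complex.I) *
    contourIntegral γ (fun z => occupation β z * -(2 * g z / (1 + 2 * h * g z)) ^ 2)

/-- A thermal contour near the field `h₀` together with a Green function without zeros of
`1 + 2hg` on it. -/
structure Admissible (β : ℝ) (γ : ℝ → ℂ) (g : ℂ → ℂ) (h₀ δ : ℝ) : Prop where
  beta_pos : 0 < β
  radius_pos : 0 < δ
  curve : IsClosedCurve γ
  mem_domain : ∀ t ∈ Set.Icc (0 : ℝ) 1, γ t ∈ thermalDomain β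
  continuousOn : ContinuousOn (fun t => g (γ t)) (Set.Icc 0 1)
  slit : ∀ h ∈ Metric.closedBall h₀ δ, ∀ t ∈ Set.Icc (0 : ℝ) 1,
    1 + 2 * h * g (γ t) ∈ Complex.slitPlane

variable {h₀ δ : ℝ}

theorem Admissible.continuousOn_den (ha : Admissible β γ g h₀ δ) :
    ContinuousOn (fun p : ℝ × ℝ => 1 + 2 * (p.1 : ℂ) * g (γ p.2))
      (Metric.closedBall h₀ δ ×ˢ Set.Icc 0 1) := by
  have h1 : ContinuousOn (fun p : ℝ × ℝ => g (γ p.2)) (Metric.closedBall h₀ δ ×ˢ Set.Icc 0 1) :=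
    ha.continuousOn.comp continuousOn_snd fun p hp => hp.2
  have h2 : Continuous fun p : ℝ × ℝ => 2 * (p.1 : ℂ) := by fun_prop
  exact continuousOn_const.add (h2.continuousOn.mul h1)

theorem Admissible.continuousOn_weight (ha : Admissible β γ g h₀ δ) :
    ContinuousOn (fun t => occupation β (γ t)) (Set.Icc 0 1) :=
  (continuousOn_occupation ha.beta_pos).comp ha.curve.continuousOn ha.mem_domain

theorem contourIntegral_mul_eq (γ : ℝ → ℂ) (f ψ : ℂ → ℂ) :
    contourIntegral γ (fun z => f z * ψ z) =
      ∫ t in (0 : ℝ)..1, ψ (γ t) * (f (γ t) * deriv γ t) := by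
  rw [contourIntegral]
  exact intervalIntegral.integral_congr fun t _ => by ring

theorem hasDerivAt_one_add_two_mul (u : ℂ) (h : ℝ) :
    HasDerivAt (fun h : ℝ => 1 + 2 * (h : ℂ) * u) (2 * u) h := by
  have h1 : HasDerivAt (fun h : ℝ => (h : ℂ)) 1 h := Complex.ofRealCLM.hasDerivAt
  simpa using ((h1.const_mul 2).mul_const u).const_add 1

theorem Admissible.continuousOn_green (ha : Admissible β γ g h₀ δ) :
    ContinuousOn (fun p : ℝ × ℝ => 2 * g (γ p.2)) (Metric.closedBall h₀ δ ×ˢ Set.Icc 0 1) :=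
  continuousOn_const.mul (ha.continuousOn.comp continuousOn_snd fun _ hp => hp.2)

theorem Admissible.continuousOn_quotient (ha : Admissible β γ g h₀ δ) :
    ContinuousOn (fun p : ℝ × ℝ => 2 * g (γ p.2) / (1 + 2 * (p.1 : ℂ) * g (γ p.2)))
      (Metric.closedBall h₀ δ ×ˢ Set.Icc 0 1) :=
  ha.continuousOn_green.div ha.continuousOn_den
    fun p hp => Complex.slitPlane_ne_zero (ha.slit p.1 hp.1 p.2 hp.2)

theorem Admissible.hasDerivAt (ha : Admissible β γ g h₀ δ) :
    HasDerivAt (logFunctional β γ g) (logFunctional₁ β γ g h₀) h₀ := by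
  have hF : ContinuousOn (fun p : ℝ × ℝ => Complex.log (1 + 2 * (p.1 : ℂ) * g (γ p.2)))
      (Metric.closedBall h₀ δ ×ˢ Set.Icc 0 1) :=
    ha.continuousOn_den.clog fun p hp => ha.slit p.1 hp.1 p.2 hp.2
  have hd : ∀ h ∈ Metric.closedBall h₀ δ, ∀ t ∈ Set.Icc (0 : ℝ) 1,
      HasDerivAt (fun h : ℝ => Complex.log (1 + 2 * (h : ℂ) * g (γ t)))
        (2 * g (γ t) / (1 + 2 * (h : ℂ) * g (γ t))) h := fun h hh t ht =>
    (hasDerivAt_one_add_two_mul _ h).clog_real (ha.slit h hh t ht)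
  have h1 := hasDerivAt_integral_mul (𝕜 := ℝ)
    (F := fun h t => Complex.log (1 + 2 * (h : ℂ) * g (γ t)))
    (F' := fun h t => 2 * g (γ t) / (1 + 2 * (h : ℂ) * g (γ t))) ha.radius_pos
    (ha.curve.intervalIntegrable_mul ha.continuousOn_weight) hF ha.continuousOn_quotient hd
  have h0 : HasDerivAt (fun h : ℝ => (h : ℂ)) 1 h₀ := Complex.ofRealCLM.hasDerivAt
  have h2 := ((h0.const_mul (β : ℂ)).fun_neg).fun_add
    (h1.const_mul (β / (2 * Real.pi * Complex.I) : ℂ))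
  rw [mul_one] at h2
  unfold logFunctional logFunctional₁
  simp only [contourIntegral_mul_eq γ (occupation β)]
  exact h2

theorem Admissible.hasDerivAt₁ (ha : Admissible β γ g h₀ δ) :
    HasDerivAt (logFunctional₁ β γ g) (logFunctional₂ β γ g h₀) h₀ := by
  have hF' : ContinuousOn (fun p : ℝ × ℝ => -(2 * g (γ p.2) / (1 + 2 * (p.1 : ℂ) * g (γ p.2))) ^ 2)
      (Metric.closedBall h₀ δ ×ˢ Set.Icc 0 1) := (ha.continuousOn_quotient.pow 2).neg
  have hd : ∀ h ∈ Metric.closedBall h₀ δ, ∀ t ∈ Set.Icc (0 : ℝ) 1,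
      HasDerivAt (fun h : ℝ => 2 * g (γ t) / (1 + 2 * (h : ℂ) * g (γ t)))
        (-(2 * g (γ t) / (1 + 2 * (h : ℂ) * g (γ t))) ^ 2) h := by
    intro h hh t ht
    have h0 := Complex.slitPlane_ne_zero (ha.slit h hh t ht)
    refine ((hasDerivAt_const h (2 * g (γ t))).fun_div
      (hasDerivAt_one_add_two_mul (g (γ t)) h) h0).congr_deriv ?_
    rw [div_pow]
    ring
  have h1 := hasDerivAt_integral_mul (𝕜 := ℝ)
    (F := fun h t => 2 * g (γ t) / (1 + 2 * (h : ℂ) * g (γ t)))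
    (F' := fun h t => -(2 * g (γ t) / (1 + 2 * (h : ℂ) * g (γ t))) ^ 2) ha.radius_pos
    (ha.curve.intervalIntegrable_mul ha.continuousOn_weight) ha.continuousOn_quotient hF' hd
  have h2 := (h1.const_mul (β / (2 * Real.pi * Complex.I) : ℂ)).const_add (-β : ℂ)
  unfold logFunctional₁ logFunctional₂
  simp only [contourIntegral_mul_eq γ (occupation β)]
  exact h2

/-- If a complex derivative of a real function exists, it is real. -/
theorem hasDerivAt_of_ofReal {f : ℝ → ℝ} {c : ℂ} {x : ℝ}
    (h : HasDerivAt (fun y => (f y : ℂ)) c x) : HasDerivAt f c.re x ∧ (c.re : ℂ) = c := by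
  have h1 : HasDerivAt f c.re x := Complex.reCLM.hasFDerivAt.comp_hasDerivAt x h
  exact ⟨h1, h1.ofReal_comp.unique h⟩

/-- The first two derivatives of a real function given by `logFunctional`. -/
theorem derivs_of_eq_logFunctional {f : ℝ → ℝ}
    (ha : ∀ h ∈ Metric.ball h₀ δ, ∃ ε, Admissible β γ g h ε) (hδ : 0 < δ)
    (hf : ∀ h ∈ Metric.ball h₀ δ, (f h : ℂ) = logFunctional β γ g h) :
    (HasDerivAt f (deriv f h₀) h₀ ∧ ((deriv f h₀ : ℝ) : ℂ) = logFunctional₁ β γ g h₀) ∧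
    HasDerivAt (deriv f) (deriv (deriv f) h₀) h₀ ∧
      ((deriv (deriv f) h₀ : ℝ) : ℂ) = logFunctional₂ β γ g h₀ := by
  have h1 : ∀ h ∈ Metric.ball h₀ δ, HasDerivAt f (deriv f h) h ∧
      ((deriv f h : ℝ) : ℂ) = logFunctional₁ β γ g h := by
    intro h hh
    obtain ⟨ε, hε⟩ := ha h hh
    have h2 : HasDerivAt (fun y => (f y : ℂ)) (logFunctional₁ β γ g h) h :=
      hε.hasDerivAt.congr_of_eventuallyEq
        (Filter.Eventually.mono (Metric.isOpen_ball.mem_nhds hh) fun y hy => hf y hy)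
    obtain ⟨h3, h4⟩ := hasDerivAt_of_ofReal h2
    rw [h3.deriv]
    exact ⟨h3, h4⟩
  have h0 : h₀ ∈ Metric.ball h₀ δ := Metric.mem_ball_self hδ
  refine ⟨h1 h₀ h0, ?_⟩
  obtain ⟨ε, hε⟩ := ha h₀ h0
  have h2 : HasDerivAt (fun y => ((deriv f y : ℝ) : ℂ)) (logFunctional₂ β γ g h₀) h₀ :=
    hε.hasDerivAt₁.congr_of_eventuallyEq
      (Filter.Eventually.mono (Metric.isOpen_ball.mem_nhds h0) fun y hy => (h1 y hy).2)
  obtain ⟨h3, h4⟩ := hasDerivAt_of_ofReal h2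
  rw [h3.deriv]
  exact ⟨h3, h4⟩

end Functional

/-- The Green function of the infinite chain. -/
noncomputable def limitGreen (z : ℂ) : ℂ := (sqrtBranch z)⁻¹

theorem continuousOn_limitGreen : ContinuousOn limitGreen cutᶜ :=
  continuousOn_sqrtBranch.inv₀ fun _ hz => sqrtBranch_ne_zero hz

theorem continuousOn_freeGreen (L : ℕ) : ContinuousOn (freeGreen L) cutᶜ := fun _ hz =>
  (differentiableAt_freeGreen L hz).continuousAt.continuousWithinAt

theorem IsThermalContour.mem_compl_cut {β h : ℝ} {γ : ℝ → ℂ}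
    (hγ : IsThermalContour β (limitInterval h) γ) : ∀ t ∈ Set.Icc (0 : ℝ) 1, γ t ∈ cutᶜ :=
  fun t ht hmem => hγ.avoids t ht (cut_subset_limitInterval h hmem)

theorem even_two_mul_add_two (k : ℕ) : Even (2 * k + 2) := ⟨k + 1, by ring⟩

/-! ### Passage to the infinite chain and its closed form -/

section Limit

variable {β h : ℝ} {γ : ℝ → ℂ}

/-- One fixed curve must serve a whole neighbourhood of fields, since the second derivative needs
the first at nearby fields. The radius δ depends only on the intervals, hence not on L. -/
theorem exists_admissible (hβ : 0 < β) (hγ : IsThermalContour β (limitInterval h) γ) :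
    ∃ δ > 0, (∀ y ∈ Metric.ball h δ, IsThermalContour β (limitInterval y) γ) ∧
      (∀ y ∈ Metric.ball h δ, ∃ ε, Admissible β γ limitGreen y ε) ∧
      ∀ (L : ℕ), Even L → L ≠ 0 → ∀ y ∈ Metric.ball h δ, ∃ ε, Admissible β γ (freeGreen L) y ε := by
  obtain ⟨δ, hδ, hnear⟩ := hγ.eventually_field
  have hball : ∀ y ∈ Metric.ball h δ, IsThermalContour β (limitInterval y) γ := fun y hy =>
    hnear y (Metric.ball_subset_closedBall hy)
  have hcut := hγ.mem_compl_cut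
  refine ⟨δ, hδ, hball, fun y hy => ?_, fun L hL hL0 y hy => ?_⟩ <;>
  obtain ⟨ε, hε, hy'⟩ := (hball y hy).eventually_field
  · exact ⟨ε, hβ, hε, hγ.curve, hγ.mem_domain,
      continuousOn_limitGreen.comp hγ.curve.continuousOn hcut,
      fun x hx t ht => limitF_mem_slitPlane ((hy' x hx).avoids t ht)⟩
  · exact ⟨ε, hβ, hε, hγ.curve, hγ.mem_domain,
      (continuousOn_freeGreen L).comp hγ.curve.continuousOn hcut,
      fun x hx t ht => finiteF_mem_slitPlane hL hL0 ((hy' x hx).avoids t ht)⟩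

theorem tendsto_contourIntegral_freeGreen (hγ : IsThermalContour β (limitInterval h) γ)
    {f ψ : ℂ → ℂ} (hf : ContinuousOn f (thermalDomain β))
    (hψ : ContinuousOn ψ {u : ℂ | 1 + 2 * h * u ∈ Complex.slitPlane}) :
    Tendsto (fun k : ℕ => contourIntegral γ (fun z => f z * ψ (freeGreen (2 * k + 2) z))) atTop
      (𝓝 (contourIntegral γ (fun z => f z * ψ (limitGreen z)))) := by
  have hcut := hγ.mem_compl_cut
  refine tendsto_contourIntegral_comp hγ.curve
    (hf.comp hγ.curve.continuousOn hγ.mem_domain)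
    (Complex.isOpen_slitPlane.preimage (by fun_prop)) hψ
    (fun k => (continuousOn_freeGreen _).comp hγ.curve.continuousOn hcut)
    (continuousOn_limitGreen.comp hγ.curve.continuousOn hcut)
    (fun t ht => limitF_mem_slitPlane (hγ.avoids t ht)) ?_
  refine tendstoUniformlyOn_freeGreen (isCompact_Icc.image_of_continuousOn hγ.curve.continuousOn) ?_
  rintro _ ⟨t, ht, rfl⟩
  exact hcut t ht

theorem continuousOn_log_slit (h : ℝ) : ContinuousOn (fun u : ℂ => Complex.log (1 + 2 * h * u))
    {u : ℂ | 1 + 2 * h * u ∈ Complex.slitPlane} :=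
  ContinuousOn.clog (by fun_prop) fun _ hu => hu

theorem continuousOn_div_slit (h : ℝ) : ContinuousOn (fun u : ℂ => 2 * u / (1 + 2 * h * u))
    {u : ℂ | 1 + 2 * h * u ∈ Complex.slitPlane} :=
  ContinuousOn.div (by fun_prop) (by fun_prop) fun _ hu => Complex.slitPlane_ne_zero hu

theorem tendsto_logFunctional₁ (hβ : 0 < β) (hγ : IsThermalContour β (limitInterval h) γ) :
    Tendsto (fun k : ℕ => logFunctional₁ β γ (freeGreen (2 * k + 2)) h) atTop
      (𝓝 (logFunctional₁ β γ limitGreen h)) :=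
  ((tendsto_contourIntegral_freeGreen hγ (continuousOn_occupation hβ)
    (continuousOn_div_slit h)).const_mul _).const_add _

theorem tendsto_logFunctional₂ (hβ : 0 < β) (hγ : IsThermalContour β (limitInterval h) γ) :
    Tendsto (fun k : ℕ => logFunctional₂ β γ (freeGreen (2 * k + 2)) h) atTop
      (𝓝 (logFunctional₂ β γ limitGreen h)) :=
  (tendsto_contourIntegral_freeGreen (ψ := fun u => -(2 * u / (1 + 2 * h * u)) ^ 2) hγ
    (continuousOn_occupation hβ) ((continuousOn_div_slit h).pow 2).neg).const_mul _

/-- The logarithm of the limit of `ζ_L` in closed form. -/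
noncomputable def logZeta (β h : ℝ) : ℝ :=
  Real.log (Real.cosh (β * Real.sqrt (1 + 4 * h ^ 2) / 2)) - Real.log (Real.cosh (β / 2))

theorem sqrtBranch_add_ne_zero {z : ℂ} (hz : z ∉ limitInterval h) : sqrtBranch z + 2 * h ≠ 0 := by
  intro h0
  have hs := sqrtBranch_ne_zero fun hh => hz (cut_subset_limitInterval h hh)
  have h1 := Complex.slitPlane_ne_zero (limitF_mem_slitPlane hz)
  rw [show 1 + 2 * h * (sqrtBranch z)⁻¹ = (sqrtBranch z + 2 * h) / sqrtBranch z by field_simp, h0,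
    zero_div] at h1
  exact h1 rfl

theorem hasDerivAt_log_limitF {z : ℂ} (hz : z ∉ limitInterval h) :
    HasDerivAt (fun z => Complex.log (1 + 2 * h * limitGreen z))
      (-(2 * h * z) / (sqrtBranch z ^ 2 * (sqrtBranch z + 2 * h))) z := by
  have hcut : z ∉ cut := fun hh => hz (cut_subset_limitInterval h hh)
  have hs := sqrtBranch_ne_zero hcut
  have hslit := limitF_mem_slitPlane hz
  have hF' := sqrtBranch_add_ne_zero hz
  refine (((((hasDerivAt_sqrtBranch hcut).inv hs).const_mul (2 * h : ℂ)).const_add 1).clog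
    hslit).congr_deriv ?_
  have h1 : 1 + 2 * h * (sqrtBranch z)⁻¹ = (sqrtBranch z + 2 * h) / sqrtBranch z := by field_simp
  simp only [Pi.inv_apply, h1]
  field_simp

/-- The partial fraction decomposition of the logarithmic derivative of `F(z) F(-z)`. -/
theorem partial_fractions {z s r : ℂ} (hsq : s ^ 2 = z ^ 2 - 1) (hrsq : r ^ 2 = 1 + 4 * (h : ℂ) ^ 2)
    (hs : s ≠ 0) (e1 : z - r ≠ 0) (e2 : z - -r ≠ 0) (e3 : z - 1 ≠ 0) (e4 : z - -1 ≠ 0)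
    (e5 : s + 2 * h ≠ 0) (e6 : -s + 2 * h ≠ 0) :
    -(2 * h * z) / (s ^ 2 * (s + 2 * h)) + -(2 * h * -z) / ((-s) ^ 2 * (-s + 2 * h)) * -1 =
      (z - r)⁻¹ + (z - -r)⁻¹ - ((z - 1)⁻¹ + (z - -1)⁻¹) := by
  have a1 : (z - r)⁻¹ + (z - -r)⁻¹ = 2 * z / (z ^ 2 - 1 - 4 * h ^ 2) := by
    have : z ^ 2 - 1 - 4 * (h : ℂ) ^ 2 = (z - r) * (z - -r) := by linear_combination hrsq
    rw [this]
    field_simp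
    ring
  have a2 : (z - 1)⁻¹ + (z - -1)⁻¹ = 2 * z / (z ^ 2 - 1) := by
    have : z ^ 2 - 1 = (z - 1) * (z - -1) := by ring
    rw [this]
    field_simp
    ring
  have a3 : z ^ 2 - 1 - 4 * (h : ℂ) ^ 2 = -((s + 2 * h) * (-s + 2 * h)) := by
    linear_combination -hsq
  rw [a1, a2, a3, ← hsq]
  field_simp
  ring

/-- The even form of the contour formula, evaluated by residues on a centrally symmetric
contour. -/
theorem contourIntegral_even (hβ : 0 < β) {r : ℝ} (hr1 : 1 ≤ r)
    (hrsq : (r : ℂ) ^ 2 = 1 + 4 * (h : ℂ) ^ 2) (hsub : limitInterval h ⊆ symmInterval r)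
    (hγ : IsThermalContour β (symmInterval r) γ)
    (hsymm : ∀ f : ℂ → ℂ, contourIntegral γ f = -contourIntegral γ (fun z => f (-z))) :
    contourIntegral γ (fun z =>
      β * (1 / 2 - occupation β z) * Complex.log (1 + 2 * h * limitGreen z)) =
      -(2 * Real.pi * Complex.I * (logCoshBranch β r - logCoshBranch β (1 : ℝ))) := by
  have hav : ∀ t ∈ Set.Icc (0 : ℝ) 1, γ t ∉ limitInterval h := fun t ht hm =>
    hγ.avoids t ht (hsub hm)
  have hav' : ∀ t ∈ Set.Icc (0 : ℝ) 1, -γ t ∉ limitInterval h := fun t ht hm =>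
    hγ.avoids t ht (neg_mem_symmInterval (hsub hm))
  have hcut : ∀ t ∈ Set.Icc (0 : ℝ) 1, γ t ∉ cut := fun t ht hm =>
    hav t ht (cut_subset_limitInterval h hm)
  have hmem : ∀ x : ℝ, |x| ≤ r → (x : ℂ) ∈ symmInterval r := fun x hx => ⟨x, abs_le.mp hx, rfl⟩
  have hγc := hγ.curve.continuousOn
  have hgc : ContinuousOn (fun t => limitGreen (γ t)) (Set.Icc 0 1) :=
    continuousOn_limitGreen.comp hγc hcut
  have hgc' : ContinuousOn (fun t => limitGreen (-γ t)) (Set.Icc 0 1) :=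
    continuousOn_limitGreen.comp hγc.neg fun t ht hm =>
      hav' t ht (cut_subset_limitInterval h hm)
  have hlog : ContinuousOn (fun t => Complex.log (1 + 2 * h * limitGreen (γ t))) (Set.Icc 0 1) :=
    (continuousOn_const.add (continuousOn_const.mul hgc)).clog
      fun t ht => limitF_mem_slitPlane (hav t ht)
  have hlog' : ContinuousOn (fun t => Complex.log (1 + 2 * h * limitGreen (-γ t))) (Set.Icc 0 1) :=
    (continuousOn_const.add (continuousOn_const.mul hgc')).clog
      fun t ht => limitF_mem_slitPlane (hav' t ht)
  have hwt : ContinuousOn (fun t => (β : ℂ) * (1 / 2 - occupation β (γ t))) (Set.Icc 0 1) :=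
    continuousOn_const.mul (continuousOn_const.sub
      ((continuousOn_occupation hβ).comp hγc hγ.mem_domain))
  -- Under z ↦ -z the weight 1/2 - occupation is odd, and its sign cancels the one from `hsymm`. So
  -- log F(z) may be replaced by log F(-z), and the average of the two has a rational derivative.
  have hJ : contourIntegral γ (fun z =>
        β * (1 / 2 - occupation β z) * Complex.log (1 + 2 * h * limitGreen z)) =
      contourIntegral γ (fun z =>
        β * (1 / 2 - occupation β z) * Complex.log (1 + 2 * h * limitGreen (-z))) := by
    rw [hsymm, ← neg_one_mul, ← contourIntegral_const_mul]
    refine contourIntegral_congr fun t ht => ?_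
    rw [occupation_neg hβ (hγ.mem_domain t ht)]
    ring
  have hne : ∀ x : ℝ, |x| ≤ r → ∀ t ∈ Set.Icc (0 : ℝ) 1, γ t ≠ x := fun x hx t ht h0 =>
    hγ.avoids t ht (h0 ▸ hmem x hx)
  have hinv : ∀ x : ℝ, |x| ≤ r → ContinuousOn (fun t => (γ t - x)⁻¹) (Set.Icc 0 1) := fun x hx =>
    (hγc.sub continuousOn_const).inv₀ fun t ht => sub_ne_zero.mpr (hne x hx t ht)
  have hb1 : |(1 : ℝ)| ≤ r := by rwa [abs_one]
  have hb1' : |(-1 : ℝ)| ≤ r := by rwa [abs_neg, abs_one]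
  have hbr : |r| ≤ r := by rw [abs_of_nonneg (by linarith)]
  have hbr' : |(-r)| ≤ r := by rw [abs_neg, abs_of_nonneg (by linarith)]
  have hκd : DifferentiableOn ℂ (logCoshBranch β) (thermalDomain β) := fun z hz =>
    (hasDerivAt_logCoshBranch hβ hz).differentiableAt.differentiableWithinAt
  have hκi : ∀ x : ℝ, |x| ≤ r →
      ContinuousOn (fun t => logCoshBranch β (γ t) * (γ t - x)⁻¹) (Set.Icc 0 1) :=
    fun x hx => (hκd.continuousOn.comp hγc hγ.mem_domain).mul (hinv x hx)
  have hparts : contourIntegral γ (fun z => logCoshBranch β z *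
        ((z - (r : ℝ))⁻¹ + (z - (-r : ℝ))⁻¹ - ((z - (1 : ℝ))⁻¹ + (z - (-1 : ℝ))⁻¹))) =
      -contourIntegral γ (fun z =>
        β * (1 / 2 - occupation β z) * (Complex.log (1 + 2 * h * limitGreen z) +
          Complex.log (1 + 2 * h * limitGreen (-z)))) := by
    refine contourIntegral_by_parts hγ.curve (U := logCoshBranch β)
      (u := fun z => β * (1 / 2 - occupation β z))
      (V := fun z => Complex.log (1 + 2 * h * limitGreen z) +
        Complex.log (1 + 2 * h * limitGreen (-z)))
      (v := fun z => (z - (r : ℝ))⁻¹ + (z - (-r : ℝ))⁻¹ - ((z - (1 : ℝ))⁻¹ + (z - (-1 : ℝ))⁻¹))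
      (fun t ht => hasDerivAt_logCoshBranch hβ (hγ.mem_domain t ht)) hwt (fun t ht => ?_)
      (((hinv _ hbr).add (hinv _ hbr')).sub ((hinv _ hb1).add (hinv _ hb1')))
    have hd := (hasDerivAt_log_limitF (hav t ht)).fun_add
      ((hasDerivAt_log_limitF (hav' t ht)).comp (γ t) (hasDerivAt_neg (γ t)))
    refine hd.congr_deriv ?_
    have e1 := sub_ne_zero.mpr (hne _ hbr t ht)
    have e2 := sub_ne_zero.mpr (hne _ hbr' t ht)
    have e3 := sub_ne_zero.mpr (hne _ hb1 t ht)
    have e4 := sub_ne_zero.mpr (hne _ hb1' t ht)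
    have e6 := sqrtBranch_add_ne_zero (hav' t ht)
    rw [sqrtBranch_neg (hcut t ht)] at e6
    rw [sqrtBranch_neg (hcut t ht)]
    push_cast at e1 e2 e3 e4 ⊢
    exact partial_fractions (sqrtBranch_sq (γ t)) hrsq (sqrtBranch_ne_zero (hcut t ht)) e1 e2 e3 e4
      (sqrtBranch_add_ne_zero (hav t ht)) e6
  have hcauchy : ∀ x : ℝ, |x| ≤ r →
      contourIntegral γ (fun z => logCoshBranch β z * (z - x)⁻¹) =
        2 * Real.pi * Complex.I * logCoshBranch β x := by
    intro x hx
    rw [contourIntegral_cauchy hβ hκd hγ.curve hγ.mem_domain (ofReal_mem_thermalDomain hβ x)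
      (hne x hx), hγ.encloses _ (hmem x hx), mul_one]
  -- Residues at ±r and ±1. As `logCoshBranch` is even they pair up, and the resulting factor 2
  -- compensates the symmetrization.
  simp only [mul_sub, mul_add] at hparts
  rw [contourIntegral_sub hγ.curve
    (f := fun z => logCoshBranch β z * (z - (r : ℝ))⁻¹ + logCoshBranch β z * (z - (-r : ℝ))⁻¹)
    (g := fun z => logCoshBranch β z * (z - (1 : ℝ))⁻¹ + logCoshBranch β z * (z - (-1 : ℝ))⁻¹)
    ((hκi _ hbr).add (hκi _ hbr')) ((hκi _ hb1).add (hκi _ hb1')),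
    contourIntegral_add hγ.curve (hκi _ hbr) (hκi _ hbr'),
    contourIntegral_add hγ.curve (hκi _ hb1) (hκi _ hb1'),
    hcauchy _ hbr, hcauchy _ hbr', hcauchy _ hb1, hcauchy _ hb1', Complex.ofReal_neg r,
    Complex.ofReal_neg 1, logCoshBranch_neg hβ (ofReal_mem_thermalDomain hβ r),
    logCoshBranch_neg hβ (ofReal_mem_thermalDomain hβ 1)] at hparts
  have hsum := contourIntegral_add hγ.curve
    (f := fun z => β * (1 / 2 - occupation β z) * Complex.log (1 + 2 * h * limitGreen z))
    (g := fun z => β * (1 / 2 - occupation β z) * Complex.log (1 + 2 * h * limitGreen (-z)))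
    (hwt.mul hlog) (hwt.mul hlog')
  rw [← hJ] at hsum
  simp only [mul_sub] at hsum ⊢
  rw [hsum] at hparts
  linear_combination hparts / 2

/-- The logarithm of `ζ_L` converges to the closed form. -/
theorem tendsto_log_chainZeta (hβ : 0 < β) (h : ℝ) (ν : ∀ k : ℕ, Fin (2 * k + 2)) :
    Tendsto (fun k => Real.log (chainZeta (2 * k + 2) (ν k) β h)) atTop (𝓝 (logZeta β h)) := by
  have hr1 := one_le_sqrt_one_add h
  have hrsq : ((Real.sqrt (1 + 4 * h ^ 2) : ℝ) : ℂ) ^ 2 = 1 + 4 * (h : ℂ) ^ 2 := by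
    rw [← Complex.ofReal_pow, Real.sq_sqrt (by positivity)]; push_cast; rfl
  have hsub := limitInterval_subset_symmInterval h
  set r := Real.sqrt (1 + 4 * h ^ 2) with hr
  obtain ⟨ρ, _, hγ⟩ := exists_isThermalContour_ellipse hβ (lt_of_lt_of_le one_pos hr1)
  have hγ' := hγ.mono hsub
  have h1 := (tendsto_contourIntegral_freeGreen hγ'
    (f := fun z => β * (1 / 2 - occupation β z))
    (continuousOn_const.mul (continuousOn_const.sub (continuousOn_occupation hβ)))
    (continuousOn_log_slit h)).const_mul (-(2 * Real.pi * Complex.I)⁻¹)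
  rw [contourIntegral_even hβ hr1 hrsq hsub hγ contourIntegral_ellipse_neg] at h1
  have h2 : -(2 * Real.pi * Complex.I : ℂ)⁻¹ *
      -(2 * Real.pi * Complex.I * (logCoshBranch β r - logCoshBranch β (1 : ℝ))) =
      ((logZeta β h : ℝ) : ℂ) := by
    rw [neg_mul_neg, inv_mul_cancel_left₀ Complex.two_pi_I_ne_zero, logCoshBranch_ofReal,
      logCoshBranch_ofReal, logZeta, mul_one, ← hr]
    push_cast
    ring
  rw [h2] at h1
  have h3 : Tendsto (fun k => ((Real.log (chainZeta (2 * k + 2) (ν k) β h) : ℝ) : ℂ)) atTop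
      (𝓝 ((logZeta β h : ℝ) : ℂ)) :=
    h1.congr fun k => (log_chainZeta_even hβ (even_two_mul_add_two k) (ν k) hγ').symm
  exact (Complex.continuous_re.tendsto _).comp h3

/-- Both sides are limits of the same sequence log ζ_L: along the symmetric ellipse it gives the
closed form, along γ the functional. No deformation of contours is needed, and the choice of sites
is immaterial. -/
theorem logZeta_eq_logFunctional (hβ : 0 < β) (hγ : IsThermalContour β (limitInterval h) γ) :
    ((logZeta β h : ℝ) : ℂ) = logFunctional β γ limitGreen h := by
  set ν : ∀ k : ℕ, Fin (2 * k + 2) := fun k => 0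
  have h1 : Tendsto (fun k => ((Real.log (chainZeta (2 * k + 2) (ν k) β h) : ℝ) : ℂ)) atTop
      (𝓝 ((logZeta β h : ℝ) : ℂ)) :=
    (Complex.continuous_ofReal.tendsto _).comp (tendsto_log_chainZeta hβ h ν)
  have h2 := ((tendsto_contourIntegral_freeGreen hγ (continuousOn_occupation hβ)
    (continuousOn_log_slit h)).const_mul (β / (2 * Real.pi * Complex.I) : ℂ)).const_add
    (-(β * h : ℂ))
  refine tendsto_nhds_unique h1 (h2.congr fun k => ?_)
  exact (log_chainZeta_occupation hβ (even_two_mul_add_two k) (ν k) hγ).symm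

theorem log_chainZeta_derivs (hβ : 0 < β) {L : ℕ} (hL : Even L) (ν : Fin L)
    (hγ : IsThermalContour β (limitInterval h) γ) :
    (HasDerivAt (fun y => Real.log (chainZeta L ν β y))
      (deriv (fun y => Real.log (chainZeta L ν β y)) h) h ∧
      ((deriv (fun y => Real.log (chainZeta L ν β y)) h : ℝ) : ℂ) =
        logFunctional₁ β γ (freeGreen L) h) ∧
    HasDerivAt (deriv fun y => Real.log (chainZeta L ν β y))
      (deriv (deriv fun y => Real.log (chainZeta L ν β y)) h) h ∧
      ((deriv (deriv fun y => Real.log (chainZeta L ν β y)) h : ℝ) : ℂ) =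
        logFunctional₂ β γ (freeGreen L) h := by
  obtain ⟨δ, hδ, hc, _, ha⟩ := exists_admissible hβ hγ
  exact derivs_of_eq_logFunctional (ha L hL (by have := ν.isLt; omega)) hδ
    fun y hy => log_chainZeta_occupation hβ hL ν (hc y hy)

theorem logZeta_derivs (hβ : 0 < β) (hγ : IsThermalContour β (limitInterval h) γ) :
    (HasDerivAt (logZeta β) (deriv (logZeta β) h) h ∧
      ((deriv (logZeta β) h : ℝ) : ℂ) = logFunctional₁ β γ limitGreen h) ∧
    HasDerivAt (deriv (logZeta β)) (deriv (deriv (logZeta β)) h) h ∧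
      ((deriv (deriv (logZeta β)) h : ℝ) : ℂ) = logFunctional₂ β γ limitGreen h := by
  obtain ⟨δ, hδ, hc, ha, _⟩ := exists_admissible hβ hγ
  exact derivs_of_eq_logFunctional ha hδ fun y hy => logZeta_eq_logFunctional hβ (hc y hy)

/-- Pointwise convergence of log ζ_L would not suffice. The derivatives are themselves contour
integrals over a contour independent of L, and these converge. -/
theorem tendsto_deriv_log_chainZeta (hβ : 0 < β) (h : ℝ) (ν : ∀ k : ℕ, Fin (2 * k + 2)) :
    Tendsto (fun k => deriv (fun y => Real.log (chainZeta (2 * k + 2) (ν k) β y)) h) atTop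
      (𝓝 (deriv (logZeta β) h)) ∧
    Tendsto (fun k => deriv (deriv fun y => Real.log (chainZeta (2 * k + 2) (ν k) β y)) h) atTop
      (𝓝 (deriv (deriv (logZeta β)) h)) := by
  obtain ⟨γ, hγ⟩ := exists_isThermalContour hβ h
  obtain ⟨⟨_, hl1⟩, _, hl2⟩ := logZeta_derivs hβ hγ
  have hf := fun k => log_chainZeta_derivs hβ (even_two_mul_add_two k) (ν k) hγ
  have h1 := tendsto_logFunctional₁ hβ hγ
  have h2 := tendsto_logFunctional₂ hβ hγ
  rw [← hl1] at h1
  rw [← hl2] at h2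
  exact ⟨(Complex.continuous_re.tendsto _).comp (h1.congr fun k => (hf k).1.2.symm),
    (Complex.continuous_re.tendsto _).comp (h2.congr fun k => (hf k).2.2.symm)⟩

end Limit

end XYChain

/-! ### The thermodynamic limit in closed form -/

namespace XYChain

/-- The normalized partition function of the infinite chain. -/
noncomputable def limitZeta (β h : ℝ) : ℝ :=
  Real.cosh (β * Real.sqrt (1 + 4 * h ^ 2) / 2) / Real.cosh (β / 2)

theorem limitZeta_pos (β h : ℝ) : 0 < limitZeta β h :=
  div_pos (Real.cosh_pos _) (Real.cosh_pos _)

theorem limitZeta_neg (β h : ℝ) : limitZeta β (-h) = limitZeta β h := by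
  rw [limitZeta, limitZeta, neg_sq]

theorem log_limitZeta (β h : ℝ) : Real.log (limitZeta β h) = logZeta β h :=
  Real.log_div (Real.cosh_pos _).ne' (Real.cosh_pos _).ne'

theorem exp_logZeta (β h : ℝ) : Real.exp (logZeta β h) = limitZeta β h := by
  rw [← log_limitZeta, Real.exp_log (limitZeta_pos β h)]

theorem logZeta_neg (β h : ℝ) : logZeta β (-h) = logZeta β h := by
  rw [← log_limitZeta, limitZeta_neg, log_limitZeta]

theorem one_add_four_mul_sq_pos (h : ℝ) : 0 < 1 + 4 * h ^ 2 := by positivity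

theorem sqrt_one_add_pos (h : ℝ) : 0 < Real.sqrt (1 + 4 * h ^ 2) :=
  Real.sqrt_pos.mpr (one_add_four_mul_sq_pos h)

theorem contDiff_limitZeta (β : ℝ) {n : WithTop ℕ∞} : ContDiff ℝ n (limitZeta β) := by
  have h1 : ContDiff ℝ n fun h : ℝ => Real.sqrt (1 + 4 * h ^ 2) :=
    (contDiff_const.add (contDiff_const.mul (contDiff_id.pow 2))).sqrt
      fun h => (one_add_four_mul_sq_pos h).ne'
  exact (Real.contDiff_cosh.comp ((contDiff_const.mul h1).div_const 2)).div_const _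

theorem hasDerivAt_sqrt_one_add (h : ℝ) :
    HasDerivAt (fun h : ℝ => Real.sqrt (1 + 4 * h ^ 2)) (4 * h / Real.sqrt (1 + 4 * h ^ 2)) h := by
  have h1 : HasDerivAt (fun h : ℝ => 1 + 4 * h ^ 2) (8 * h) h :=
    (((hasDerivAt_pow 2 h).const_mul 4).const_add 1).congr_deriv (by push_cast; ring)
  refine (h1.sqrt (one_add_four_mul_sq_pos h).ne').congr_deriv ?_
  have := (sqrt_one_add_pos h).ne'
  field_simp
  ring

theorem hasDerivAt_logZeta (β h : ℝ) :
    HasDerivAt (logZeta β) (2 * β * h * Real.tanh (β * Real.sqrt (1 + 4 * h ^ 2) / 2) /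
      Real.sqrt (1 + 4 * h ^ 2)) h := by
  have h1 := (((hasDerivAt_sqrt_one_add h).const_mul β).div_const 2)
  refine ((h1.cosh.log (Real.cosh_pos _).ne').sub_const _).congr_deriv ?_
  have := (sqrt_one_add_pos h).ne'
  rw [Real.tanh_eq_sinh_div_cosh]
  field_simp
  ring

theorem deriv_logZeta (β : ℝ) : deriv (logZeta β) = fun h =>
    2 * β * h * Real.tanh (β * Real.sqrt (1 + 4 * h ^ 2) / 2) / Real.sqrt (1 + 4 * h ^ 2) :=
  funext fun h => (hasDerivAt_logZeta β h).deriv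

theorem hasDerivAt_tanh (x : ℝ) : HasDerivAt Real.tanh (1 / Real.cosh x ^ 2) x := by
  have h0 := (Real.cosh_pos x).ne'
  have h1 : Real.tanh = fun y => Real.sinh y / Real.cosh y :=
    funext Real.tanh_eq_sinh_div_cosh
  rw [h1]
  refine ((Real.hasDerivAt_sinh x).fun_div (Real.hasDerivAt_cosh x) h0).congr_deriv ?_
  rw [← Real.cosh_sq_sub_sinh_sq x]
  ring

theorem hasDerivAt_deriv_logZeta (β h : ℝ) :
    HasDerivAt (deriv (logZeta β))
      (2 * β * Real.tanh (β * Real.sqrt (1 + 4 * h ^ 2) / 2) / Real.sqrt (1 + 4 * h ^ 2) ^ 3 +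
        4 * β ^ 2 * h ^ 2 / (Real.sqrt (1 + 4 * h ^ 2) ^ 2 *
          Real.cosh (β * Real.sqrt (1 + 4 * h ^ 2) / 2) ^ 2)) h := by
  have hr := (sqrt_one_add_pos h).ne'
  have hsq := Real.sq_sqrt (one_add_four_mul_sq_pos h).le
  have h1 := (((hasDerivAt_sqrt_one_add h).const_mul β).div_const 2)
  have h2 := (hasDerivAt_tanh _).comp h h1
  have h3 := (((hasDerivAt_id h).const_mul (2 * β)).mul h2).div (hasDerivAt_sqrt_one_add h) hr
  rw [deriv_logZeta]
  refine h3.congr_deriv ?_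
  have hc := (Real.cosh_pos (β * Real.sqrt (1 + 4 * h ^ 2) / 2)).ne'
  simp only [Function.comp_apply, id, Pi.mul_apply]
  generalize Real.cosh (β * Real.sqrt (1 + 4 * h ^ 2) / 2) = c at *
  generalize Real.tanh (β * Real.sqrt (1 + 4 * h ^ 2) / 2) = T at *
  generalize Real.sqrt (1 + 4 * h ^ 2) = r at *
  field_simp
  linear_combination (2 * β * c ^ 2 * T) * hsq

theorem deriv_deriv_logZeta (β h : ℝ) : deriv (deriv (logZeta β)) h =
    2 * β * Real.tanh (β * Real.sqrt (1 + 4 * h ^ 2) / 2) / Real.sqrt (1 + 4 * h ^ 2) ^ 3 +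
      4 * β ^ 2 * h ^ 2 / (Real.sqrt (1 + 4 * h ^ 2) ^ 2 *
        Real.cosh (β * Real.sqrt (1 + 4 * h ^ 2) / 2) ^ 2) :=
  (hasDerivAt_deriv_logZeta β h).deriv

/-- Magnetization and susceptibility in terms of the free energy, up to a constant. -/
theorem magnetization_eq {Z G : ℝ → ℝ} {c : ℝ} (hG : ∀ x, Real.log (Z x) = c + G x) (β h : ℝ) :
    magnetization Z β h = β⁻¹ * deriv G h := by
  rw [magnetization, funext hG, deriv_const_add]

theorem susceptibility_eq {Z G : ℝ → ℝ} {c : ℝ} (hG : ∀ x, Real.log (Z x) = c + G x) (β h : ℝ) :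
    susceptibility Z β h = β⁻¹ * deriv (deriv G) h := by
  rw [susceptibility, funext fun x => magnetization_eq hG β x, deriv_const_mul_field]

theorem log_limitZeta_eq (β x : ℝ) : Real.log (limitZeta β x) = 0 + logZeta β x := by
  rw [zero_add, log_limitZeta]

theorem magnetization_limitZeta {β : ℝ} (hβ : 0 < β) (h : ℝ) :
    magnetization (limitZeta β) β h =
      2 * h * Real.tanh (β * Real.sqrt (1 + 4 * h ^ 2) / 2) / Real.sqrt (1 + 4 * h ^ 2) := by
  rw [magnetization_eq (log_limitZeta_eq β), deriv_logZeta]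
  field_simp

theorem susceptibility_limitZeta {β : ℝ} (hβ : 0 < β) (h : ℝ) :
    susceptibility (limitZeta β) β h =
      2 * Real.tanh (β * Real.sqrt (1 + 4 * h ^ 2) / 2) / Real.sqrt (1 + 4 * h ^ 2) ^ 3 +
      4 * h ^ 2 / Real.sqrt (1 + 4 * h ^ 2) ^ 2 *
        (β / Real.cosh (β * Real.sqrt (1 + 4 * h ^ 2) / 2) ^ 2) := by
  rw [susceptibility_eq (log_limitZeta_eq β), deriv_deriv_logZeta]
  field_simp

theorem susceptibility_limitZeta_zero {β : ℝ} (hβ : 0 < β) :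
    susceptibility (limitZeta β) β 0 = 2 * Real.sinh β / (1 + Real.cosh β) := by
  rw [susceptibility_limitZeta hβ]
  have h1 : Real.sinh β = 2 * Real.sinh (β / 2) * Real.cosh (β / 2) := by
    rw [← Real.sinh_two_mul]; ring_nf
  have h2 : 1 + Real.cosh β = 2 * Real.cosh (β / 2) ^ 2 := by
    have h3 := Real.cosh_two_mul (β / 2)
    rw [mul_div_cancel₀ β two_ne_zero] at h3
    rw [h3, Real.sinh_sq]; ring
  have := (Real.cosh_pos (β / 2)).ne'
  rw [h1, h2]
  simp only [ne_eq, OfNat.ofNat_ne_zero, not_false_eq_true, zero_pow, mul_zero, add_zero,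
    Real.sqrt_one, mul_one, one_pow, div_one, zero_mul, Real.tanh_eq_sinh_div_cosh]
  field_simp

theorem tendsto_tanh_atTop : Tendsto Real.tanh atTop (𝓝 1) := by
  have h1 : Tendsto (fun x : ℝ => 1 - 2 / (Real.exp (2 * x) + 1)) atTop (𝓝 (1 - 0)) := by
    refine tendsto_const_nhds.sub (tendsto_const_nhds.div_atTop ?_)
    exact tendsto_atTop_add_const_right _ _
      (Real.tendsto_exp_atTop.comp (tendsto_id.const_mul_atTop two_pos))
  rw [sub_zero] at h1
  refine h1.congr fun x => ?_
  have h2 : Real.exp (2 * x) = Real.exp x ^ 2 := by rw [← Real.exp_nat_mul]; norm_num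
  rw [Real.tanh_eq_sinh_div_cosh, Real.sinh_eq, Real.cosh_eq, h2, Real.exp_neg]
  have := Real.exp_pos x
  field_simp
  ring

theorem tendsto_mul_sqrt_atTop (h : ℝ) :
    Tendsto (fun β : ℝ => β * Real.sqrt (1 + 4 * h ^ 2) / 2) atTop atTop :=
  (tendsto_id.atTop_mul_const (sqrt_one_add_pos h)).atTop_div_const two_pos

/-- The crude bound cosh² u ≥ u² ≥ β²/4 already gives decay like 4/β. -/
theorem tendsto_div_cosh_sq (h : ℝ) :
    Tendsto (fun β : ℝ => β / Real.cosh (β * Real.sqrt (1 + 4 * h ^ 2) / 2) ^ 2) atTop (𝓝 0) := by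
  have h1 : Tendsto (fun β : ℝ => 4 / β) atTop (𝓝 0) := tendsto_const_nhds.div_atTop tendsto_id
  refine squeeze_zero' ?_ ?_ h1
  · filter_upwards [eventually_gt_atTop 0] with β hβ
    positivity
  · filter_upwards [eventually_gt_atTop 0] with β hβ
    have h2 := one_le_sqrt_one_add h
    have h3 : β / 2 ≤ β * Real.sqrt (1 + 4 * h ^ 2) / 2 := by nlinarith
    set u := β * Real.sqrt (1 + 4 * h ^ 2) / 2
    have h4 : u ≤ Real.sinh u := Real.self_le_sinh_iff.mpr (by linarith)
    have h5 : β ^ 2 / 4 ≤ Real.cosh u ^ 2 := by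
      rw [Real.cosh_sq]; nlinarith
    rw [div_le_div_iff₀ (by positivity) hβ]
    nlinarith

theorem tendsto_magnetization_limitZeta (h : ℝ) :
    Tendsto (fun β => magnetization (limitZeta β) β h) atTop
      (𝓝 (2 * h / Real.sqrt (1 + 4 * h ^ 2))) := by
  have h1 := ((tendsto_tanh_atTop.comp (tendsto_mul_sqrt_atTop h)).const_mul (2 * h)).div_const
    (Real.sqrt (1 + 4 * h ^ 2))
  rw [mul_one] at h1
  refine h1.congr' ?_
  filter_upwards [eventually_gt_atTop 0] with β hβ
  rw [magnetization_limitZeta hβ]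
  rfl

theorem tendsto_susceptibility_limitZeta (h : ℝ) :
    Tendsto (fun β => susceptibility (limitZeta β) β h) atTop
      (𝓝 (2 / (1 + 4 * h ^ 2) ^ (3 / 2 : ℝ))) := by
  have h1 := (((tendsto_tanh_atTop.comp (tendsto_mul_sqrt_atTop h)).const_mul 2).div_const
    (Real.sqrt (1 + 4 * h ^ 2) ^ 3)).add
    ((tendsto_div_cosh_sq h).const_mul (4 * h ^ 2 / Real.sqrt (1 + 4 * h ^ 2) ^ 2))
  have h2 : (1 + 4 * h ^ 2) ^ (3 / 2 : ℝ) = Real.sqrt (1 + 4 * h ^ 2) ^ 3 := by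
    rw [Real.sqrt_eq_rpow, ← Real.rpow_natCast (_ ^ (1 / 2 : ℝ)) 3, ← Real.rpow_mul (one_add_four_mul_sq_pos h).le]
    norm_num
  rw [mul_one, mul_zero, add_zero, ← h2] at h1
  refine h1.congr' ?_
  filter_upwards [eventually_gt_atTop 0] with β hβ
  rw [susceptibility_limitZeta hβ, h2]
  rfl

/-! ### Contour formulas and convergence -/

theorem log_limitZeta_contour {β h : ℝ} {γ : ℝ → ℂ} (hβ : 0 < β)
    (hγ : IsThermalContour β (limitInterval h) γ) :
    (Real.log (limitZeta β h) : ℂ) =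
      -(β * h : ℂ) + β / (2 * Real.pi * Complex.I) *
        contourIntegral γ (fun z => 1 / (1 + Complex.exp (β * z)) *
          Complex.log (1 + 2 * h / sqrtBranch z)) := by
  rw [log_limitZeta, logZeta_eq_logFunctional hβ hγ]
  rfl

theorem two_mul_limitGreen_div {h : ℝ} {z : ℂ} (hz : z ∉ limitInterval h) :
    2 * limitGreen z / (1 + 2 * h * limitGreen z) = 2 * (1 / (sqrtBranch z + 2 * h)) := by
  have h1 := sqrtBranch_add_ne_zero hz
  have h2 := sqrtBranch_ne_zero fun hh => hz (cut_subset_limitInterval h hh)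
  rw [limitGreen, show 1 + 2 * (h : ℂ) * (sqrtBranch z)⁻¹ = (sqrtBranch z + 2 * h) / sqrtBranch z by
    field_simp]
  field_simp

theorem magnetization_limitZeta_contour {β h : ℝ} {γ : ℝ → ℂ} (hβ : 0 < β)
    (hγ : IsThermalContour β (limitInterval h) γ) :
    (magnetization (limitZeta β) β h : ℂ) =
      -1 + 1 / (Real.pi * Complex.I) *
        contourIntegral γ (fun z => 1 / (1 + Complex.exp (β * z)) *
          (1 / (sqrtBranch z + 2 * h))) := by
  rw [magnetization_eq (log_limitZeta_eq β), Complex.ofReal_mul, (logZeta_derivs hβ hγ).1.2,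
    logFunctional₁, contourIntegral_congr (g := fun z => 2 * (1 / (1 + Complex.exp (β * z)) *
      (1 / (sqrtBranch z + 2 * h)))) fun t ht => by
        rw [two_mul_limitGreen_div (hγ.avoids t ht), occupation]; ring, contourIntegral_const_mul]
  have h1 : (β : ℂ) ≠ 0 := Complex.ofReal_ne_zero.mpr hβ.ne'
  have h2 : (Real.pi : ℂ) ≠ 0 := Complex.ofReal_ne_zero.mpr Real.pi_ne_zero
  have h3 := Complex.I_ne_zero
  push_cast
  field_simp

theorem susceptibility_limitZeta_contour {β h : ℝ} {γ : ℝ → ℂ} (hβ : 0 < β)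
    (hγ : IsThermalContour β (limitInterval h) γ) :
    (susceptibility (limitZeta β) β h : ℂ) =
      -(2 / (Real.pi * Complex.I)) *
        contourIntegral γ (fun z => 1 / (1 + Complex.exp (β * z)) *
          (1 / (sqrtBranch z + 2 * h) ^ 2)) := by
  rw [susceptibility_eq (log_limitZeta_eq β), Complex.ofReal_mul, (logZeta_derivs hβ hγ).2.2,
    logFunctional₂, contourIntegral_congr (g := fun z => -4 * (1 / (1 + Complex.exp (β * z)) *
      (1 / (sqrtBranch z + 2 * h) ^ 2))) fun t ht => by
        rw [two_mul_limitGreen_div (hγ.avoids t ht), occupation, ← one_div_pow]; ring,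
    contourIntegral_const_mul]
  have h1 : (β : ℂ) ≠ 0 := Complex.ofReal_ne_zero.mpr hβ.ne'
  have h2 : (Real.pi : ℂ) ≠ 0 := Complex.ofReal_ne_zero.mpr Real.pi_ne_zero
  have h3 := Complex.I_ne_zero
  push_cast
  field_simp
  norm_num

theorem chainPartition_eq_mul_exp {L : ℕ} (hL : Even L) (ν : Fin L) (β h : ℝ) :
    chainPartition L ν β h =
      chainPartition L ν β 0 * Real.exp (Real.log (chainZeta L ν β h)) := by
  rw [Real.exp_log (chainZeta_pos hL ν β h), chainZeta,
    mul_div_cancel₀ _ (chainPartition_pos hL ν β 0).ne']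

/-- Normalization only adds a constant to the logarithm, so Z_L and ζ_L have the same field
derivatives. -/
theorem log_chainPartition {L : ℕ} (hL : Even L) (ν : Fin L) (β h : ℝ) :
    Real.log (chainPartition L ν β h) =
      Real.log (chainPartition L ν β 0) + Real.log (chainZeta L ν β h) := by
  rw [chainPartition_eq_mul_exp hL, Real.log_mul (chainPartition_pos hL ν β 0).ne'
    (Real.exp_pos _).ne', Real.log_exp]

variable {β : ℝ}

theorem tendsto_chainZeta (hβ : 0 < β) (ν : ∀ k : ℕ, Fin (2 * k + 2)) (h : ℝ) :
    Tendsto (fun k => chainZeta (2 * k + 2) (ν k) β h) atTop (𝓝 (limitZeta β h)) := by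
  rw [← exp_logZeta]
  exact ((Real.continuous_exp.tendsto _).comp (tendsto_log_chainZeta hβ h ν)).congr fun k =>
    Real.exp_log (chainZeta_pos (even_two_mul_add_two k) _ _ _)

theorem tendsto_magnetization (hβ : 0 < β) (ν : ∀ k : ℕ, Fin (2 * k + 2)) (h : ℝ) :
    Tendsto (fun k => magnetization (chainPartition (2 * k + 2) (ν k) β) β h) atTop
      (𝓝 (magnetization (limitZeta β) β h)) := by
  rw [magnetization_eq (log_limitZeta_eq β)]
  exact ((tendsto_deriv_log_chainZeta hβ h ν).1.const_mul _).congr fun k =>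
    (magnetization_eq (log_chainPartition (even_two_mul_add_two k) _ _) _ _).symm

theorem tendsto_susceptibility (hβ : 0 < β) (ν : ∀ k : ℕ, Fin (2 * k + 2)) (h : ℝ) :
    Tendsto (fun k => susceptibility (chainPartition (2 * k + 2) (ν k) β) β h) atTop
      (𝓝 (susceptibility (limitZeta β) β h)) := by
  rw [susceptibility_eq (log_limitZeta_eq β)]
  exact ((tendsto_deriv_log_chainZeta hβ h ν).2.const_mul _).congr fun k =>
    (susceptibility_eq (log_chainPartition (even_two_mul_add_two k) _ _) _ _).symm

end XYChain

/-! ### The chain with impurity -/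

namespace XYChain

open Matrix in
-- The impurity spin is conserved: for τᶻ = ±1 the coupling shifts the field at ν by ±λ, and the
-- impurity's own energy is ∓h.
theorem impurityHamiltonian_eq {L : ℕ} (ν : Fin L) (lam h : ℝ) :
    impurityHamiltonian L ν lam h = blockDiagonal
      ![chainHamiltonian L ν (h + lam) - (h : ℂ) • 1, chainHamiltonian L ν (h - lam) + (h : ℂ) • 1] := by
  ext ⟨s, a⟩ ⟨t, b⟩
  simp only [impurityHamiltonian, chainHamiltonian, blockDiagonal_apply, kroneckerMap_apply,
    Matrix.sub_apply, Matrix.add_apply, Matrix.smul_apply, smul_eq_mul, pauliZ]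
  fin_cases a <;> fin_cases b <;> simp <;> ring

open Matrix in
theorem trace_exp_shift {X : Type*} [Fintype X] [DecidableEq X] (A : Matrix X X ℂ) (c : ℂ) :
    trace (NormedSpace.exp (A + c • 1)) = Complex.exp c * trace (NormedSpace.exp A) := by
  rw [Matrix.exp_add_of_commute _ _ ((Commute.one_right _).smul_right _),
    exp_smul_of_isIdempotentElem (one_mul 1), sub_smul, one_smul, add_sub_cancel, mul_smul_comm,
    mul_one, trace_smul, smul_eq_mul]

open scoped Matrix.Norms.Operator in
theorem exp_pi_matrix {ι X : Type*} [Finite ι] [Fintype X] [DecidableEq X]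
    (v : ι → Matrix X X ℂ) (i : ι) : NormedSpace.exp v i = NormedSpace.exp (v i) := by
  let _ : NormedAlgebra ℚ (Matrix X X ℂ) := NormedAlgebra.restrictScalars ℚ ℂ _
  exact Pi.coe_exp v i

open Matrix in
theorem impurityPartition_eq {L : ℕ} (ν : Fin L) (β lam h : ℝ) :
    impurityPartition L ν β lam h = Real.exp (β * h) * chainPartition L ν β (h + lam) +
      Real.exp (-(β * h)) * chainPartition L ν β (h - lam) := by
  have h1 : -(β : ℂ) • (chainHamiltonian L ν (h + lam) - (h : ℂ) • 1) =
      -(β : ℂ) • chainHamiltonian L ν (h + lam) + ((β * h : ℝ) : ℂ) • 1 := by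
    rw [smul_sub, smul_smul, sub_eq_add_neg, ← neg_smul]; push_cast; ring_nf
  have h2 : -(β : ℂ) • (chainHamiltonian L ν (h - lam) + (h : ℂ) • 1) =
      -(β : ℂ) • chainHamiltonian L ν (h - lam) + ((-(β * h) : ℝ) : ℂ) • 1 := by
    rw [smul_add, smul_smul]; push_cast; ring_nf
  rw [impurityPartition, impurityHamiltonian_eq, ← blockDiagonal_smul, exp_blockDiagonal,
    trace_blockDiagonal, Fin.sum_univ_two]
  simp only [exp_pi_matrix, Pi.smul_apply, cons_val_zero, cons_val_one, h1, h2, trace_exp_shift,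
    Complex.add_re, ← Complex.ofReal_exp, Complex.re_ofReal_mul, chainPartition]

/-- The free energy of an impurity spin in the field `h`, coupled to a system with free energy
`f`. -/
noncomputable def impurityLog (β lam : ℝ) (f : ℝ → ℝ) (h : ℝ) : ℝ :=
  Real.log (Real.exp (β * h + f (h + lam)) + Real.exp (-(β * h) + f (h - lam)))

/-- The mean of `p` and `q` with weights `exp u` and `exp v`. -/
noncomputable def gibbsMean (u v p q : ℝ) : ℝ :=
  (Real.exp u * p + Real.exp v * q) / (Real.exp u + Real.exp v)

theorem exp_add_exp_ne_zero (u v : ℝ) : Real.exp u + Real.exp v ≠ 0 := by positivity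

theorem hasDerivAt_log_exp_add_exp {u v : ℝ → ℝ} {u' v' h : ℝ} (hu : HasDerivAt u u' h)
    (hv : HasDerivAt v v' h) :
    HasDerivAt (fun x => Real.log (Real.exp (u x) + Real.exp (v x)))
      (gibbsMean (u h) (v h) u' v') h :=
  (hu.exp.fun_add hv.exp).log (exp_add_exp_ne_zero _ _)

/-- When p and q are the derivatives of the exponents, differentiating the weights produces the
variance of the two values. -/
theorem hasDerivAt_gibbsMean {u v p q : ℝ → ℝ} {p' q' h : ℝ} (hu : HasDerivAt u (p h) h)
    (hv : HasDerivAt v (q h) h) (hp : HasDerivAt p p' h) (hq : HasDerivAt q q' h) :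
    HasDerivAt (fun x => gibbsMean (u x) (v x) (p x) (q x))
      (gibbsMean (u h) (v h) (p h ^ 2 + p') (q h ^ 2 + q') -
        gibbsMean (u h) (v h) (p h) (q h) ^ 2) h := by
  refine (((hu.exp.fun_mul hp).fun_add (hv.exp.fun_mul hq)).fun_div (hu.exp.fun_add hv.exp)
    (exp_add_exp_ne_zero _ _)).congr_deriv ?_
  have := exp_add_exp_ne_zero (u h) (v h)
  unfold gibbsMean
  field_simp

theorem tendsto_gibbsMean {ι : Type*} {l : Filter ι} {u v p q : ι → ℝ} {u₀ v₀ p₀ q₀ : ℝ}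
    (hu : Tendsto u l (𝓝 u₀)) (hv : Tendsto v l (𝓝 v₀)) (hp : Tendsto p l (𝓝 p₀))
    (hq : Tendsto q l (𝓝 q₀)) :
    Tendsto (fun i => gibbsMean (u i) (v i) (p i) (q i)) l (𝓝 (gibbsMean u₀ v₀ p₀ q₀)) := by
  have hu' := (Real.continuous_exp.tendsto _).comp hu
  have hv' := (Real.continuous_exp.tendsto _).comp hv
  exact ((hu'.mul hp).add (hv'.mul hq)).div (hu'.add hv') (exp_add_exp_ne_zero _ _)

section Derivatives

variable {f : ℝ → ℝ} (β lam : ℝ)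

theorem deriv_impurityLog (hf : ∀ x, HasDerivAt f (deriv f x) x) :
    deriv (impurityLog β lam f) = fun h =>
      gibbsMean (β * h + f (h + lam)) (-(β * h) + f (h - lam)) (β + deriv f (h + lam))
        (-β + deriv f (h - lam)) := by
  funext h
  refine (hasDerivAt_log_exp_add_exp ?_ ?_).deriv
  · exact (hasDerivAt_const_mul β).fun_add ((hf (h + lam)).comp_add_const h lam)
  · exact (hasDerivAt_const_mul β).fun_neg.fun_add ((hf (h - lam)).comp_sub_const h lam)

theorem deriv_deriv_impurityLog (hf : ∀ x, HasDerivAt f (deriv f x) x)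
    (hf' : ∀ x, HasDerivAt (deriv f) (deriv (deriv f) x) x) (h : ℝ) :
    deriv (deriv (impurityLog β lam f)) h =
      gibbsMean (β * h + f (h + lam)) (-(β * h) + f (h - lam))
        ((β + deriv f (h + lam)) ^ 2 + deriv (deriv f) (h + lam))
        ((-β + deriv f (h - lam)) ^ 2 + deriv (deriv f) (h - lam)) -
      gibbsMean (β * h + f (h + lam)) (-(β * h) + f (h - lam)) (β + deriv f (h + lam))
        (-β + deriv f (h - lam)) ^ 2 := by
  rw [deriv_impurityLog β lam hf]
  refine (hasDerivAt_gibbsMean (u := fun h => β * h + f (h + lam))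
    (v := fun h => -(β * h) + f (h - lam)) (p := fun h => β + deriv f (h + lam))
    (q := fun h => -β + deriv f (h - lam)) ?_ ?_ ?_ ?_).deriv
  · exact (hasDerivAt_const_mul β).fun_add ((hf (h + lam)).comp_add_const h lam)
  · exact (hasDerivAt_const_mul β).fun_neg.fun_add ((hf (h - lam)).comp_sub_const h lam)
  · exact ((hf' (h + lam)).comp_add_const h lam).const_add β
  · exact ((hf' (h - lam)).comp_sub_const h lam).const_add (-β)

end Derivatives

/-- The normalized partition function of the infinite chain with impurity. -/
noncomputable def limitImpurityZeta (β lam h : ℝ) : ℝ :=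
  Real.exp (β * h) * limitZeta β (h + lam) + Real.exp (-(β * h)) * limitZeta β (h - lam)

theorem log_limitImpurityZeta (β lam h : ℝ) :
    Real.log (limitImpurityZeta β lam h) = 0 + impurityLog β lam (logZeta β) h := by
  rw [impurityLog, Real.exp_add, Real.exp_add, exp_logZeta, exp_logZeta, zero_add,
    limitImpurityZeta]

theorem impurityPartition_eq_mul {L : ℕ} (hL : Even L) (ν : Fin L) (β lam h : ℝ) :
    impurityPartition L ν β lam h = chainPartition L ν β 0 *
      (Real.exp (β * h) * chainZeta L ν β (h + lam) +
        Real.exp (-(β * h)) * chainZeta L ν β (h - lam)) := by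
  have := (chainPartition_pos hL ν β 0).ne'
  rw [impurityPartition_eq, chainZeta, chainZeta]
  field_simp

theorem log_impurityPartition {L : ℕ} (hL : Even L) (ν : Fin L) (β lam h : ℝ) :
    Real.log (impurityPartition L ν β lam h) = Real.log (chainPartition L ν β 0) +
      impurityLog β lam (fun y => Real.log (chainZeta L ν β y)) h := by
  have h1 := chainZeta_pos hL ν β (h + lam)
  have h2 := chainZeta_pos hL ν β (h - lam)
  rw [impurityPartition_eq_mul hL, impurityLog, Real.exp_add, Real.exp_add, Real.exp_log h1,
    Real.exp_log h2, Real.log_mul (chainPartition_pos hL ν β 0).ne' (by positivity)]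

/-! ### Thermodynamic and zero-temperature limits with the impurity -/

variable {β : ℝ}

theorem tendsto_impurityPartition (hβ : 0 < β) (lam : ℝ) (ν : ∀ k : ℕ, Fin (2 * k + 2)) (h : ℝ) :
    Tendsto (fun k => impurityPartition (2 * k + 2) (ν k) β lam h /
      chainPartition (2 * k + 2) (ν k) β 0) atTop (𝓝 (limitImpurityZeta β lam h)) :=
  (((tendsto_chainZeta hβ ν (h + lam)).const_mul _).add
    ((tendsto_chainZeta hβ ν (h - lam)).const_mul _)).congr fun k => by
    rw [impurityPartition_eq_mul (even_two_mul_add_two k),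
      mul_div_cancel_left₀ _ (chainPartition_pos (even_two_mul_add_two k) _ _ _).ne']

theorem hasDerivAt_log_chainZeta (hβ : 0 < β) {L : ℕ} (hL : Even L) (ν : Fin L) (x : ℝ) :
    HasDerivAt (fun y => Real.log (chainZeta L ν β y))
      (deriv (fun y => Real.log (chainZeta L ν β y)) x) x ∧
    HasDerivAt (deriv fun y => Real.log (chainZeta L ν β y))
      (deriv (deriv fun y => Real.log (chainZeta L ν β y)) x) x := by
  obtain ⟨γ, hγ⟩ := exists_isThermalContour hβ x
  have h1 := log_chainZeta_derivs hβ hL ν hγ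
  exact ⟨h1.1.1, h1.2.1⟩

theorem hasDerivAt_logZeta_deriv (β x : ℝ) : HasDerivAt (logZeta β) (deriv (logZeta β) x) x :=
  (hasDerivAt_logZeta β x).differentiableAt.hasDerivAt

theorem hasDerivAt_deriv_logZeta_deriv (β x : ℝ) :
    HasDerivAt (deriv (logZeta β)) (deriv (deriv (logZeta β)) x) x :=
  (hasDerivAt_deriv_logZeta β x).differentiableAt.hasDerivAt

theorem tendsto_magnetization_impurity (hβ : 0 < β) (lam : ℝ) (ν : ∀ k : ℕ, Fin (2 * k + 2))
    (h : ℝ) :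
    Tendsto (fun k => magnetization (impurityPartition (2 * k + 2) (ν k) β lam) β h) atTop
      (𝓝 (magnetization (limitImpurityZeta β lam) β h)) := by
  have he := even_two_mul_add_two
  rw [magnetization_eq (log_limitImpurityZeta β lam),
    deriv_impurityLog β lam (hasDerivAt_logZeta_deriv β)]
  refine Tendsto.congr (fun k => (magnetization_eq (log_impurityPartition (he k) _ _ _) _ _).symm)
    (Tendsto.const_mul _ ?_)
  simp only [fun k => deriv_impurityLog β lam
    fun x => (hasDerivAt_log_chainZeta hβ (he k) (ν k) x).1]
  exact tendsto_gibbsMean ((tendsto_log_chainZeta hβ (h + lam) ν).const_add _)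
    ((tendsto_log_chainZeta hβ (h - lam) ν).const_add _)
    ((tendsto_deriv_log_chainZeta hβ (h + lam) ν).1.const_add _)
    ((tendsto_deriv_log_chainZeta hβ (h - lam) ν).1.const_add _)

theorem tendsto_susceptibility_impurity (hβ : 0 < β) (lam : ℝ) (ν : ∀ k : ℕ, Fin (2 * k + 2))
    (h : ℝ) :
    Tendsto (fun k => susceptibility (impurityPartition (2 * k + 2) (ν k) β lam) β h) atTop
      (𝓝 (susceptibility (limitImpurityZeta β lam) β h)) := by
  have he := even_two_mul_add_two
  rw [susceptibility_eq (log_limitImpurityZeta β lam),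
    deriv_deriv_impurityLog β lam (hasDerivAt_logZeta_deriv β) (hasDerivAt_deriv_logZeta_deriv β)]
  refine Tendsto.congr (fun k => (susceptibility_eq (log_impurityPartition (he k) _ _ _) _ _).symm)
    (Tendsto.const_mul _ ?_)
  simp only [fun k => deriv_deriv_impurityLog β lam
    (fun x => (hasDerivAt_log_chainZeta hβ (he k) (ν k) x).1)
    (fun x => (hasDerivAt_log_chainZeta hβ (he k) (ν k) x).2)]
  have hu := (tendsto_log_chainZeta hβ (h + lam) ν).const_add (β * h)
  have hv := (tendsto_log_chainZeta hβ (h - lam) ν).const_add (-(β * h))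
  obtain ⟨p1, p2⟩ := tendsto_deriv_log_chainZeta hβ (h + lam) ν
  obtain ⟨q1, q2⟩ := tendsto_deriv_log_chainZeta hβ (h - lam) ν
  have hp := p1.const_add β
  have hq := q1.const_add (-β)
  exact (tendsto_gibbsMean hu hv ((hp.pow 2).add p2) ((hq.pow 2).add q2)).sub
    ((tendsto_gibbsMean hu hv hp hq).pow 2)

/-- By evenness of ζ the two impurity states have equal weight and the same χ at zero field, while
the slopes of their exponents are ±β(m + 1). The mean slope vanishes, and the mean square gives the
extra term. -/
theorem susceptibility_impurity_zero (hβ : 0 < β) (lam : ℝ) :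
    susceptibility (limitImpurityZeta β lam) β 0 =
      susceptibility (limitZeta β) β lam + β * (magnetization (limitZeta β) β lam + 1) ^ 2 := by
  rw [susceptibility_eq (log_limitImpurityZeta β lam), susceptibility_eq (log_limitZeta_eq β),
    magnetization_eq (log_limitZeta_eq β),
    deriv_deriv_impurityLog β lam (hasDerivAt_logZeta_deriv β) (hasDerivAt_deriv_logZeta_deriv β)]
  have h1 : deriv (logZeta β) (-lam) = -deriv (logZeta β) lam := by
    simp only [deriv_logZeta, neg_sq]; ring
  have h2 : deriv (deriv (logZeta β)) (-lam) = deriv (deriv (logZeta β)) lam := by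
    simp only [deriv_deriv_logZeta, neg_sq]
  simp only [mul_zero, zero_add, neg_zero, zero_sub, logZeta_neg, h1, h2, gibbsMean]
  have := Real.exp_pos (logZeta β lam)
  field_simp
  ring

/-- At zero temperature m + 1 tends to 1 + 2λ/√(1+4λ²), which is positive even for λ < 0 because
√(1+4λ²) > 2|λ|. So the term linear in β wins for either sign. -/
theorem tendsto_susceptibility_impurity_zero (lam : ℝ) :
    Tendsto (fun β => susceptibility (limitImpurityZeta β lam) β 0) atTop atTop := by
  have h1 : Tendsto (fun β : ℝ => susceptibility (limitZeta β) β lam +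
      β * (magnetization (limitZeta β) β lam + 1) ^ 2) atTop atTop := by
    refine (tendsto_susceptibility_limitZeta lam).add_atTop (tendsto_id.atTop_mul_pos ?_
      (((tendsto_magnetization_limitZeta lam).add_const 1).pow 2))
    have h2 : -(2 * lam) < Real.sqrt (1 + 4 * lam ^ 2) :=
      Real.lt_sqrt_of_sq_lt (by nlinarith)
    have h3 := sqrt_one_add_pos lam
    have h4 : 0 < 2 * lam / Real.sqrt (1 + 4 * lam ^ 2) + 1 := by
      rw [div_add_one h3.ne']; exact div_pos (by linarith) h3
    positivity
  refine h1.congr' ?_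
  filter_upwards [eventually_gt_atTop 0] with β hβ
  rw [susceptibility_impurity_zero hβ]

/-- A property holding for all small fields holds at h = 0 itself, where divergence at λ = -1
excludes a finite limit. -/
theorem not_exhibitsKondoEffect {X : ℝ → ℝ → ℝ → ℝ}
    (hX : ∀ lam, Tendsto (fun β => X lam β 0) atTop atTop) : ¬ ExhibitsKondoEffect X := by
  rintro ⟨h, _⟩
  obtain ⟨X₀, h1, _⟩ := h (-1) neg_one_lt_zero
  exact not_tendsto_nhds_of_tendsto_atTop (hX (-1)) _ h1.self_of_nhds

end XYChain

theorem mainTheorem6 :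
    -- finite volume: the partition function
    (∀ (L : ℕ), Even L → ∀ (ν : Fin L) (β h : ℝ), 0 < β →
      0 < XYChain.chainZeta L ν β h ∧
      ∀ γ : ℝ → ℂ, XYChain.IsThermalContour β (XYChain.finiteSingularities L h) γ →
        (Real.log (XYChain.chainZeta L ν β h) : ℂ) =
          -(β * h : ℂ) + (2 * Real.pi * Complex.I)⁻¹ *
            XYChain.contourIntegral γ (fun z => XYChain.logOnePlusExp β z *
              (deriv (XYChain.finiteF L h) z / XYChain.finiteF L h z))) ∧
    -- the partition function at zero field is extensive
    (∀ β : ℝ, 0 < β → ∃ C : ℝ, ∀ (L : ℕ), Even L → ∀ ν : Fin L,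
      XYChain.chainPartition L ν β 0 ≤ Real.exp (C * L)) ∧
    -- the limit of `F_L`
    (∀ (h : ℝ) (z : ℂ), z ∉ Complex.ofReal '' Set.Icc (-1) 1 →
      Tendsto (fun k : ℕ => XYChain.finiteF (2 * k + 2) h z) atTop
        (𝓝 (1 + 2 * h / XYChain.sqrtBranch z)) ∧
      1 + (2 * h / Real.pi : ℂ) * ∫ q in (0 : ℝ)..Real.pi, 1 / (z + (Real.cos q : ℂ)) =
        1 + 2 * h / XYChain.sqrtBranch z) ∧
    -- thermodynamic limit, without (`ζ`) and with (`ζint`) the impurity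
    ∃ (ζ : ℝ → ℝ → ℝ) (ζint : ℝ → ℝ → ℝ → ℝ),
      (∀ β : ℝ, 0 < β →
        (∀ h : ℝ, 0 < ζ β h) ∧ ContDiff ℝ ((⊤ : ℕ∞) : WithTop ℕ∞) (ζ β) ∧
        (∀ h : ℝ, ζ β (-h) = ζ β h) ∧
        (∀ (ν : ∀ k : ℕ, Fin (2 * k + 2)) (h : ℝ),
          Tendsto (fun k => XYChain.chainZeta (2 * k + 2) (ν k) β h) atTop (𝓝 (ζ β h)) ∧
          Tendsto (fun k =>
              XYChain.magnetization (XYChain.chainPartition (2 * k + 2) (ν k) β) β h) atTop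
            (𝓝 (XYChain.magnetization (ζ β) β h)) ∧
          Tendsto (fun k =>
              XYChain.susceptibility (XYChain.chainPartition (2 * k + 2) (ν k) β) β h) atTop
            (𝓝 (XYChain.susceptibility (ζ β) β h))) ∧
        (∀ (h : ℝ) (γ : ℝ → ℂ), XYChain.IsThermalContour β (XYChain.limitInterval h) γ →
          (Real.log (ζ β h) : ℂ) =
            -(β * h : ℂ) + β / (2 * Real.pi * Complex.I) *
              XYChain.contourIntegral γ (fun z => 1 / (1 + Complex.exp (β * z)) *
                Complex.log (1 + 2 * h / XYChain.sqrtBranch z)) ∧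
          (XYChain.magnetization (ζ β) β h : ℂ) =
            -1 + 1 / (Real.pi * Complex.I) *
              XYChain.contourIntegral γ (fun z => 1 / (1 + Complex.exp (β * z)) *
                (1 / (XYChain.sqrtBranch z + 2 * h))) ∧
          (XYChain.susceptibility (ζ β) β h : ℂ) =
            -(2 / (Real.pi * Complex.I)) *
              XYChain.contourIntegral γ (fun z => 1 / (1 + Complex.exp (β * z)) *
                (1 / (XYChain.sqrtBranch z + 2 * h) ^ 2))) ∧
        XYChain.susceptibility (ζ β) β 0 = 2 * Real.sinh β / (1 + Real.cosh β)) ∧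
      (∀ h : ℝ,
        Tendsto (fun β => XYChain.magnetization (ζ β) β h) atTop
          (𝓝 (2 * h / Real.sqrt (1 + 4 * h ^ 2))) ∧
        Tendsto (fun β => XYChain.susceptibility (ζ β) β h) atTop
          (𝓝 (2 / (1 + 4 * h ^ 2) ^ (3 / 2 : ℝ)))) ∧
      (∀ β : ℝ, 0 < β → ∀ lam : ℝ,
        (∀ h : ℝ, ζint β lam h =
          Real.exp (β * h) * ζ β (h + lam) + Real.exp (-(β * h)) * ζ β (h - lam)) ∧
        (∀ (ν : ∀ k : ℕ, Fin (2 * k + 2)) (h : ℝ),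
          Tendsto (fun k => XYChain.impurityPartition (2 * k + 2) (ν k) β lam h /
              XYChain.chainPartition (2 * k + 2) (ν k) β 0) atTop (𝓝 (ζint β lam h)) ∧
          Tendsto (fun k =>
              XYChain.magnetization (XYChain.impurityPartition (2 * k + 2) (ν k) β lam) β h) atTop
            (𝓝 (XYChain.magnetization (ζint β lam) β h)) ∧
          Tendsto (fun k =>
              XYChain.susceptibility (XYChain.impurityPartition (2 * k + 2) (ν k) β lam) β h) atTop
            (𝓝 (XYChain.susceptibility (ζint β lam) β h))) ∧
        XYChain.susceptibility (ζint β lam) β 0 =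
          XYChain.susceptibility (ζ β) β lam +
            β * (XYChain.magnetization (ζ β) β lam + 1) ^ 2) ∧
      (∀ lam : ℝ,
        Tendsto (fun β => XYChain.susceptibility (ζint β lam) β 0) atTop atTop) ∧
      ¬ XYChain.ExhibitsKondoEffect
        (fun lam β h => XYChain.susceptibility (ζint β lam) β h) := by
  refine ⟨fun L hL ν β h hβ => ⟨XYChain.chainZeta_pos hL ν β h, fun γ hγ =>
    XYChain.log_chainZeta_contour hβ hL ν hγ⟩, fun β hβ => ⟨_, fun L hL ν =>
    XYChain.chainPartition_zero_le hβ hL ν⟩, fun h z hz => ⟨XYChain.tendsto_finiteF h hz, ?_⟩,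
    XYChain.limitZeta, XYChain.limitImpurityZeta, fun β hβ => ⟨XYChain.limitZeta_pos β,
    XYChain.contDiff_limitZeta β, XYChain.limitZeta_neg β, fun ν h =>
    ⟨XYChain.tendsto_chainZeta hβ ν h, XYChain.tendsto_magnetization hβ ν h,
    XYChain.tendsto_susceptibility hβ ν h⟩, fun h γ hγ => ⟨XYChain.log_limitZeta_contour hβ hγ,
    XYChain.magnetization_limitZeta_contour hβ hγ,
    XYChain.susceptibility_limitZeta_contour hβ hγ⟩, XYChain.susceptibility_limitZeta_zero hβ⟩,
    fun h => ⟨XYChain.tendsto_magnetization_limitZeta h,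
    XYChain.tendsto_susceptibility_limitZeta h⟩, fun β hβ lam => ⟨fun h => rfl, fun ν h =>
    ⟨XYChain.tendsto_impurityPartition hβ lam ν h,
    XYChain.tendsto_magnetization_impurity hβ lam ν h,
    XYChain.tendsto_susceptibility_impurity hβ lam ν h⟩,
    XYChain.susceptibility_impurity_zero hβ lam⟩,
    XYChain.tendsto_susceptibility_impurity_zero,
    XYChain.not_exhibitsKondoEffect XYChain.tendsto_susceptibility_impurity_zero⟩
  rw [XYChain.integral_inv_add_cos hz]
  have h1 : (Real.pi : ℂ) ≠ 0 := Complex.ofReal_ne_zero.mpr Real.pi_ne_zero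
  field_simp
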